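/- **Setting.** Let $K$ be a bounded symmetric kernel of order $r\ge 1$ supported in $[-1,1]$: $\int K=1$ and $\int u^kK(u)\,du=0$ for $1\le k\le r-1$. Let $X_1,\dots,X_n$ be i.i.d. with density $f$ on $\mathbb R$, and $\hat f_h(x)=\frac1n\sum_{i=1}^n\frac1hK\big(\frac{X_i-x}{h}\big)$. Fix $p\ge1$, $1<a\le2$, $D_1\ge1$, $D_2>4p$, $L,M>0$, and set $\mathcal H_n=\{a^{-j}:0\le j\le\lfloor\log_a(n/\log^3n)\rfloor\}$, $v^2(h)=\frac{M\|K\|_2^2}{nh}$, $v^2(h,\eta)=\frac{M}{nh}\int_{-1}^1\big(K(u)-\frac h\eta K(\frac{uh}\eta)\big)^2du$, $\lambda(h)=1\vee\sqrt{D_2\log(1/h)}$, $\psi(h,\eta)=2D_1v(h)\lambda(h)+v(h,\eta)\lambda(\eta)$, $$\hat h_n(x)=\sup\{h\in\mathcal H_n:\ |\hat f_h(x)-\hat f_\eta(x)|\le\psi(h,\eta)\ \ \forall\eta\in\mathcal H_n,\ \eta<h\},$$ and let $\hat f_{\hat h_n}$ denote the estimator $x\mapsto\hat f_{\hat h_n(x)}(x)$,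 which uses neither the regularities nor the break points. **Classes.** Let $I=\,]A,B[$, $-\infty\le A<B\le\infty$. For $\alpha>0$ let $\lfloor\alpha\rfloor$ be the largest integer strictly less than $\alpha$, and $\lfloor0\rfloor:=0$. For an interval $J$, $\Sigma(\alpha,L,M,J)$ is the set of $f$ with $|f|\le M$ on $J$ and $|f^{(\lfloor\alpha\rfloor)}(x)-f^{(\lfloor\alpha\rfloor)}(x')|\le L|x-x'|^{\alpha-\lfloor\alpha\rfloor}$ for $x,x'\in J$, $|x-x'|\le1$, where moreover $f\in C^{\lfloor\alpha\rfloor}(J)$ if $\alpha>0$. For $\mathbf x=(x_1,\dots,x_m)$ with $A=x_0<x_1<\dots<x_m<x_{m+1}=B$, $\Sigma_{pw}(\mathbf x,\alpha,L,M,I)$ is the set of $f$ that coincide on each $]x_i,x_{i+1}[$, $0\le i\le m$, with an element of $\Sigma(\alpha,L,M,[x_i,x_{i+1}])$ (intervals being left open at infinite end points). For an integer $\ell$, $\gamma>0$ and $\mathbf x\in I^m$, $D_{pw}(\mathbf x,\ell,\gamma,L,M,I)$ is the set of $f$ with $|f|\le M$ on $I$ such that for all $x\in I\setminus\{x_1,\dots,x_m\}$,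 $f^{(\ell)}(x)$ exists and $|f^{(\ell)}(x)|\le L(\max_i|x-x_i|^{-\gamma}\vee1)$. **Result.** Let $\beta\ge0$. Let $I_0=[c,d]$ be compact with $]c-\delta,d+\delta[\,\subseteq I$ for some $\delta>0$. In each case below the bound holds for all $n\ge n_0$, where $C>0$ and $n_0$ depend only on $p,K,r,a,D_1,D_2,L,M$, the regularity parameters, $m$, $\delta$ and an upper bound for the length of $I_0$ (not on $f$, on the positions of the $x_i$, or otherwise on $I,I_0$). 1. If $f\in\Sigma_{pw}(\mathbf x,\alpha,L,M,I)\cap\Sigma(\beta,L,M,I)$ is a density, with $\beta<\alpha\le r$, and if $\beta>0$ or $p\alpha<2\alpha+1$ or $p\ge6$, then $$\mathbb E\|\hat f_{\hat h_n}-f\|_{p,I_0}^p\le C(\log n)^{\frac p2}\Big(n^{-\frac{1+p\beta}{1+2\beta}}+n^{-\frac{p\alpha}{2\alpha+1}}\Big).$$ If $\beta=0$, then for every $p\ge1$ the bound holds with $C\frac{\log^3n}{n}$ added to the right-hand side. 2. If $f\in D_{pw}(\mathbf x,\ell,\gamma,L,M,I)\cap\Sigma(\beta,L,M,I)$ is a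 density, with $\beta<\ell\le r$ and $0<\gamma\le\ell-\beta$, and if $\beta>0$ or $p\ell<2\ell+1$ or $p\ge6$, then $$\mathbb E\|\hat f_{\hat h_n}-f\|_{p,I_0}^p\le C(\log n)^{\frac p2}\Big(n^{-\frac{1+p\beta}{1+2\beta}}+\log(n)\,n^{-\frac{p\ell}{2\ell+1}}\Big).$$ If $\beta=0$, then for every $p\ge1$ the bound holds with $C\frac{\log^3n}{n}$ added to the right-hand side. 3. If $f\in D_{pw}(\mathbf x,\ell,\gamma,L,M,I)\cap\Sigma(\beta,L,M,I)$ is a density, with $\beta<\ell\le r$ and $\gamma>\ell-\beta$, and if $\beta>0$ or $p\gamma<2\ell+1$ or $(p+2)\gamma\ge6\ell$, then $$\mathbb E\|\hat f_{\hat h_n}-f\|_{p,I_0}^p\le C(\log n)^{\frac p2+1}\Big(n^{-\left(\frac{p\beta}{1+2\beta}+\frac{(\ell-\beta)/\gamma}{2\beta+1}\right)}+n^{-\frac{p\ell}{2\ell+1}}\Big).$$ If $\beta=0$, then for every $p\ge1$ the bound holds with $C\big(\frac{\log^3n}{n}\big)^{\ell/\gamma}$ added to the right-hand side. -/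

import Mathlib

open MeasureTheory Set
open scoped ENNReal

noncomputable section

namespace AdaptiveKDE

/-! ### Kernels, densities, kernel estimators -/

/-- `K` is a bounded symmetric kernel of order `r ≥ 1` with support in `[-1,1]`. -/
structure IsKernelOfOrder (K : ℝ → ℝ) (r : ℕ) : Prop where
  order_pos : 1 ≤ r
  measurable : Measurable K
  bounded : ∃ B : ℝ, ∀ u, |K u| ≤ B
  symmetric : ∀ u, K (-u) = K u
  support : ∀ u, 1 < |u| → K u = 0
  integral_eq_one : ∫ u, K u = 1
  moments : ∀ k : ℕ, 1 ≤ k → k < r → ∫ u, u ^ k * K u = 0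

/-- `f` is a probability density on `ℝ` with respect to Lebesgue measure. -/
structure IsDensity (f : ℝ → ℝ) : Prop where
  measurable : Measurable f
  nonneg : ∀ x, 0 ≤ f x
  lintegral_eq_one : ∫⁻ x, ENNReal.ofReal (f x) = 1

/-- The law of `(X₁, …, Xₙ)`, independent with common density `f`. -/
def sampleLaw (f : ℝ → ℝ) (n : ℕ) : Measure (Fin n → ℝ) :=
  Measure.pi fun _ : Fin n => (volume : Measure ℝ).withDensity fun x => ENNReal.ofReal (f x)

/-- The kernel estimator `f̂_h(x) = n⁻¹ ∑ᵢ K_h(Xᵢ - x)` with `K_h(u) = h⁻¹ K(u / h)`. -/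
def kde (K : ℝ → ℝ) {n : ℕ} (X : Fin n → ℝ) (h x : ℝ) : ℝ :=
  (1 / (n : ℝ)) * ∑ i, (1 / h) * K ((X i - x) / h)

/-! ### The data-driven bandwidth -/

/-- The grid `{a⁻ʲ : 0 ≤ j ≤ J}` with `J = ⌊log_a (n / log³ n)⌋`. -/
def bandwidths (a : ℝ) (n : ℕ) : Set ℝ :=
  {h | ∃ j : ℕ, (j : ℤ) ≤ ⌊Real.logb a ((n : ℝ) / Real.log n ^ 3)⌋ ∧ h = (a ^ j)⁻¹}

/-- `v(h)`, where `v²(h) = M ‖K‖₂² / (n h)`. -/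
def vOne (K : ℝ → ℝ) (M : ℝ) (n : ℕ) (h : ℝ) : ℝ :=
  Real.sqrt (M * (∫ u, K u ^ 2) / (n * h))

/-- `v(h, η)`, where `v²(h, η) = M / (n h) * ∫_{-1}^{1} (K(u) - (h / η) K(u h / η))² du`. -/
def vTwo (K : ℝ → ℝ) (M : ℝ) (n : ℕ) (h η : ℝ) : ℝ :=
  Real.sqrt (M / (n * h) * ∫ u in (-1 : ℝ)..1, (K u - h / η * K (u * h / η)) ^ 2)

/-- `λ(h) = 1 ∨ √(D₂ log (1 / h))`. -/
def lam (D₂ h : ℝ) : ℝ := max 1 (Real.sqrt (D₂ * Real.log (1 / h)))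

/-- The threshold `ψ(h, η) = 2 D₁ v(h) λ(h) + v(h, η) λ(η)`. -/
def psi (K : ℝ → ℝ) (M D₁ D₂ : ℝ) (n : ℕ) (h η : ℝ) : ℝ :=
  2 * D₁ * vOne K M n h * lam D₂ h + vTwo K M n h η * lam D₂ η

/-- The selected bandwidth `ĥₙ(x)`. -/
def hHat (K : ℝ → ℝ) (a M D₁ D₂ : ℝ) {n : ℕ} (X : Fin n → ℝ) (x : ℝ) : ℝ :=
  sSup {h | h ∈ bandwidths a n ∧ ∀ η ∈ bandwidths a n, η < h →
    |kde K X h x - kde K X η x| ≤ psi K M D₁ D₂ n h η}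

/-- The adaptive estimator `x ↦ f̂_{ĥₙ(x)}(x)`. -/
def adaptiveEstimator (K : ℝ → ℝ) (a M D₁ D₂ : ℝ) {n : ℕ} (X : Fin n → ℝ) (x : ℝ) : ℝ :=
  kde K X (hHat K a M D₁ D₂ X x) x

/-- The risk `𝔼 ‖f̂_{ĥₙ} - f‖_{p,[c,d]}^p` for `n` independent observations of density `f`. -/
def adaptiveRisk (K : ℝ → ℝ) (a M D₁ D₂ p : ℝ) (n : ℕ) (f : ℝ → ℝ) (c d : ℝ) : ℝ≥0∞ :=
  ∫⁻ X : Fin n → ℝ, (∫⁻ x : ℝ in Icc c d,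
    ENNReal.ofReal (|adaptiveEstimator K a M D₁ D₂ X x - f x| ^ p)) ∂(sampleLaw f n)

/-! ### Regularity classes -/

/-- The real points of the open interval `]A, B[`, where `A`, `B` may be infinite. -/
def openIv (A B : EReal) : Set ℝ := {t | A < (t : EReal) ∧ (t : EReal) < B}

/-- The real points of the closed interval `[A, B]`, where `A`, `B` may be infinite. -/
def closedIv (A B : EReal) : Set ℝ := {t | A ≤ (t : EReal) ∧ (t : EReal) ≤ B}

/-- The largest integer strictly less than `α` if `α > 0`; it is `0` for `α = 0`. -/
def strictFloor (α : ℝ) : ℕ := ⌈α⌉₊ - 1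

/-- The Hölder class `Σ(α, L, M, I)`. For `α = 0` no continuity is required: the functions are
bounded by `M` and vary by at most `L` between points at distance at most `1`. -/
def Holder (α L M : ℝ) (I : Set ℝ) : Set (ℝ → ℝ) :=
  {f | (0 < α → ContDiffOn ℝ (strictFloor α) f I) ∧
    (∀ x ∈ I, |f x| ≤ M) ∧
    ∀ x ∈ I, ∀ x' ∈ I, |x - x'| ≤ 1 →
      |iteratedDerivWithin (strictFloor α) f I x - iteratedDerivWithin (strictFloor α) f I x'|
        ≤ L * |x - x'| ^ (α - strictFloor α)}

/-- The points `x₀ = A, x₁, …, x_m, x_{m+1} = B`. -/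
def nodes (A B : EReal) {m : ℕ} (x : Fin m → ℝ) : Fin (m + 2) → EReal :=
  Fin.cons A (Fin.snoc (fun i => (x i : EReal)) B : Fin (m + 1) → EReal)

/-- The piecewise Hölder class `Σ_pw(x, α, L, M, ]A, B[)`: on every `]xᵢ, xᵢ₊₁[` the function
coincides with an element of `Σ(α, L, M, [xᵢ, xᵢ₊₁])`. -/
def PwHolder (A B : EReal) {m : ℕ} (x : Fin m → ℝ) (α L M : ℝ) : Set (ℝ → ℝ) :=
  {f | StrictMono (nodes A B x) ∧
    ∀ i : Fin (m + 1), ∃ g ∈ Holder α L M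
        (closedIv (nodes A B x i.castSucc) (nodes A B x i.succ)),
      EqOn f g (openIv (nodes A B x i.castSucc) (nodes A B x i.succ))}

/-- The piecewise differentiable class `D_pw(x, ℓ, γ, L, M, ]A, B[)`. -/
def PwDiff (A B : EReal) {m : ℕ} (x : Fin m → ℝ) (ℓ : ℕ) (γ L M : ℝ) : Set (ℝ → ℝ) :=
  {f | (∀ i, x i ∈ openIv A B) ∧
    (∀ t ∈ openIv A B, |f t| ≤ M) ∧
    ∀ t ∈ openIv A B, t ∉ range x →
      (∀ k < ℓ, DifferentiableAt ℝ (iteratedDeriv k f) t) ∧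
      |iteratedDeriv ℓ f t| ≤ L * max (⨆ i, |t - x i| ^ (-γ)) 1}

/-! ### Upper bounds on the risk -/

/-- The risk of the adaptive estimator is at most `C * rate n` for all large `n`, uniformly over
the intervals `I = ]A, B[`, the compact intervals `I₀ = [c, d]` of length at most `T` with
`]c - δ, d + δ[ ⊆ I`, the vectors `x` of `m` break points, and the densities `f` in the class
`F A B x`. -/
def RiskBound (K : ℝ → ℝ) (a M D₁ D₂ p T δ : ℝ) (m : ℕ)
    (F : EReal → EReal → (Fin m → ℝ) → Set (ℝ → ℝ)) (rate : ℕ → ℝ) : Prop :=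
  ∃ C : ℝ, 0 < C ∧ ∃ n₀ : ℕ,
    ∀ (A B : EReal) (c d : ℝ), c ≤ d → d - c ≤ T → Ioo (c - δ) (d + δ) ⊆ openIv A B →
    ∀ (x : Fin m → ℝ) (f : ℝ → ℝ), IsDensity f → f ∈ F A B x →
    ∀ n : ℕ, n₀ ≤ n → adaptiveRisk K a M D₁ D₂ p n f c d ≤ ENNReal.ofReal (C * rate n)

end AdaptiveKDE

end

open AdaptiveKDE

/-! ### Elementary inequalities -/

/-! The proof has a stochastic half, an oracle inequality at a fixed point, and an analytic half,
which integrates it over the distance to the break points.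

Oracle inequality. Let `h` be a grid bandwidth such that, for all grid bandwidths `η < h' ≤ h`, the
means of the estimators differ by at most the first part of the threshold. If the selected bandwidth
exceeds `h`, its admissibility against `h` keeps the two estimators within `psi`. If it is some `h'
< h`, then `a * h'` was rejected, so a centred difference exceeded `vTwo * lam`. Bernstein's
inequality gives this event (`badEvent`) probability of order `h' ^ (2 * p)`: the condition `D₂ > 4
* p` supplies the exponent, and `n * η ≥ log³ n` on the grid makes the deviation essentially
Gaussian. The loss on these events sums geometrically. Hence (`exists_oracle_bound`) the pointwise
risk is at most a constant times `b ^ p + (log n / (n * h)) ^ (p / 2)`, where `b` bounds the bias at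
`h`.

Integration. At distance `ρ` from the break points the bias is of order `h ^ s * ρ ^ (-γ)` for `h ≤
ρ / 2` (`s = α`, `γ = 0` for piecewise Hölder densities, `s = ℓ` for piecewise differentiable ones),
so the usable bandwidth is of the order of the minimum of `ρ` and the one balancing this bias
against the noise. For `β > 0`, points within `n ^ (-τ / (2β + 1))` of a break point are treated by
global smoothness `β` alone, with risk `n ^ (-pβ / (2β + 1))` up to logarithms; elsewhere the risk
is a sum of powers of `ρ`, integrated explicitly. The right choice is `τ = min 1 ((s - β) / γ)`, the
largest `τ ≤ 1` for which the balancing bandwidth outside this zone is at least of order `n ^ (-1 /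
(2β + 1))`.

For `β = 0` the grid is too coarse: it stops at `log³ n / n`. The near zone becomes `(log³ n / n) ^
τ`, where the risk is only bounded, and this is the additional term. Further out the balancing
bandwidth can still fall below the grid; there the smallest bandwidth is used, and its bias
dominates its noise. The alternative hypotheses when `β = 0` are those under which the additional
term is absorbed. -/

theorem exp_le_one_add_add_sq (y : ℝ) :
    Real.exp y ≤ 1 + y + y ^ 2 / 2 * Real.exp |y| := by
  rcases le_total 0 y with hy | hy
  · rw [abs_of_nonneg hy]
    have hmono : MonotoneOn (fun z : ℝ => 1 + z + z ^ 2 / 2 * Real.exp z - Real.exp z) (Ici 0) := by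
      have hd : ∀ z : ℝ, HasDerivAt (fun z : ℝ => 1 + z + z ^ 2 / 2 * Real.exp z - Real.exp z)
          (1 + (z * Real.exp z + z ^ 2 / 2 * Real.exp z) - Real.exp z) z := by
        intro z
        have h1 := ((((hasDerivAt_id z).const_add 1).add
          ((((hasDerivAt_id z).pow 2).div_const 2).mul (Real.hasDerivAt_exp z))).sub
            (Real.hasDerivAt_exp z))
        exact h1.congr_deriv (by simp)
      apply monotoneOn_of_deriv_nonneg (convex_Ici 0)
      · exact fun z _ => (hd z).continuousAt.continuousWithinAt
      · exact fun z _ => (hd z).differentiableAt.differentiableWithinAt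
      · intro z hz
        rw [interior_Ici] at hz
        have hz : 0 < z := hz
        rw [(hd z).deriv]
        have h2 : 1 - z ≤ Real.exp (-z) := by
          have := Real.add_one_le_exp (-z); linarith
        have h3 : (1 - z) * Real.exp z ≤ 1 := by
          calc (1 - z) * Real.exp z ≤ Real.exp (-z) * Real.exp z := by gcongr
            _ = 1 := by rw [← Real.exp_add]; simp
        have : 0 ≤ z ^ 2 / 2 * Real.exp z := by positivity
        linarith
    have := hmono (self_mem_Ici) (show y ∈ Ici (0 : ℝ) from hy) hy
    simp at this
    linarith
  · have hanti : AntitoneOn (fun z : ℝ => 1 + z + z ^ 2 / 2 - Real.exp z) (Iic 0) := by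
      have hd : ∀ z : ℝ, HasDerivAt (fun z : ℝ => 1 + z + z ^ 2 / 2 - Real.exp z)
          (1 + z - Real.exp z) z := by
        intro z
        have h1 := (((hasDerivAt_id z).const_add 1).add
          (((hasDerivAt_id z).pow 2).div_const 2)).sub (Real.hasDerivAt_exp z)
        exact h1.congr_deriv (by simp)
      apply antitoneOn_of_deriv_nonpos (convex_Iic 0)
      · exact fun z _ => (hd z).continuousAt.continuousWithinAt
      · exact fun z _ => (hd z).differentiableAt.differentiableWithinAt
      · intro z _
        rw [(hd z).deriv]
        have := Real.add_one_le_exp z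
        linarith
    have h1 := hanti (show y ∈ Iic (0 : ℝ) from hy) self_mem_Iic hy
    simp at h1
    have h2 : y ^ 2 / 2 ≤ y ^ 2 / 2 * Real.exp |y| :=
      le_mul_of_one_le_right (by positivity) (Real.one_le_exp (abs_nonneg y))
    linarith

/-- Apply `z ≤ exp z` at `z = y / q` and raise to the power `q`. It converts exponential moments
into moments of any positive order. -/
theorem rpow_le_rpow_mul_exp {y q : ℝ} (hy : 0 ≤ y) (hq : 0 < q) :
    y ^ q ≤ q ^ q * Real.exp y := by
  have h1 : y / q ≤ Real.exp (y / q) := by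
    have := Real.add_one_le_exp (y / q); linarith
  calc y ^ q = q ^ q * (y / q) ^ q := by
        rw [Real.div_rpow hy hq.le]; field_simp
    _ ≤ q ^ q * (Real.exp (y / q)) ^ q := by gcongr
    _ = q ^ q * Real.exp y := by
        rw [← Real.exp_mul]; congr 2; field_simp

/-- Taylor's formula for a chain of derivatives `g 0, …, g k` on a convex set, when the last one
stays within `Q` of a constant `e`. -/
theorem taylor_chain_bound {S : Set ℝ} (hS : Convex ℝ S) {x : ℝ} (hx : x ∈ S) (k : ℕ) :
    ∀ (g : ℕ → ℝ → ℝ) (e Q : ℝ),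
      (∀ j < k, ∀ z ∈ S, HasDerivWithinAt (g j) (g (j + 1) z) S z) →
      (∀ z ∈ S, |g k z - e| ≤ Q) → ∀ y ∈ S,
      |g 0 y - ((∑ j ∈ Finset.range k, g j x * (y - x) ^ j / (j.factorial : ℝ)) +
        e * (y - x) ^ k / (k.factorial : ℝ))| ≤ Q * |y - x| ^ k := by
  induction k with
  | zero => intro g e Q _ hQ y hy; simpa using hQ y hy
  | succ k ih =>
    intro g e Q hg hQ y hy
    have hQ0 : 0 ≤ Q := (abs_nonneg _).trans (hQ x hx)
    have ih' := ih (fun j => g (j + 1)) e Q (fun j hj z hz => hg (j + 1) (by omega) z hz) hQ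
    set D : ℝ → ℝ := fun y => g 0 y -
      ((∑ j ∈ Finset.range (k + 1), g j x * (y - x) ^ j / (j.factorial : ℝ)) +
        e * (y - x) ^ (k + 1) / ((k + 1).factorial : ℝ)) with hD
    set D' : ℝ → ℝ := fun y => g 1 y -
      ((∑ j ∈ Finset.range k, g (j + 1) x * (y - x) ^ j / (j.factorial : ℝ)) +
        e * (y - x) ^ k / (k.factorial : ℝ)) with hD'
    have hmono : ∀ (c : ℝ) (j : ℕ) (z : ℝ) (s : Set ℝ),
        HasDerivWithinAt (fun y : ℝ => c * (y - x) ^ (j + 1) / ((j + 1).factorial : ℝ))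
          (c * (z - x) ^ j / (j.factorial : ℝ)) s z := by
      intro c j z s
      have h1 := (((((hasDerivAt_id z).sub_const x).pow (j + 1)).const_mul c).div_const
        ((j + 1).factorial : ℝ)).hasDerivWithinAt (s := s)
      refine h1.congr_deriv ?_
      rw [Nat.factorial_succ]
      have : (j.factorial : ℝ) ≠ 0 := by positivity
      push_cast
      simp only [id, mul_one]
      field_simp
    -- The derivative of the remainder is the remainder of the shifted chain, which the induction
    -- hypothesis controls. Since the remainder vanishes at `x`, the mean value inequality on the
    -- segment adds one power of `|y - x|`. The factorial that integration would gain is given up.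
    have hder : ∀ z ∈ S, HasDerivWithinAt D (D' z) S z := by
      intro z hz
      have h0 := hg 0 (by omega) z hz
      have hsum : HasDerivWithinAt
          (fun y => ∑ j ∈ Finset.range (k + 1), g j x * (y - x) ^ j / (j.factorial : ℝ))
          (∑ j ∈ Finset.range k, g (j + 1) x * (z - x) ^ j / (j.factorial : ℝ)) S z := by
        simp_rw [Finset.sum_range_succ']
        simp only [pow_zero, Nat.factorial_zero, Nat.cast_one, mul_one, div_one]
        apply HasDerivWithinAt.add_const
        exact HasDerivWithinAt.fun_sum fun j _ => hmono _ j z S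
      exact h0.sub (hsum.add (hmono e k z S))
    have hDx : D x = 0 := by
      simp [hD, Finset.sum_range_succ']
    have hseg : segment ℝ x y ⊆ S := hS.segment_subset hx hy
    have key := (convex_segment x y).norm_image_sub_le_of_norm_hasDerivWithin_le
      (f := D) (f' := D') (C := Q * |y - x| ^ k)
      (fun z hz => (hder z (hseg hz)).mono hseg) (fun z hz => ?_)
      (left_mem_segment ℝ x y) (right_mem_segment ℝ x y)
    · rw [hDx, sub_zero, Real.norm_eq_abs, Real.norm_eq_abs] at key
      calc |D y| ≤ Q * |y - x| ^ k * |y - x| := key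
        _ = Q * |y - x| ^ (k + 1) := by ring
    · have hzx : |z - x| ≤ |y - x| := by
        rw [segment_eq_uIcc] at hz
        exact abs_sub_left_of_mem_uIcc hz
      calc ‖D' z‖ ≤ Q * |z - x| ^ k := ih' z (hseg hz)
        _ ≤ Q * |y - x| ^ k := by gcongr

/-! ### Kernel moments and the mean of the kernel estimator -/

theorem integrable_of_bounded_of_support {g : ℝ → ℝ} (hg : Measurable g) {C : ℝ}
    (hC : ∀ u, |u| ≤ 1 → |g u| ≤ C) (hs : ∀ u, 1 < |u| → g u = 0) : Integrable g := by
  have h1 : IntegrableOn g (Icc (-1) 1) := by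
    apply Measure.integrableOn_of_bounded (M := C) (by simp) hg.aestronglyMeasurable
    filter_upwards [ae_restrict_mem measurableSet_Icc] with u hu
    exact hC u (abs_le.2 hu)
  refine (integrableOn_iff_integrable_of_support_subset ?_).1 h1
  intro u hu
  by_contra h
  exact hu (hs u (by rw [← not_le]; exact fun h' => h (abs_le.1 h')))

theorem abs_integral_le_of_support {g : ℝ → ℝ} {C : ℝ}
    (hC : ∀ u, |u| ≤ 1 → |g u| ≤ C) (hs : ∀ u, 1 < |u| → g u = 0) : |∫ u, g u| ≤ 2 * C := by
  have h1 : ∫ u, g u = ∫ u in Icc (-1 : ℝ) 1, g u := by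
    refine (setIntegral_eq_integral_of_forall_compl_eq_zero fun u hu => hs u ?_).symm
    rw [← not_le]; exact fun h' => hu (abs_le.1 h')
  rw [h1]
  have := norm_setIntegral_le_of_norm_le_const (μ := volume) (s := Icc (-1 : ℝ) 1) (C := C)
    (f := g) (by simp) (fun u hu => hC u (abs_le.2 hu))
  rw [Real.norm_eq_abs] at this
  refine this.trans (le_of_eq ?_)
  simp [Measure.real]
  ring

/-- The mean of the kernel estimator at `x`. -/
noncomputable def kmean (K f : ℝ → ℝ) (h x : ℝ) : ℝ := ∫ y, 1 / h * K ((y - x) / h) * f y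

theorem kmean_eq (K f : ℝ → ℝ) {h : ℝ} (hh : 0 < h) (x : ℝ) :
    kmean K f h x = ∫ u, K u * f (x + h * u) := by
  have h1 := integral_add_left_eq_self (μ := (volume : Measure ℝ))
    (fun y => 1 / h * K ((y - x) / h) * f y) x
  have h2 := Measure.integral_comp_mul_left
    (fun y => 1 / h * K ((x + y - x) / h) * f (x + y)) h
  rw [kmean, ← h1]
  simp only [smul_eq_mul] at h2
  rw [abs_of_pos (by positivity)] at h2
  have h3 : ∀ u, 1 / h * K ((x + h * u - x) / h) * f (x + h * u) =
      h⁻¹ * (K u * f (x + h * u)) := by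
    intro u
    have : (x + h * u - x) / h = u := by field_simp; ring
    rw [this]; ring
  simp_rw [h3] at h2
  rw [integral_const_mul] at h2
  have := mul_left_cancel₀ (inv_ne_zero hh.ne') h2
  rw [this]

/-- The vanishing moments annihilate every nonconstant monomial of degree below `r`, and the unit
mass reproduces the constant term `f x`. Only the approximation error `Q` remains, integrated
against a kernel bounded by `B` on an interval of length 2. -/
theorem abs_kmean_sub_le {K : ℝ → ℝ} {r : ℕ} (hK : IsKernelOfOrder K r) {B : ℝ}
    (hB : ∀ u, |K u| ≤ B) {f : ℝ → ℝ} (hf : Measurable f) {x h Q : ℝ} (hh : 0 < h) {N : ℕ}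
    (hN : N < r) (c : ℕ → ℝ) (hc : c 0 = f x)
    (hQ : ∀ v, |v| ≤ h → |f (x + v) - ∑ j ∈ Finset.range (N + 1), c j * v ^ j| ≤ Q) :
    |kmean K f h x - f x| ≤ 2 * B * Q := by
  have hB0 : 0 ≤ B := (abs_nonneg _).trans (hB 0)
  have hQ0 : 0 ≤ Q := (abs_nonneg _).trans (hQ 0 (by simpa using hh.le))
  rw [kmean_eq K f hh]
  have hmonoint : ∀ j : ℕ, Integrable fun u => u ^ j * K u := by
    intro j
    apply integrable_of_bounded_of_support (C := B) (by have := hK.measurable; fun_prop)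
    · intro u hu
      rw [abs_mul, abs_pow]
      calc |u| ^ j * |K u| ≤ 1 * B := by
            gcongr
            · exact pow_le_one₀ (abs_nonneg _) hu
            · exact hB u
        _ = B := one_mul B
    · intro u hu; rw [hK.support u hu, mul_zero]
  have hpint : ∫ u, K u * ∑ j ∈ Finset.range (N + 1), c j * (h * u) ^ j = f x := by
    have h1 : ∀ u, K u * ∑ j ∈ Finset.range (N + 1), c j * (h * u) ^ j =
        ∑ j ∈ Finset.range (N + 1), (c j * h ^ j) * (u ^ j * K u) := by
      intro u; rw [Finset.mul_sum]; exact Finset.sum_congr rfl fun j _ => by ring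
    simp_rw [h1]
    rw [integral_finsetSum _ fun j _ => (hmonoint j).const_mul _]
    simp_rw [integral_const_mul]
    rw [Finset.sum_range_succ', Finset.sum_eq_zero]
    · simp [hK.integral_eq_one, hc]
    · intro j hj
      rw [hK.moments (j + 1) (by omega) (by have := Finset.mem_range.1 hj; omega), mul_zero]
  have hpi : Integrable fun u => K u * ∑ j ∈ Finset.range (N + 1), c j * (h * u) ^ j := by
    have h1 : ∀ u, K u * ∑ j ∈ Finset.range (N + 1), c j * (h * u) ^ j =
        ∑ j ∈ Finset.range (N + 1), (c j * h ^ j) * (u ^ j * K u) := by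
      intro u; rw [Finset.mul_sum]; exact Finset.sum_congr rfl fun j _ => by ring
    simp_rw [h1]
    exact integrable_finsetSum _ fun j _ => (hmonoint j).const_mul _
  have hdm : Measurable fun u =>
      K u * (f (x + h * u) - ∑ j ∈ Finset.range (N + 1), c j * (h * u) ^ j) := by
    have := hK.measurable
    fun_prop
  have hdb : ∀ u, |u| ≤ 1 →
      |K u * (f (x + h * u) - ∑ j ∈ Finset.range (N + 1), c j * (h * u) ^ j)| ≤ B * Q := by
    intro u hu
    rw [abs_mul]
    gcongr
    · exact hB u
    · apply hQ
      rw [abs_mul, abs_of_pos hh]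
      nlinarith
  have hds : ∀ u, 1 < |u| →
      K u * (f (x + h * u) - ∑ j ∈ Finset.range (N + 1), c j * (h * u) ^ j) = 0 := by
    intro u hu; rw [hK.support u hu, zero_mul]
  have hdi := integrable_of_bounded_of_support hdm hdb hds
  have hle := abs_integral_le_of_support hdb hds
  have hfull : ∫ u, K u * f (x + h * u) =
      (∫ u, K u * (f (x + h * u) - ∑ j ∈ Finset.range (N + 1), c j * (h * u) ^ j)) + f x := by
    conv_rhs => rw [← hpint]
    rw [← integral_add hdi hpi]
    congr 1; ext u; ring
  rw [hfull, add_sub_cancel_right]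
  linarith

theorem iteratedDeriv_hasDerivAt {f : ℝ → ℝ} {j : ℕ} {z : ℝ}
    (h : DifferentiableAt ℝ (iteratedDeriv j f) z) :
    HasDerivAt (iteratedDeriv j f) (iteratedDeriv (j + 1) f z) z := by
  rw [iteratedDeriv_succ]; exact h.hasDerivAt

theorem iteratedDerivWithin_eq_of_mem_nhds {f : ℝ → ℝ} {s : Set ℝ} {z : ℝ} (hs : s ∈ nhds z)
    (k : ℕ) : iteratedDerivWithin k f s z = iteratedDeriv k f z := by
  rw [← iteratedDerivWithin_univ, iteratedDerivWithin, iteratedDerivWithin,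
    iteratedFDerivWithin_congr_set (Filter.eventuallyEq_univ.mpr hs)]

theorem ContDiffAt.differentiableAt_iteratedDeriv_of_lt {f : ℝ → ℝ} {k j : ℕ} {z : ℝ}
    (h : ContDiffAt ℝ k f z) (hj : j < k) : DifferentiableAt ℝ (iteratedDeriv j f) z := by
  have h1 := (h.contDiffWithinAt (s := univ)).differentiableWithinAt_iteratedDerivWithin (m := j)
    (by exact_mod_cast hj) (by simp)
  rwa [iteratedDerivWithin_univ, differentiableWithinAt_univ] at h1

/-- The bias of the kernel estimator under a Hölder condition on the window. -/
theorem abs_bias_le_of_holder {K : ℝ → ℝ} {r : ℕ} (hK : IsKernelOfOrder K r) {B : ℝ}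
    (hB : ∀ u, |K u| ≤ B) {f g : ℝ → ℝ} (hf : Measurable f) {α L M x h : ℝ} (hα : 0 ≤ α)
    (hL : 0 ≤ L) (hr : strictFloor α < r) {J O : Set ℝ} (hO : IsOpen O) (hOJ : O ⊆ J)
    (hg : g ∈ Holder α L M J)
    (hfg : EqOn f g O) (hh : 0 < h) (hh1 : h ≤ 1) (hw : Icc (x - h) (x + h) ⊆ O) :
    |kmean K f h x - f x| ≤ 2 * B * L * h ^ α := by
  obtain ⟨hcd, -, hhol⟩ := hg
  set k := strictFloor α with hk
  have hkα : (k : ℝ) ≤ α := by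
    rcases hα.eq_or_lt with h0 | h0
    · simp [hk, strictFloor, ← h0]
    · have := Nat.ceil_lt_add_one hα
      rw [hk, strictFloor, Nat.cast_sub (Nat.one_le_ceil_iff.2 h0)]
      push_cast; linarith
  have hxO : x ∈ Icc (x - h) (x + h) := by constructor <;> linarith
  -- The open set `O` between the window and `J` puts every window point in the interior of `J`, so
  -- that derivatives within `J` are ordinary derivatives there.
  have hnhds : ∀ z ∈ Icc (x - h) (x + h), J ∈ nhds z := fun z hz =>
    Filter.mem_of_superset (hO.mem_nhds (hw hz)) hOJ
  have hder : ∀ j < k, ∀ z ∈ Icc (x - h) (x + h),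
      HasDerivWithinAt (iteratedDeriv j g) (iteratedDeriv (j + 1) g z) (Icc (x - h) (x + h)) z := by
    intro j hj z hz
    -- For `α = 0` there is no `j < k`, so the missing continuity assumption does no harm.
    have hα0 : 0 < α := by
      rcases hα.eq_or_lt with h0 | h0
      · simp [hk, strictFloor, ← h0] at hj
      · exact h0
    have h1 := (hcd hα0).contDiffAt (hnhds z hz)
    exact (iteratedDeriv_hasDerivAt
      (h1.differentiableAt_iteratedDeriv_of_lt hj)).hasDerivWithinAt
  have hlast : ∀ z ∈ Icc (x - h) (x + h),
      |iteratedDeriv k g z - iteratedDeriv k g x| ≤ L * h ^ (α - k) := by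
    intro z hz
    have hzx : |z - x| ≤ h := abs_le.2 ⟨by linarith [hz.1], by linarith [hz.2]⟩
    have h1 := hhol z (mem_of_mem_nhds (hnhds z hz)) x (mem_of_mem_nhds (hnhds x hxO))
      (hzx.trans hh1)
    rw [iteratedDerivWithin_eq_of_mem_nhds (hnhds z hz),
      iteratedDerivWithin_eq_of_mem_nhds (hnhds x hxO)] at h1
    refine h1.trans ?_
    gcongr
  have hT := taylor_chain_bound (convex_Icc (x - h) (x + h)) hxO k (fun j => iteratedDeriv j g)
    (iteratedDeriv k g x) (L * h ^ (α - k)) hder hlast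
  have key := abs_kmean_sub_le hK hB hf (x := x) hh (Q := L * h ^ α) hr
    (fun j => iteratedDeriv j g x / (j.factorial : ℝ)) (by simp [hfg (hw hxO)]) ?_
  · linarith
  · intro v hv
    have hvm : x + v ∈ Icc (x - h) (x + h) := by
      have := abs_le.1 hv; constructor <;> linarith
    have h1 := hT (x + v) hvm
    rw [iteratedDeriv_zero, ← hfg (hw hvm)] at h1
    rw [Finset.sum_range_succ]
    simp only [add_sub_cancel_left] at h1
    have h2 : ∀ j : ℕ, iteratedDeriv j g x / (j.factorial : ℝ) * v ^ j =
      iteratedDeriv j g x * v ^ j / (j.factorial : ℝ) := fun j => by ring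
    simp_rw [h2]
    refine h1.trans ?_
    calc L * h ^ (α - k) * |v| ^ k ≤ L * h ^ (α - k) * h ^ k := by gcongr
      _ = L * h ^ α := by
        rw [mul_assoc, ← Real.rpow_natCast h k, ← Real.rpow_add hh]; simp

/-- The bias of the kernel estimator under a bound on the derivative of order `ℓ` on the window. -/
theorem abs_bias_le_of_deriv {K : ℝ → ℝ} {r : ℕ} (hK : IsKernelOfOrder K r) {B : ℝ}
    (hB : ∀ u, |K u| ≤ B) {f : ℝ → ℝ} (hf : Measurable f) {Q x h : ℝ} {ℓ : ℕ} (hℓ : 1 ≤ ℓ)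
    (hr : ℓ ≤ r) (hh : 0 < h)
    (hd : ∀ z ∈ Icc (x - h) (x + h), (∀ k < ℓ, DifferentiableAt ℝ (iteratedDeriv k f) z) ∧
      |iteratedDeriv ℓ f z| ≤ Q) :
    |kmean K f h x - f x| ≤ 2 * B * Q * h ^ ℓ := by
  have hxO : x ∈ Icc (x - h) (x + h) := by constructor <;> linarith
  have hQ0 : 0 ≤ Q := (abs_nonneg _).trans (hd x hxO).2
  have hT := taylor_chain_bound (convex_Icc (x - h) (x + h)) hxO ℓ (fun j => iteratedDeriv j f)
    0 Q (fun j hj z hz => (iteratedDeriv_hasDerivAt ((hd z hz).1 j hj)).hasDerivWithinAt)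
    (fun z hz => by simpa using (hd z hz).2)
  -- With the constant `e = 0` the Taylor polynomial has degree `ℓ - 1`, hence `ℓ ≤ r` suffices.
  obtain ⟨N, rfl⟩ : ∃ N, ℓ = N + 1 := ⟨ℓ - 1, by omega⟩
  have key := abs_kmean_sub_le hK hB hf (x := x) hh (Q := Q * h ^ (N + 1)) (N := N) (by omega)
    (fun j => iteratedDeriv j f x / (j.factorial : ℝ)) (by simp) ?_
  · linarith
  · intro v hv
    have hvm : x + v ∈ Icc (x - h) (x + h) := by
      have := abs_le.1 hv; constructor <;> linarith
    have h1 := hT (x + v) hvm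
    rw [iteratedDeriv_zero] at h1
    simp only [add_sub_cancel_left, zero_mul, zero_div, add_zero] at h1
    have h2 : ∀ j : ℕ, iteratedDeriv j f x / (j.factorial : ℝ) * v ^ j =
      iteratedDeriv j f x * v ^ j / (j.factorial : ℝ) := fun j => by ring
    simp_rw [h2]
    exact h1.trans (by gcongr)

/-! ### Exponential bounds for empirical means -/

/-- The deviation of the empirical mean of `g` from its expectation. -/
noncomputable def empDev (μ : Measure ℝ) (g : ℝ → ℝ) {n : ℕ} (X : Fin n → ℝ) : ℝ :=
  (1 / (n : ℝ)) * ∑ i, g (X i) - ∫ y, g y ∂μ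

theorem measurable_empDev {μ : Measure ℝ} {g : ℝ → ℝ} {n : ℕ} (hg : Measurable g) :
    Measurable fun X : Fin n → ℝ => empDev μ g X := by
  unfold empDev; fun_prop

section Bernstein

variable {μ : Measure ℝ} [IsProbabilityMeasure μ] {g : ℝ → ℝ} {b v : ℝ} {n : ℕ}

theorem integrable_of_abs_le (hg : Measurable g) (hb : ∀ y, |g y| ≤ b) : Integrable g μ :=
  Integrable.of_bound hg.aestronglyMeasurable b (Filter.Eventually.of_forall hb)

/-- Integrate the second-order exponential inequality: the linear term vanishes and the variance is
at most the second moment. The Gaussian constant `1 / 2` is kept, and the correction `exp (2 * |θ| *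
b)` is left explicit so that it can be made close to 1; the condition `D₂ > 4 * p` leaves no room
for a worse constant. -/
theorem integral_exp_centered_le (hg : Measurable g) (hb : ∀ y, |g y| ≤ b)
    (hv : ∫ y, g y ^ 2 ∂μ ≤ v) (θ : ℝ) :
    ∫ y, Real.exp (θ * (g y - ∫ z, g z ∂μ)) ∂μ ≤
      Real.exp (θ ^ 2 * v / 2 * Real.exp (2 * |θ| * b)) := by
  set e := ∫ z, g z ∂μ with he
  have hgi : Integrable g μ := integrable_of_abs_le hg hb
  have hb0 : 0 ≤ b := (abs_nonneg _).trans (hb 0)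
  have heb : |e| ≤ b := by
    have := norm_integral_le_of_norm_le_const (μ := μ) (f := g) (C := b)
      (Filter.Eventually.of_forall hb)
    simpa using this
  have hY : ∀ y, |θ * (g y - e)| ≤ 2 * |θ| * b := by
    intro y
    rw [abs_mul]
    have : |g y - e| ≤ 2 * b := (abs_sub _ _).trans (by linarith [hb y])
    nlinarith [abs_nonneg θ]
  have hg2i : Integrable (fun y => g y ^ 2) μ :=
    integrable_of_abs_le (b := b ^ 2) (by fun_prop) fun y => by
      rw [abs_pow]; gcongr; exact hb y
  have hce : Integrable (fun y => (g y - e) ^ 2) μ := by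
    have : (fun y => (g y - e) ^ 2) = fun y => g y ^ 2 - (2 * e) * g y + e ^ 2 := by ext y; ring
    rw [this]
    exact (hg2i.sub (hgi.const_mul _)).add (integrable_const _)
  have hvar : ∫ y, (g y - e) ^ 2 ∂μ ≤ v := by
    have h1 : (fun y => (g y - e) ^ 2) = fun y => g y ^ 2 - (2 * e) * g y + e ^ 2 := by ext y; ring
    have h2 : Integrable (fun y => g y ^ 2 - (2 * e) * g y) μ := hg2i.sub (hgi.const_mul _)
    rw [h1, integral_add h2 (integrable_const _), integral_sub hg2i (hgi.const_mul _), integral_const_mul, ← he]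
    simp
    nlinarith [sq_nonneg e]
  have hpt : ∀ y, Real.exp (θ * (g y - e)) ≤
      1 + θ * (g y - e) + θ ^ 2 / 2 * Real.exp (2 * |θ| * b) * (g y - e) ^ 2 := by
    intro y
    refine (exp_le_one_add_add_sq _).trans ?_
    have h1 : (θ * (g y - e)) ^ 2 / 2 * Real.exp |θ * (g y - e)| ≤
        (θ * (g y - e)) ^ 2 / 2 * Real.exp (2 * |θ| * b) := by
      gcongr; exact hY y
    nlinarith
  have hlin : Integrable (fun y => θ * (g y - e)) μ := (hgi.sub (integrable_const e)).const_mul θ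
  have h1 : ∫ y, Real.exp (θ * (g y - e)) ∂μ ≤
      ∫ y, (1 + θ * (g y - e) + θ ^ 2 / 2 * Real.exp (2 * |θ| * b) * (g y - e) ^ 2) ∂μ := by
    apply integral_mono _ (((integrable_const 1).add hlin).add (hce.const_mul _)) hpt
    apply integrable_of_abs_le (b := Real.exp (2 * |θ| * b)) (by fun_prop)
    intro y
    rw [abs_of_pos (Real.exp_pos _)]
    exact Real.exp_le_exp.2 ((le_abs_self _).trans (hY y))
  refine h1.trans ?_
  have hlin1 : Integrable (fun y => 1 + θ * (g y - e)) μ := (integrable_const 1).add hlin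
  rw [integral_add hlin1 (hce.const_mul _),
    integral_add (integrable_const 1) hlin, integral_const_mul, integral_const_mul,
    integral_sub hgi (integrable_const e), ← he]
  simp only [integral_const, probReal_univ, smul_eq_mul, one_mul, sub_self, mul_zero, add_zero]
  have h2 : θ ^ 2 / 2 * Real.exp (2 * |θ| * b) * ∫ y, (g y - e) ^ 2 ∂μ ≤
      θ ^ 2 / 2 * Real.exp (2 * |θ| * b) * v := by gcongr
  have h3 := Real.add_one_le_exp (θ ^ 2 * v / 2 * Real.exp (2 * |θ| * b))
  nlinarith

theorem lintegral_exp_empDev_le (hg : Measurable g) (hb : ∀ y, |g y| ≤ b)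
    (hv : ∫ y, g y ^ 2 ∂μ ≤ v) (hn : 0 < n) (θ : ℝ) :
    ∫⁻ X : Fin n → ℝ, ENNReal.ofReal (Real.exp (θ * empDev μ g X))
        ∂(Measure.pi fun _ : Fin n => μ) ≤
      ENNReal.ofReal (Real.exp (θ ^ 2 * v / (2 * n) * Real.exp (2 * |θ| * b / n))) := by
  have hn' : (0 : ℝ) < n := by exact_mod_cast hn
  set e := ∫ z, g z ∂μ with he
  have hprod : ∀ X : Fin n → ℝ, Real.exp (θ * empDev μ g X) =
      ∏ i, Real.exp (θ / n * (g (X i) - e)) := by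
    intro X
    rw [← Real.exp_sum, ← Finset.mul_sum, Finset.sum_sub_distrib]
    congr 1
    simp only [empDev, Finset.sum_const, Finset.card_univ, Fintype.card_fin, nsmul_eq_mul, ← he]
    field_simp
  have hb0 : 0 ≤ b := (abs_nonneg _).trans (hb 0)
  have hint : Integrable (fun X : Fin n → ℝ => Real.exp (θ * empDev μ g X))
      (Measure.pi fun _ : Fin n => μ) := by
    have hm := (measurable_empDev (μ := μ) (n := n) hg)
    refine Integrable.of_bound (C := Real.exp (|θ| * (b + |e|)))
      (by fun_prop) (Filter.Eventually.of_forall fun X => ?_)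
    rw [Real.norm_eq_abs, abs_of_pos (Real.exp_pos _)]
    apply Real.exp_le_exp.2
    refine (le_abs_self _).trans ?_
    rw [abs_mul]
    gcongr
    refine (abs_sub _ _).trans (add_le_add ?_ le_rfl)
    rw [abs_mul, abs_of_pos (by positivity)]
    calc 1 / (n : ℝ) * |∑ i, g (X i)| ≤ 1 / (n : ℝ) * ∑ _i : Fin n, b := by
          gcongr
          exact (Finset.abs_sum_le_sum_abs _ _).trans (Finset.sum_le_sum fun i _ => hb _)
      _ = b := by simp; field_simp
  rw [← ofReal_integral_eq_lintegral_ofReal hint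
    (Filter.Eventually.of_forall fun X => (Real.exp_pos _).le)]
  apply ENNReal.ofReal_le_ofReal
  simp_rw [hprod]
  rw [integral_fintype_prod_eq_pow (fun y => Real.exp (θ / n * (g y - e))), Fintype.card_fin]
  calc (∫ y, Real.exp (θ / n * (g y - e)) ∂μ) ^ n
      ≤ (Real.exp ((θ / n) ^ 2 * v / 2 * Real.exp (2 * |θ / n| * b))) ^ n := by
        gcongr
        exact integral_exp_centered_le hg hb hv _
    _ = _ := by
        rw [← Real.exp_nat_mul, abs_div, abs_of_pos hn']
        congr 1
        have : 2 * (|θ| / n) * b = 2 * |θ| * b / n := by ring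
        rw [this]
        field_simp

theorem lintegral_exp_abs_empDev_le (hg : Measurable g) (hb : ∀ y, |g y| ≤ b)
    (hv : ∫ y, g y ^ 2 ∂μ ≤ v) (hn : 0 < n) {θ : ℝ} (hθ : 0 ≤ θ) :
    ∫⁻ X : Fin n → ℝ, ENNReal.ofReal (Real.exp (θ * |empDev μ g X|))
        ∂(Measure.pi fun _ : Fin n => μ) ≤
      ENNReal.ofReal (2 * Real.exp (θ ^ 2 * v / (2 * n) * Real.exp (2 * θ * b / n))) := by
  have h1 := lintegral_exp_empDev_le hg hb hv hn θ
  have h2 := lintegral_exp_empDev_le hg hb hv hn (-θ)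
  rw [abs_neg, neg_sq] at h2
  rw [abs_of_nonneg hθ] at h1 h2
  have hm := (measurable_empDev (μ := μ) (n := n) hg)
  calc _ ≤ ∫⁻ X : Fin n → ℝ, (ENNReal.ofReal (Real.exp (θ * empDev μ g X)) +
        ENNReal.ofReal (Real.exp (-θ * empDev μ g X))) ∂(Measure.pi fun _ : Fin n => μ) := by
        apply lintegral_mono
        intro X
        rcases abs_cases (empDev μ g X) with h | h
        · simp only [h.1]; exact le_self_add
        · simp only [h.1]; rw [mul_neg, ← neg_mul]; exact le_add_self
    _ ≤ _ := by
        rw [lintegral_add_left (by fun_prop), two_mul,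
          ENNReal.ofReal_add (Real.exp_pos _).le (Real.exp_pos _).le]
        exact add_le_add h1 h2

/-- Chernoff's bound with `θ` left free, to be chosen at the Gaussian optimum later. -/
theorem measure_empDev_gt_le (hg : Measurable g) (hb : ∀ y, |g y| ≤ b)
    (hv : ∫ y, g y ^ 2 ∂μ ≤ v) (hn : 0 < n) {θ : ℝ} (hθ : 0 ≤ θ) (t : ℝ) :
    (Measure.pi fun _ : Fin n => μ) {X | t < |empDev μ g X|} ≤
      ENNReal.ofReal (2 * Real.exp (-(θ * t) +
        θ ^ 2 * v / (2 * n) * Real.exp (2 * θ * b / n))) := by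
  have hm := (measurable_empDev (μ := μ) (n := n) hg)
  have hms : MeasurableSet {X : Fin n → ℝ | t < |empDev μ g X|} :=
    measurableSet_lt measurable_const (by fun_prop)
  rw [← lintegral_indicator_one hms]
  calc _ ≤ ∫⁻ X : Fin n → ℝ, ENNReal.ofReal (Real.exp (-(θ * t))) *
        ENNReal.ofReal (Real.exp (θ * |empDev μ g X|)) ∂(Measure.pi fun _ : Fin n => μ) := by
        apply lintegral_mono
        intro X
        apply indicator_le (fun X hX => ?_)
        have hX : t < |empDev μ g X| := hX
        rw [← ENNReal.ofReal_mul (Real.exp_pos _).le, ← Real.exp_add, Pi.one_apply]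
        rw [ENNReal.one_le_ofReal]
        apply Real.one_le_exp
        nlinarith
    _ ≤ _ := by
        rw [lintegral_const_mul _ (by fun_prop), Real.exp_add]
        rw [show (2 * (Real.exp (-(θ * t)) * Real.exp (θ ^ 2 * v / (2 * n) *
          Real.exp (2 * θ * b / n)))) = Real.exp (-(θ * t)) * (2 * Real.exp (θ ^ 2 * v / (2 * n) *
          Real.exp (2 * θ * b / n))) by ring, ENNReal.ofReal_mul (Real.exp_pos _).le]
        gcongr
        exact lintegral_exp_abs_empDev_le hg hb hv hn hθ

/-- The scale `s` dominates both the standard deviation and `2 * b / n`, so the exponential moment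
at `θ = 1 / s` is bounded by a constant, and it controls every power. -/
theorem lintegral_abs_empDev_rpow_le (hg : Measurable g) (hb : ∀ y, |g y| ≤ b)
    (hv : ∫ y, g y ^ 2 ∂μ ≤ v) (hn : 0 < n) {s q : ℝ} (hs : 0 < s) (hq : 0 < q)
    (hvs : v ≤ n * s ^ 2) (hbs : 2 * b ≤ n * s) :
    ∫⁻ X : Fin n → ℝ, ENNReal.ofReal (|empDev μ g X| ^ q)
        ∂(Measure.pi fun _ : Fin n => μ) ≤
      ENNReal.ofReal (q ^ q * (2 * Real.exp (Real.exp 1)) * s ^ q) := by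
  have hn' : (0 : ℝ) < n := by exact_mod_cast hn
  have hm := (measurable_empDev (μ := μ) (n := n) hg)
  have h1 := lintegral_exp_abs_empDev_le hg hb hv hn (θ := 1 / s) (by positivity)
  have h2 : (1 / s) ^ 2 * v / (2 * n) * Real.exp (2 * (1 / s) * b / n) ≤ Real.exp 1 := by
    have h3 : (1 / s) ^ 2 * v / (2 * n) ≤ 1 := by
      rw [div_pow, one_pow, one_div_mul_eq_div, div_div, div_le_one (by positivity)]
      nlinarith [mul_pos hn' (pow_pos hs 2)]
    have h4 : 2 * (1 / s) * b / n ≤ 1 := by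
      rw [show 2 * (1 / s) * b / n = 2 * b / (n * s) by field_simp, div_le_one (by positivity)]
      exact hbs
    calc _ ≤ 1 * Real.exp 1 := by gcongr
      _ = _ := one_mul _
  calc _ ≤ ∫⁻ X : Fin n → ℝ, ENNReal.ofReal (s ^ q * q ^ q) *
        ENNReal.ofReal (Real.exp (1 / s * |empDev μ g X|))
        ∂(Measure.pi fun _ : Fin n => μ) := by
        apply lintegral_mono
        intro X
        simp only
        rw [← ENNReal.ofReal_mul (by positivity)]
        apply ENNReal.ofReal_le_ofReal
        have h5 := rpow_le_rpow_mul_exp (y := 1 / s * |empDev μ g X|) (by positivity) hq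
        calc |empDev μ g X| ^ q = s ^ q * (1 / s * |empDev μ g X|) ^ q := by
              rw [← Real.mul_rpow hs.le (by positivity)]; congr 1; field_simp
          _ ≤ s ^ q * (q ^ q * Real.exp (1 / s * |empDev μ g X|)) := by gcongr
          _ = _ := by ring
    _ ≤ ENNReal.ofReal (s ^ q * q ^ q) * ENNReal.ofReal (2 * Real.exp (Real.exp 1)) := by
        rw [lintegral_const_mul _ (by fun_prop)]
        gcongr
        refine h1.trans (ENNReal.ofReal_le_ofReal ?_)
        gcongr
    _ = _ := by
        rw [← ENNReal.ofReal_mul (by positivity)]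
        congr 1; ring

end Bernstein

/-! ### Second moments of kernels -/

/-- The function `y ↦ h⁻¹ K ((y - x) / h)`. -/
noncomputable def kfun (K : ℝ → ℝ) (h x y : ℝ) : ℝ := 1 / h * K ((y - x) / h)

/-- The law of one observation of density `f`. -/
noncomputable def obsLaw (f : ℝ → ℝ) : Measure ℝ :=
  (volume : Measure ℝ).withDensity fun x => ENNReal.ofReal (f x)

theorem isProbabilityMeasure_obsLaw {f : ℝ → ℝ} (hf : IsDensity f) :
    IsProbabilityMeasure (obsLaw f) :=
  ⟨by rw [obsLaw, withDensity_apply _ MeasurableSet.univ, setLIntegral_univ, hf.lintegral_eq_one]⟩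

theorem integral_obsLaw {f : ℝ → ℝ} (hf : IsDensity f) (g : ℝ → ℝ) :
    ∫ y, g y ∂(obsLaw f) = ∫ y, g y * f y := by
  rw [obsLaw, integral_withDensity_eq_integral_toReal_smul (by have := hf.measurable; fun_prop)
    (Filter.Eventually.of_forall fun x => ENNReal.ofReal_lt_top)]
  congr 1; ext y
  rw [ENNReal.toReal_ofReal (hf.nonneg y), smul_eq_mul, mul_comm]

/-- The density is known to be bounded by `M` only on `I`, so the bound is used only on the window
where `g` lives. -/
theorem integral_sq_obsLaw_le {f : ℝ → ℝ} (hf : IsDensity f) {g : ℝ → ℝ} {M x h : ℝ}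
    (hg : Integrable fun y => g y ^ 2) (hfM : ∀ y, |y - x| ≤ h → f y ≤ M)
    (hs : ∀ y, h < |y - x| → g y = 0) :
    ∫ y, g y ^ 2 ∂(obsLaw f) ≤ M * ∫ y, g y ^ 2 := by
  rw [integral_obsLaw hf, ← integral_const_mul]
  apply integral_mono_of_nonneg
  · exact Filter.Eventually.of_forall fun y => mul_nonneg (sq_nonneg _) (hf.nonneg y)
  · exact hg.const_mul M
  · refine Filter.Eventually.of_forall fun y => ?_
    rcases le_or_gt |y - x| h with hy | hy
    · simp only
      rw [mul_comm]
      exact mul_le_mul_of_nonneg_right (hfM y hy) (sq_nonneg _)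
    · simp [hs y hy]

section Kernel

variable {K : ℝ → ℝ} {r : ℕ} {B : ℝ}

theorem measurable_kfun (hK : IsKernelOfOrder K r) (h x : ℝ) : Measurable (kfun K h x) := by
  have := hK.measurable
  unfold kfun; fun_prop

theorem abs_kfun_le (hB : ∀ u, |K u| ≤ B) {h : ℝ} (hh : 0 < h) (x y : ℝ) :
    |kfun K h x y| ≤ B / h := by
  rw [kfun, abs_mul, abs_of_pos (by positivity), one_div_mul_eq_div]
  gcongr; exact hB _

theorem kfun_eq_zero (hK : IsKernelOfOrder K r) {h : ℝ} (hh : 0 < h) {x y : ℝ}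
    (hy : h < |y - x|) : kfun K h x y = 0 := by
  rw [kfun, hK.support, mul_zero]
  rw [abs_div, abs_of_pos hh, one_lt_div hh]; exact hy

theorem integrable_sq_of_support {g : ℝ → ℝ} (hg : Measurable g) {C x h : ℝ}
    (hC : ∀ y, |g y| ≤ C) (hs : ∀ y, h < |y - x| → g y = 0) :
    Integrable fun y => g y ^ 2 := by
  have h1 : IntegrableOn (fun y => g y ^ 2) (Icc (x - h) (x + h)) := by
    apply Measure.integrableOn_of_bounded (M := C ^ 2) (by simp) (by fun_prop)
    refine Filter.Eventually.of_forall fun u => ?_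
    rw [Real.norm_eq_abs, abs_pow]; gcongr; exact hC u
  refine (integrableOn_iff_integrable_of_support_subset ?_).1 h1
  intro u hu
  by_contra h'
  refine hu ?_
  simp only
  rw [hs u, zero_pow two_ne_zero]
  by_contra h3
  rw [not_lt, abs_le] at h3
  exact h' ⟨by linarith [h3.1], by linarith [h3.2]⟩

theorem integrable_kernel_sq (hK : IsKernelOfOrder K r) : Integrable fun u => K u ^ 2 := by
  obtain ⟨B, hB⟩ := hK.bounded
  exact integrable_sq_of_support (x := 0) hK.measurable hB
    fun y hy => hK.support y (by simpa using hy)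

theorem integral_kernel_sq_pos (hK : IsKernelOfOrder K r) : 0 < ∫ u, K u ^ 2 := by
  refine lt_of_le_of_ne (integral_nonneg fun u => sq_nonneg _) fun h0 => ?_
  have h1 := (integral_eq_zero_iff_of_nonneg (fun u => sq_nonneg (K u))
    (integrable_kernel_sq hK)).1 h0.symm
  have h2 : ∫ u, K u = 0 := by
    rw [integral_congr_ae (g := fun _ => (0 : ℝ)) ?_]
    · simp
    · filter_upwards [h1] with u hu
      simpa using hu
  rw [hK.integral_eq_one] at h2
  exact one_ne_zero h2

theorem integral_comp_affine (g : ℝ → ℝ) {h : ℝ} (hh : 0 < h) (x : ℝ) :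
    ∫ y, g y = h * ∫ u, g (x + h * u) := by
  have h1 := integral_add_left_eq_self (μ := (volume : Measure ℝ)) g x
  have h2 := Measure.integral_comp_mul_left (fun y => g (x + y)) h
  rw [abs_of_pos (by positivity), smul_eq_mul] at h2
  rw [h2, h1, mul_inv_cancel_left₀ hh.ne']

theorem integral_kfun_sq (K : ℝ → ℝ) {h : ℝ} (hh : 0 < h) (x : ℝ) :
    ∫ y, kfun K h x y ^ 2 = (∫ u, K u ^ 2) / h := by
  rw [integral_comp_affine _ hh x]
  have h1 : ∀ u, kfun K h x (x + h * u) ^ 2 = (1 / h ^ 2) * K u ^ 2 := by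
    intro u
    have : (x + h * u - x) / h = u := by field_simp; ring
    rw [kfun, this]; ring
  simp_rw [h1]
  rw [integral_const_mul]; field_simp

theorem integral_kfun_sub_sq (hK : IsKernelOfOrder K r) {h η : ℝ} (hη : 0 < η) (hηh : η < h)
    (x : ℝ) :
    ∫ y, (kfun K h x y - kfun K η x y) ^ 2 =
      (1 / h) * ∫ u in (-1 : ℝ)..1, (K u - h / η * K (u * h / η)) ^ 2 := by
  have hh : 0 < h := hη.trans hηh
  rw [integral_comp_affine _ hh x]
  have h1 : ∀ u, (kfun K h x (x + h * u) - kfun K η x (x + h * u)) ^ 2 =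
      (1 / h ^ 2) * (K u - h / η * K (u * h / η)) ^ 2 := by
    intro u
    have h2 : (x + h * u - x) / h = u := by field_simp; ring
    have h3 : (x + h * u - x) / η = u * h / η := by ring
    rw [kfun, kfun, h2, h3]; field_simp
  simp_rw [h1]
  rw [integral_const_mul, intervalIntegral.integral_of_le (by norm_num),
    ← integral_Icc_eq_integral_Ioc, setIntegral_eq_integral_of_forall_compl_eq_zero]
  · rw [← mul_assoc]
    congr 1
    field_simp
  · intro u hu
    have hu' : 1 < |u| := by rw [← not_le]; exact fun h' => hu (abs_le.1 h')
    rw [hK.support u hu', hK.support]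
    · simp
    · rw [abs_div, abs_mul, abs_of_pos hη, abs_of_pos hh, one_lt_div hη]
      nlinarith

theorem integrable_kernel_comp_mul_sq (hK : IsKernelOfOrder K r) {s : ℝ} (hs : s ≠ 0) :
    Integrable fun u => K (u * s) ^ 2 :=
  (integrable_kernel_sq hK).comp_mul_right' hs

theorem integral_kernel_comp_mul_sq (K : ℝ → ℝ) {s : ℝ} (hs : 0 < s) :
    ∫ u, K (u * s) ^ 2 = (∫ u, K u ^ 2) / s := by
  rw [Measure.integral_comp_mul_right (fun u => K u ^ 2), abs_of_pos (by positivity), smul_eq_mul,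
    inv_mul_eq_div]

theorem intervalIntegral_sub_sq_eq (hK : IsKernelOfOrder K r) {h η : ℝ} (hη : 0 < η)
    (hηh : η < h) :
    ∫ u in (-1 : ℝ)..1, (K u - h / η * K (u * h / η)) ^ 2 =
      ∫ u, (K u - h / η * K (u * (h / η))) ^ 2 := by
  have hh : 0 < h := hη.trans hηh
  rw [intervalIntegral.integral_of_le (by norm_num),
    ← integral_Icc_eq_integral_Ioc, setIntegral_eq_integral_of_forall_compl_eq_zero]
  · simp_rw [mul_div_assoc]
  · intro u hu
    have hu' : 1 < |u| := by rw [← not_le]; exact fun h' => hu (abs_le.1 h')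
    rw [hK.support u hu', hK.support]
    · simp
    · rw [abs_div, abs_mul, abs_of_pos hη, abs_of_pos hh, one_lt_div hη]
      nlinarith

theorem integrable_kernel_sub_sq (hK : IsKernelOfOrder K r) {s : ℝ} (hs : 1 < s) :
    Integrable fun u => (K u - s * K (u * s)) ^ 2 := by
  obtain ⟨B, hB⟩ := hK.bounded
  have hm := hK.measurable
  refine integrable_sq_of_support (x := 0) (h := 1) (C := B + s * B) (by fun_prop)
    (fun y => ?_) fun y hy => ?_
  · refine (abs_sub _ _).trans (add_le_add (hB _) ?_)
    rw [abs_mul, abs_of_pos (by linarith)]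
    gcongr; exact hB _
  · rw [sub_zero] at hy
    rw [hK.support y hy, hK.support, mul_zero, sub_zero]
    rw [abs_mul, abs_of_pos (by linarith : (0 : ℝ) < s)]
    nlinarith

theorem vTwo_sq (hK : IsKernelOfOrder K r) {M : ℝ} (hM : 0 < M) (n : ℕ) {h η : ℝ} (hη : 0 < η)
    (hηh : η < h) :
    vTwo K M n h η ^ 2 = M / (n * h) * ∫ u, (K u - h / η * K (u * (h / η))) ^ 2 := by
  have hh : 0 < h := hη.trans hηh
  rw [vTwo, intervalIntegral_sub_sq_eq hK hη hηh, Real.sq_sqrt]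
  exact mul_nonneg (by positivity) (integral_nonneg fun u => sq_nonneg _)

theorem vTwo_sq_le (hK : IsKernelOfOrder K r) {M : ℝ} (hM : 0 < M) {n : ℕ} (hn : 0 < n) {h η : ℝ}
    (hη : 0 < η) (hηh : η < h) :
    vTwo K M n h η ^ 2 ≤ 4 * (M * ∫ u, K u ^ 2) / (n * η) := by
  have hh : 0 < h := hη.trans hηh
  have hn' : (0 : ℝ) < n := by exact_mod_cast hn
  rw [vTwo_sq hK hM n hη hηh]
  set s := h / η with hs
  have hs1 : 1 < s := (one_lt_div hη).2 hηh
  have hs0 : 0 < s := by linarith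
  have hpos := integral_kernel_sq_pos hK
  have h1 : ∫ u, (K u - s * K (u * s)) ^ 2 ≤
      ∫ u, (2 * K u ^ 2 + 2 * s ^ 2 * K (u * s) ^ 2) := by
    apply integral_mono (integrable_kernel_sub_sq hK hs1)
      (((integrable_kernel_sq hK).const_mul _).add
        ((integrable_kernel_comp_mul_sq hK hs0.ne').const_mul _))
    intro u
    simp only [Pi.add_apply]
    nlinarith [sq_nonneg (K u + s * K (u * s))]
  rw [integral_add ((integrable_kernel_sq hK).const_mul _)
    ((integrable_kernel_comp_mul_sq hK hs0.ne').const_mul _), integral_const_mul,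
    integral_const_mul, integral_kernel_comp_mul_sq K hs0] at h1
  have h2 : 2 * ∫ u, K u ^ 2 ≤ 2 * s * ∫ u, K u ^ 2 := by nlinarith
  have h3 : 2 * s ^ 2 * ((∫ u, K u ^ 2) / s) = 2 * s * ∫ u, K u ^ 2 := by field_simp
  calc M / (n * h) * ∫ u, (K u - s * K (u * s)) ^ 2
      ≤ M / (n * h) * (4 * s * ∫ u, K u ^ 2) := by gcongr; linarith
    _ = _ := by rw [hs]; field_simp

/-- This is the reverse triangle inequality in L²: the two kernels have norms in the ratio `√(h / η)
≥ √a > 1`, so their difference is not small. The tail bound needs it, because the Chernoff parameter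
is inversely proportional to `vTwo`. -/
theorem le_vTwo_sq (hK : IsKernelOfOrder K r) {M : ℝ} (hM : 0 < M) {n : ℕ} (hn : 0 < n)
    {a h η : ℝ} (ha : 1 < a) (hη : 0 < η) (hηh : a * η ≤ h) :
    (1 - 1 / Real.sqrt a) ^ 2 * (M * ∫ u, K u ^ 2) / (n * η) ≤ vTwo K M n h η ^ 2 := by
  have hlt : η < h := by nlinarith
  have hh : 0 < h := hη.trans hlt
  have hn' : (0 : ℝ) < n := by exact_mod_cast hn
  rw [vTwo_sq hK hM n hη hlt]
  set s := h / η with hs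
  have hsa : a ≤ s := (le_div_iff₀ hη).2 hηh
  have hs1 : 1 < s := by linarith
  have hs0 : 0 < s := by linarith
  have hpos := integral_kernel_sq_pos hK
  set w := Real.sqrt s with hw
  have hws : w ^ 2 = s := Real.sq_sqrt hs0.le
  have hw1 : 1 < w := by rw [hw]; exact Real.lt_sqrt_of_sq_lt (by simpa using hs1)
  have hwa : Real.sqrt a ≤ w := Real.sqrt_le_sqrt hsa
  have ha1 : 1 < Real.sqrt a := Real.lt_sqrt_of_sq_lt (by simpa using ha)
  -- With `s = w ^ 2`, the right integrand minus the left one is exactly `w * (K u - w * K (u * s))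
  -- ^ 2`, and the left integral equals `(w - 1) ^ 2 * ∫ K ^ 2`.
  have h1 : ∫ u, ((1 - w) * K u ^ 2 + w ^ 3 * (w - 1) * K (u * s) ^ 2) ≤
      ∫ u, (K u - s * K (u * s)) ^ 2 := by
    apply integral_mono (((integrable_kernel_sq hK).const_mul _).add
        ((integrable_kernel_comp_mul_sq hK hs0.ne').const_mul _)) (integrable_kernel_sub_sq hK hs1)
    intro u
    simp only [Pi.add_apply]
    rw [← hws]
    nlinarith [mul_nonneg (by linarith : 0 ≤ w) (sq_nonneg (K u - w * K (u * w ^ 2)))]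
  rw [integral_add ((integrable_kernel_sq hK).const_mul _)
    ((integrable_kernel_comp_mul_sq hK hs0.ne').const_mul _), integral_const_mul,
    integral_const_mul, integral_kernel_comp_mul_sq K hs0] at h1
  have h2 : (1 - w) * (∫ u, K u ^ 2) + w ^ 3 * (w - 1) * ((∫ u, K u ^ 2) / s) =
      (w - 1) ^ 2 * ∫ u, K u ^ 2 := by
    rw [← hws]; field_simp; ring
  rw [h2] at h1
  have h3 : (1 - 1 / Real.sqrt a) ^ 2 * s ≤ (w - 1) ^ 2 := by
    have h4 : 0 ≤ 1 - 1 / Real.sqrt a := by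
      rw [sub_nonneg, div_le_one (by linarith)]; exact ha1.le
    have h5 : (1 - 1 / Real.sqrt a) * w ≤ w - 1 := by
      have : 1 ≤ 1 / Real.sqrt a * w := by
        rw [one_div_mul_eq_div, le_div_iff₀ (by linarith)]; linarith
      linarith
    calc (1 - 1 / Real.sqrt a) ^ 2 * s = ((1 - 1 / Real.sqrt a) * w) ^ 2 := by rw [← hws]; ring
      _ ≤ _ := pow_le_pow_left₀ (by positivity) h5 2
  calc (1 - 1 / Real.sqrt a) ^ 2 * (M * ∫ u, K u ^ 2) / (n * η)
      = M / (n * h) * ((1 - 1 / Real.sqrt a) ^ 2 * s * ∫ u, K u ^ 2) := by rw [hs]; field_simp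
    _ ≤ M / (n * h) * ((w - 1) ^ 2 * ∫ u, K u ^ 2) := by gcongr
    _ ≤ _ := by gcongr

/-! ### Deviations of the kernel estimator -/

theorem kmean_eq_integral_obsLaw {f : ℝ → ℝ} (hf : IsDensity f) (K : ℝ → ℝ) (h x : ℝ) :
    kmean K f h x = ∫ y, kfun K h x y ∂(obsLaw f) := by
  rw [integral_obsLaw hf]; rfl

theorem kde_sub_kmean {f : ℝ → ℝ} (hf : IsDensity f) {n : ℕ} (X : Fin n → ℝ) (h x : ℝ) :
    kde K X h x - kmean K f h x = empDev (obsLaw f) (kfun K h x) X := by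
  rw [kmean_eq_integral_obsLaw hf]; rfl

theorem kde_sub_kde_centered (hK : IsKernelOfOrder K r) {f : ℝ → ℝ} (hf : IsDensity f) {n : ℕ}
    (X : Fin n → ℝ) {h η : ℝ} (hh : 0 < h) (hη : 0 < η) (x : ℝ) :
    (kde K X h x - kde K X η x) - (kmean K f h x - kmean K f η x) =
      empDev (obsLaw f) (fun y => kfun K h x y - kfun K η x y) X := by
  obtain ⟨B, hB⟩ := hK.bounded
  have := isProbabilityMeasure_obsLaw hf
  rw [kmean_eq_integral_obsLaw hf, kmean_eq_integral_obsLaw hf, empDev, integral_sub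
    (integrable_of_abs_le (measurable_kfun hK h x) (abs_kfun_le hB hh x))
    (integrable_of_abs_le (measurable_kfun hK η x) (abs_kfun_le hB hη x)),
    Finset.sum_sub_distrib]
  simp only [kde, kfun]; ring

theorem integral_kfun_sub_sq_obsLaw_le (hK : IsKernelOfOrder K r) {f : ℝ → ℝ} (hf : IsDensity f)
    {M : ℝ} (hM : 0 < M) {n : ℕ} (hn : 0 < n) {h η : ℝ} (hη : 0 < η) (hηh : η < h) {x : ℝ}
    (hfM : ∀ y, |y - x| ≤ h → f y ≤ M) :
    ∫ y, (kfun K h x y - kfun K η x y) ^ 2 ∂(obsLaw f) ≤ n * vTwo K M n h η ^ 2 := by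
  obtain ⟨B, hB⟩ := hK.bounded
  have hh : 0 < h := hη.trans hηh
  have hn' : (0 : ℝ) < n := by exact_mod_cast hn
  have hs : ∀ y, h < |y - x| → kfun K h x y - kfun K η x y = 0 := fun y hy => by
    rw [kfun_eq_zero hK hh hy, kfun_eq_zero hK hη (hηh.trans hy), sub_zero]
  refine (integral_sq_obsLaw_le hf (integrable_sq_of_support
    ((measurable_kfun hK h x).sub (measurable_kfun hK η x)) (C := B / h + B / η)
    (fun y => (abs_sub _ _).trans
      (add_le_add (abs_kfun_le hB hh x y) (abs_kfun_le hB hη x y))) hs) hfM hs).trans ?_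
  change M * ∫ y, (kfun K h x y - kfun K η x y) ^ 2 ≤ _
  rw [integral_kfun_sub_sq hK hη hηh, vTwo_sq hK hM n hη hηh, intervalIntegral_sub_sq_eq hK hη hηh]
  apply le_of_eq
  rw [← mul_assoc, ← mul_assoc]
  congr 1
  field_simp

theorem integral_kfun_sq_obsLaw_le (hK : IsKernelOfOrder K r) {f : ℝ → ℝ} (hf : IsDensity f)
    {M : ℝ} {h : ℝ} (hh : 0 < h) {x : ℝ} (hfM : ∀ y, |y - x| ≤ h → f y ≤ M) :
    ∫ y, kfun K h x y ^ 2 ∂(obsLaw f) ≤ M * (∫ u, K u ^ 2) / h := by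
  obtain ⟨B, hB⟩ := hK.bounded
  have hs : ∀ y, h < |y - x| → kfun K h x y = 0 := fun y hy => kfun_eq_zero hK hh hy
  refine (integral_sq_obsLaw_le hf (integrable_sq_of_support
    (measurable_kfun hK h x) (C := B / h) (abs_kfun_le hB hh x) hs) hfM hs).trans ?_
  rw [integral_kfun_sq K hh, mul_div_assoc]

end Kernel

/-! ### The grid of bandwidths -/

section Grid

variable {a : ℝ} {n : ℕ}

theorem bandwidths_finite (a : ℝ) (n : ℕ) : (bandwidths a n).Finite := by
  refine ((Finset.range (⌊Real.logb a ((n : ℝ) / Real.log n ^ 3)⌋.toNat + 1)).image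
    fun j : ℕ => (a ^ j)⁻¹).finite_toSet.subset ?_
  rintro h ⟨j, hj, rfl⟩
  rw [Finset.coe_image]
  exact ⟨j, by simp; omega, rfl⟩

theorem bandwidths_pos (ha : 1 < a) {h : ℝ} (hh : h ∈ bandwidths a n) : 0 < h := by
  obtain ⟨j, -, rfl⟩ := hh
  positivity

theorem bandwidths_le_one (ha : 1 < a) {h : ℝ} (hh : h ∈ bandwidths a n) : h ≤ 1 := by
  obtain ⟨j, -, rfl⟩ := hh
  exact inv_le_one_of_one_le₀ (one_le_pow₀ ha.le)

theorem natCast_le_floor_logb_iff (ha : 1 < a) {t : ℝ} (ht : 0 < t) (j : ℕ) :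
    (j : ℤ) ≤ ⌊Real.logb a t⌋ ↔ a ^ j ≤ t := by
  rw [Int.le_floor, Int.cast_natCast, Real.le_logb_iff_rpow_le ha ht, Real.rpow_natCast]

theorem one_lt_log_of_three_le (hn : 3 ≤ n) : 1 < Real.log n := by
  rw [Real.lt_log_iff_exp_lt (by positivity)]
  have : (3 : ℝ) ≤ n := by exact_mod_cast hn
  linarith [Real.exp_one_lt_d9]

/-- Clears the floor and the logarithm to base `a`; taking `n ≥ 3` ensures `log n > 1`. -/
theorem mem_bandwidths_iff (ha : 1 < a) (hn : 3 ≤ n) {h : ℝ} :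
    h ∈ bandwidths a n ↔ ∃ j : ℕ, Real.log n ^ 3 ≤ n * (a ^ j)⁻¹ ∧ h = (a ^ j)⁻¹ := by
  have hlog := one_lt_log_of_three_le hn
  have hn' : (0 : ℝ) < n := by positivity
  have : ∀ j : ℕ, (j : ℤ) ≤ ⌊Real.logb a ((n : ℝ) / Real.log n ^ 3)⌋ ↔
      Real.log n ^ 3 ≤ n * (a ^ j)⁻¹ := by
    intro j
    rw [natCast_le_floor_logb_iff ha (by positivity), le_div_iff₀ (by positivity),
      ← div_eq_mul_inv, le_div_iff₀ (by positivity), mul_comm]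
  simp only [bandwidths, mem_ofPred_eq, this]

theorem log_pow_le_of_mem_bandwidths (ha : 1 < a) (hn : 3 ≤ n) {h : ℝ}
    (hh : h ∈ bandwidths a n) : Real.log n ^ 3 ≤ n * h := by
  obtain ⟨j, hj, rfl⟩ := (mem_bandwidths_iff ha hn).1 hh
  exact hj

theorem mul_mem_bandwidths (ha : 1 < a) {h h' : ℝ} (hh : h ∈ bandwidths a n)
    (hh' : h' ∈ bandwidths a n) (hlt : h' < h) : a * h' ∈ bandwidths a n ∧ a * h' ≤ h := by
  obtain ⟨i, hi, rfl⟩ := hh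
  obtain ⟨j, hj, rfl⟩ := hh'
  have hij : i < j := by
    by_contra hij
    rw [not_lt] at hij
    exact absurd hlt (not_lt.2 (inv_anti₀ (by positivity) (pow_le_pow_right₀ ha.le hij)))
  obtain ⟨k, rfl⟩ : ∃ k, j = k + 1 := ⟨j - 1, by omega⟩
  have h1 : a * (a ^ (k + 1))⁻¹ = (a ^ k)⁻¹ := by field_simp; ring
  rw [h1]
  refine ⟨⟨k, by omega, rfl⟩, inv_anti₀ (by positivity) (pow_le_pow_right₀ ha.le (by omega))⟩

theorem le_of_mem_bandwidths_of_lt_mul (ha : 1 < a) {h η : ℝ} (hh : h ∈ bandwidths a n)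
    (hη : η ∈ bandwidths a n) (hlt : η < a * h) : η ≤ h := by
  by_contra hc
  exact absurd hlt (not_lt.2 (mul_mem_bandwidths ha hη hh (not_le.1 hc)).2)

/-- Consecutive grid points have ratio `a ≤ 2`, so an ideal bandwidth can be replaced by a grid one
at the cost of a factor 2. The factor 2 in the lower bound on `t` keeps the replacement inside the
grid. -/
theorem exists_mem_bandwidths_between (ha : 1 < a) (ha2 : a ≤ 2) (hn : 3 ≤ n) {t : ℝ}
    (ht : 2 * (Real.log n ^ 3 / n) ≤ t) (ht1 : t ≤ 1) : ∃ h ∈ bandwidths a n, t / 2 ≤ h ∧ h ≤ t := by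
  have hlog := one_lt_log_of_three_le hn
  have hn' : (0 : ℝ) < n := by positivity
  have ht0 : 0 < t := lt_of_lt_of_le (by positivity) ht
  obtain ⟨j, hj1, hj2⟩ := exists_nat_pow_near (x := 1 / t) (one_le_one_div ht0 ht1) ha
  by_cases heq : a ^ j = 1 / t
  · refine ⟨t, (mem_bandwidths_iff ha hn).2 ⟨j, ?_, by rw [heq]; simp⟩, by linarith, le_rfl⟩
    rw [heq, one_div, inv_inv]
    rw [← mul_div_assoc, div_le_iff₀ hn'] at ht
    nlinarith [pow_pos (by linarith : 0 < Real.log n) 3]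
  · have hlow : t / 2 ≤ (a ^ (j + 1))⁻¹ := by
      rw [le_inv_comm₀ (by positivity) (by positivity), inv_div, pow_succ]
      calc a ^ j * a ≤ 1 / t * 2 := by gcongr
        _ = 2 / t := by ring
    refine ⟨(a ^ (j + 1))⁻¹, (mem_bandwidths_iff ha hn).2 ⟨j + 1, ?_, rfl⟩, hlow, ?_⟩
    · have h3 : Real.log n ^ 3 / n ≤ t / 2 := by linarith
      have h4 := (div_le_iff₀ hn').1 (h3.trans hlow)
      linarith
    · rw [inv_le_comm₀ (by positivity) ht0, inv_eq_one_div]; exact hj2.le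

/-- Comparison with the full geometric series, hence uniform in `n`; this is why sums over the grid
cost no logarithm. -/
theorem sum_rpow_le_of_subset_bandwidths (ha : 1 < a) {q : ℝ} (hq : 0 < q) (F : Finset ℝ)
    (hF : ∀ h ∈ F, h ∈ bandwidths a n) : ∑ h ∈ F, h ^ q ≤ (1 - a ^ (-q))⁻¹ := by
  have h1 : ∀ h ∈ F, ∃ j : ℕ, h = (a ^ j)⁻¹ := fun h hh => by
    obtain ⟨j, -, hj⟩ := hF h hh; exact ⟨j, hj⟩
  choose! J hJ using h1
  have hr0 : 0 ≤ a ^ (-q) := by positivity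
  have hr1 : a ^ (-q) < 1 := Real.rpow_lt_one_of_one_lt_of_neg ha (by linarith)
  have hinj : Set.InjOn J F := fun x hx y hy hxy => by rw [hJ x hx, hJ y hy, hxy]
  calc ∑ h ∈ F, h ^ q = ∑ h ∈ F, (a ^ (-q)) ^ (J h) := by
        refine Finset.sum_congr rfl fun h hh => ?_
        conv_lhs => rw [hJ h hh]
        rw [← Real.rpow_natCast, ← Real.rpow_natCast, ← Real.rpow_neg (by linarith),
          ← Real.rpow_mul (by linarith), ← Real.rpow_mul (by linarith)]
        congr 1; ring
    _ = ∑ j ∈ F.image J, (a ^ (-q)) ^ j := (Finset.sum_image hinj).symm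
    _ ≤ ∑' j : ℕ, (a ^ (-q)) ^ j :=
        (summable_geometric_of_lt_one hr0 hr1).sum_le_tsum _ fun j _ => by positivity
    _ = _ := tsum_geometric_of_lt_one hr0 hr1

end Grid

/-! ### Thresholds -/

theorem one_le_lam (D₂ h : ℝ) : 1 ≤ lam D₂ h := le_max_left _ _

theorem le_lam_sq {D₂ h : ℝ} : D₂ * Real.log (1 / h) ≤ lam D₂ h ^ 2 := by
  rcases le_total 0 (D₂ * Real.log (1 / h)) with h0 | h0
  · calc D₂ * Real.log (1 / h) = Real.sqrt (D₂ * Real.log (1 / h)) ^ 2 := (Real.sq_sqrt h0).symm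
      _ ≤ _ := pow_le_pow_left₀ (Real.sqrt_nonneg _) (le_max_right _ _) 2
  · exact h0.trans (sq_nonneg _)

theorem lam_le {D₂ h : ℝ} {n : ℕ} (hD₂ : 1 ≤ D₂) (hn : 3 ≤ n) (hh : 0 < h) (hnh : 1 ≤ n * h) :
    lam D₂ h ≤ Real.sqrt (D₂ * Real.log n) := by
  have hlog := one_lt_log_of_three_le hn
  refine max_le ?_ (Real.sqrt_le_sqrt ?_)
  · exact Real.one_le_sqrt.2 (by nlinarith)
  · have : Real.log (1 / h) ≤ Real.log n :=
      Real.log_le_log (by positivity) (by rw [div_le_iff₀ hh]; exact hnh)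
    gcongr

theorem lam_anti {D₂ h h' : ℝ} (hD₂ : 0 ≤ D₂) (hh' : 0 < h') (hle : h' ≤ h) :
    lam D₂ h ≤ lam D₂ h' := by
  unfold lam
  gcongr
  exact one_div_pos.2 (hh'.trans_le hle)

theorem vOne_eq (K : ℝ → ℝ) {M : ℝ} {n : ℕ} {h : ℝ} :
    vOne K M n h = Real.sqrt (M * (∫ u, K u ^ 2) / (n * h)) := rfl

theorem vOne_anti {K : ℝ → ℝ} {M : ℝ} (hM : 0 ≤ M) {n : ℕ} (hn : 0 < n) {h h' : ℝ} (hh' : 0 < h')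
    (hle : h' ≤ h) : vOne K M n h ≤ vOne K M n h' := by
  have : 0 ≤ M * ∫ u, K u ^ 2 := mul_nonneg hM (integral_nonneg fun u => sq_nonneg _)
  have hn' : (0 : ℝ) < n := by exact_mod_cast hn
  unfold vOne
  gcongr

theorem vTwo_nonneg (K : ℝ → ℝ) (M : ℝ) (n : ℕ) (h η : ℝ) : 0 ≤ vTwo K M n h η :=
  Real.sqrt_nonneg _

theorem vOne_nonneg (K : ℝ → ℝ) (M : ℝ) (n : ℕ) (h : ℝ) : 0 ≤ vOne K M n h :=
  Real.sqrt_nonneg _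

/-! ### The selection rule -/

section Selection

variable {K : ℝ → ℝ} {a M D₁ D₂ : ℝ} {n : ℕ}

/-- The smallest grid bandwidth is vacuously admissible and the grid is finite, so the supremum is
attained. -/
theorem hHat_mem (hne : (bandwidths a n).Nonempty) (X : Fin n → ℝ) (x : ℝ) :
    hHat K a M D₁ D₂ X x ∈ bandwidths a n ∧ ∀ η ∈ bandwidths a n, η < hHat K a M D₁ D₂ X x →
      |kde K X (hHat K a M D₁ D₂ X x) x - kde K X η x| ≤
        psi K M D₁ D₂ n (hHat K a M D₁ D₂ X x) η := by
  set S := {h | h ∈ bandwidths a n ∧ ∀ η ∈ bandwidths a n, η < h →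
    |kde K X h x - kde K X η x| ≤ psi K M D₁ D₂ n h η} with hS
  have hfin : S.Finite := (bandwidths_finite a n).subset fun h hh => hh.1
  obtain ⟨h₀, hh₀, hmin⟩ := (bandwidths a n).exists_min_image id (bandwidths_finite a n) hne
  have hSne : S.Nonempty := ⟨h₀, hh₀, fun η hη hlt => absurd hlt (not_lt.2 (hmin η hη))⟩
  exact hSne.csSup_mem hfin

theorem le_hHat {X : Fin n → ℝ} {x h : ℝ} (hh : h ∈ bandwidths a n)
    (hadm : ∀ η ∈ bandwidths a n, η < h →
      |kde K X h x - kde K X η x| ≤ psi K M D₁ D₂ n h η) : h ≤ hHat K a M D₁ D₂ X x :=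
  le_csSup (((bandwidths_finite a n).subset fun _ hh => hh.1).bddAbove) ⟨hh, hadm⟩

/-- Both noise levels are comparable to that of the smaller bandwidth `η`, and both factors `lam`
are at most `√(D₂ log n)`. -/
theorem psi_le {r : ℕ} (hK : IsKernelOfOrder K r) (hM : 0 < M) (hD₁ : 1 ≤ D₁) (hD₂ : 1 ≤ D₂)
    (hn : 3 ≤ n) {h η : ℝ} (hη : 0 < η) (hηh : η < h) (hnη : 1 ≤ n * η) :
    psi K M D₁ D₂ n h η ≤
      (2 * D₁ + 2) * Real.sqrt (M * (∫ u, K u ^ 2) * D₂) * Real.sqrt (Real.log n / (n * η)) := by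
  have hlog := one_lt_log_of_three_le hn
  have hn' : (0 : ℝ) < n := by positivity
  have hh : 0 < h := hη.trans hηh
  have hκ := integral_kernel_sq_pos hK
  have hl : lam D₂ η ≤ Real.sqrt (D₂ * Real.log n) := lam_le hD₂ hn hη hnη
  have hlh : lam D₂ h ≤ Real.sqrt (D₂ * Real.log n) :=
    (lam_anti (by linarith) hη hηh.le).trans hl
  have hv2 : vTwo K M n h η ≤ 2 * vOne K M n η := by
    refine abs_le_of_sq_le_sq' ?_ (by have := vOne_nonneg K M n η; linarith) |>.2
    refine (vTwo_sq_le hK hM (by omega) hη hηh).trans (le_of_eq ?_)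
    rw [mul_pow, vOne_eq, Real.sq_sqrt (by positivity)]; ring
  have hv1 : vOne K M n h ≤ vOne K M n η := vOne_anti hM.le (by omega) hη hηh.le
  have hprod : vOne K M n η * Real.sqrt (D₂ * Real.log n) =
      Real.sqrt (M * (∫ u, K u ^ 2) * D₂) * Real.sqrt (Real.log n / (n * η)) := by
    rw [vOne_eq, ← Real.sqrt_mul (by positivity), ← Real.sqrt_mul (by positivity)]
    congr 1; ring
  have h0 := vOne_nonneg K M n η
  have h1 := vOne_nonneg K M n h
  have h2 : 0 ≤ lam D₂ h := zero_le_one.trans (one_le_lam _ _)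
  have h3 : 0 ≤ lam D₂ η := zero_le_one.trans (one_le_lam _ _)
  calc psi K M D₁ D₂ n h η
      ≤ 2 * D₁ * vOne K M n η * Real.sqrt (D₂ * Real.log n) +
        2 * vOne K M n η * Real.sqrt (D₂ * Real.log n) := by
        unfold psi; gcongr
    _ = (2 * D₁ + 2) * (vOne K M n η * Real.sqrt (D₂ * Real.log n)) := by ring
    _ = _ := by rw [hprod]; ring

/-- The event that some centred difference exceeds its random threshold at the bandwidth following
`h` in the grid. -/
def badEvent (K : ℝ → ℝ) (a M D₂ : ℝ) (n : ℕ) (f : ℝ → ℝ) (x h : ℝ) : Set (Fin n → ℝ) :=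
  {X | ∃ η ∈ bandwidths a n, η ≤ h ∧ vTwo K M n (a * h) η * lam D₂ η <
    |empDev (obsLaw f) (fun y => kfun K (a * h) x y - kfun K η x y) X|}

/-- If the selected `h'` is below `h`, the next bandwidth `a * h' ≤ h` must be rejected. The first
summand of `psi` pays for the difference of the means, so the second one is exceeded by the centred
difference. -/
theorem mem_badEvent {r : ℕ} (hK : IsKernelOfOrder K r) (ha : 1 < a) {f : ℝ → ℝ}
    (hf : IsDensity f) {X : Fin n → ℝ} {x h : ℝ} (hh : h ∈ bandwidths a n)
    (hmean : ∀ h' ∈ bandwidths a n, h' ≤ h → ∀ η ∈ bandwidths a n, η < h' →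
      |kmean K f h' x - kmean K f η x| ≤ 2 * D₁ * vOne K M n h' * lam D₂ h')
    (hlt : hHat K a M D₁ D₂ X x < h) : X ∈ badEvent K a M D₂ n f x (hHat K a M D₁ D₂ X x) := by
  set h' := hHat K a M D₁ D₂ X x with hh'
  have hmem := (hHat_mem (K := K) (M := M) (D₁ := D₁) (D₂ := D₂) ⟨h, hh⟩ X x).1
  obtain ⟨hup, hle⟩ := mul_mem_bandwidths ha hh hmem hlt
  have hpos := bandwidths_pos ha hmem
  by_contra hcon
  have h1 : a * h' ≤ h' := by
    refine le_hHat hup fun η hη hηlt => ?_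
    have hηle := le_of_mem_bandwidths_of_lt_mul ha hmem hη hηlt
    have h2 : ¬ (vTwo K M n (a * h') η * lam D₂ η <
      |empDev (obsLaw f) (fun y => kfun K (a * h') x y - kfun K η x y) X|) := fun h3 =>
      hcon ⟨η, hη, hηle, h3⟩
    rw [not_lt, ← kde_sub_kde_centered hK hf X (by nlinarith) (bandwidths_pos ha hη)] at h2
    have h4 := hmean _ hup hle η hη hηlt
    calc |kde K X (a * h') x - kde K X η x|
        ≤ |(kde K X (a * h') x - kde K X η x) - (kmean K f (a * h') x - kmean K f η x)| +
          |kmean K f (a * h') x - kmean K f η x| := by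
          have := abs_add_le ((kde K X (a * h') x - kde K X η x) -
            (kmean K f (a * h') x - kmean K f η x)) (kmean K f (a * h') x - kmean K f η x)
          simpa using this
      _ ≤ _ := by unfold psi; linarith
  have : 1 * h' < a * h' := by gcongr
  linarith

end Selection

/-! ### The oracle inequality at a point -/

theorem exists_nat_le_log (R : ℝ) : ∃ n₀ : ℕ, 3 ≤ n₀ ∧ ∀ n : ℕ, n₀ ≤ n → R ≤ Real.log n := by
  have h := (Real.tendsto_log_atTop.comp tendsto_natCast_atTop_atTop).eventually_ge_atTop R
  obtain ⟨N, hN⟩ := Filter.eventually_atTop.1 h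
  exact ⟨max N 3, le_max_right _ _, fun n hn => hN n ((le_max_left _ _).trans hn)⟩

section Oracle

variable {K : ℝ → ℝ} {r : ℕ} {p a M D₁ D₂ : ℝ}

/-- Chernoff's bound at `θ = l / v` with threshold `v * l`, where `v = vTwo` and `l = lam`, gives
the exponent `-l ^ 2 + l ^ 2 / 2 * (1 + τ)`. Since `l ^ 2 ≥ D₂ log (1 / η)`, this is a power of `η`,
and `D₂ > 4 * p` leaves an excess `ε` over `2 * p`. -/
theorem exists_tail_bound (hK : IsKernelOfOrder K r) (hp : 1 ≤ p) (ha : 1 < a)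
    (hD₂ : 4 * p < D₂) (hM : 0 < M) :
    ∃ ε : ℝ, 0 < ε ∧ ∃ n₀ : ℕ, 3 ≤ n₀ ∧ ∀ n : ℕ, n₀ ≤ n → ∀ f : ℝ → ℝ, IsDensity f →
      ∀ x h η : ℝ, η ∈ bandwidths a n → a * η ≤ h → (∀ y, |y - x| ≤ h → f y ≤ M) →
      sampleLaw f n {X | vTwo K M n h η * lam D₂ η <
        |empDev (obsLaw f) (fun y => kfun K h x y - kfun K η x y) X|} ≤
      ENNReal.ofReal (2 * η ^ (2 * p + ε)) := by
  obtain ⟨B, hB⟩ := hK.bounded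
  have hκ := integral_kernel_sq_pos hK
  have hB0 : 0 ≤ B := (abs_nonneg _).trans (hB 0)
  set ε := (D₂ - 4 * p) / 4 with hε
  have hε0 : 0 < ε := by rw [hε]; linarith
  have hDε : D₂ = 4 * p + 4 * ε := by rw [hε]; ring
  have hD0 : 0 < D₂ := by linarith
  have ha1 : 1 < Real.sqrt a := Real.lt_sqrt_of_sq_lt (by simpa using ha)
  set c := (1 - 1 / Real.sqrt a) * Real.sqrt (M * ∫ u, K u ^ 2) with hc
  have hfac : 0 < 1 - 1 / Real.sqrt a := by
    rw [sub_pos, div_lt_one (by linarith)]; exact ha1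
  have hc0 : 0 < c := by positivity
  -- Chosen so that `(1 - τ) / 2 * D₂ = 2 * p + ε`.
  set τ := ε / (2 * p + 2 * ε) with hτ
  have hτ0 : 0 < τ := by positivity
  have hlogτ : 0 < Real.log (1 + τ) := Real.log_pos (by linarith)
  obtain ⟨n₀, hn₀3, hn₀⟩ := exists_nat_le_log (4 * B * Real.sqrt D₂ / c / Real.log (1 + τ))
  refine ⟨ε, hε0, n₀, hn₀3, fun n hn f hf x h η hη hηh hfM => ?_⟩
  have hn3 : 3 ≤ n := hn₀3.trans hn
  have hn' : (0 : ℝ) < n := by positivity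
  have hlog := one_lt_log_of_three_le hn3
  have hη0 := bandwidths_pos ha hη
  have hlt : η < h := by nlinarith
  have hh0 : 0 < h := hη0.trans hlt
  have := isProbabilityMeasure_obsLaw hf
  have hnη : Real.log n ^ 3 ≤ n * η := log_pow_le_of_mem_bandwidths ha hn3 hη
  have hnη1 : 1 ≤ n * η := (one_le_pow₀ hlog.le).trans hnη
  set v := vTwo K M n h η with hv
  set l := lam D₂ η with hl
  have hl1 : 1 ≤ l := one_le_lam _ _
  have hvlow : c / Real.sqrt (n * η) ≤ v := by
    have h1 := le_vTwo_sq hK hM (by omega : 0 < n) ha hη0 hηh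
    refine abs_le_of_sq_le_sq' ?_ (vTwo_nonneg _ _ _ _ _) |>.2
    refine le_trans (le_of_eq ?_) h1
    rw [div_pow, Real.sq_sqrt (by positivity), hc, mul_pow, Real.sq_sqrt (by positivity)]
  have hv0 : 0 < v := lt_of_lt_of_le (by positivity) hvlow
  have hbound : ∀ y, |kfun K h x y - kfun K η x y| ≤ 2 * B / η := by
    intro y
    have h1 := abs_kfun_le hB hh0 x y
    have h2 := abs_kfun_le hB hη0 x y
    have h3 : B / h ≤ B / η := by gcongr
    refine (abs_sub _ _).trans ?_
    rw [mul_div_assoc]; linarith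
  have htail := measure_empDev_gt_le
    ((measurable_kfun hK h x).sub (measurable_kfun hK η x)) hbound
    (integral_kfun_sub_sq_obsLaw_le hK hf hM (by omega : 0 < n) hη0 hlt hfM) (by omega : 0 < n)
    (θ := l / v) (by positivity) (v * l)
  refine htail.trans (ENNReal.ofReal_le_ofReal ?_)
  have hlu : l ≤ Real.sqrt (D₂ * Real.log n) := lam_le (by linarith) hn3 hη0 hnη1
  -- Here the cube of the logarithm in the grid is used: the left side is of order `√(log n) / √(n *
  -- η)`, and `n * η ≥ log³ n` makes this at most of order `1 / log n`.
  have hexp : 2 * (l / v) * (2 * B / η) / n ≤ Real.log (1 + τ) := by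
    have h1 : 1 / v ≤ Real.sqrt (n * η) / c := by
      rw [one_div_le hv0 (by positivity), one_div_div]; exact hvlow
    have h2 : Real.sqrt (n * η) * Real.sqrt (n * η) = n * η := Real.mul_self_sqrt (by positivity)
    have h3 : Real.log n * Real.sqrt (Real.log n) ≤ Real.sqrt (n * η) := by
      apply Real.le_sqrt_of_sq_le
      rw [mul_pow, Real.sq_sqrt (by linarith)]
      calc Real.log n ^ 2 * Real.log n = Real.log n ^ 3 := by ring
        _ ≤ _ := hnη
    have hs0 : 0 < Real.sqrt (n * η) := by positivity
    have h4 := hn₀ n hn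
    rw [div_le_iff₀ hlogτ, div_le_iff₀ hc0] at h4
    have h5 : 0 < Real.sqrt (Real.log n) := Real.sqrt_pos.2 (by linarith)
    calc 2 * (l / v) * (2 * B / η) / n = 4 * B * l / (n * η) * (1 / v) := by field_simp; ring
      _ ≤ 4 * B * Real.sqrt (D₂ * Real.log n) / (n * η) * (Real.sqrt (n * η) / c) := by gcongr
      _ = 4 * B * Real.sqrt D₂ * Real.sqrt (Real.log n) / (c * Real.sqrt (n * η)) := by
          rw [Real.sqrt_mul hD0.le, ← h2]; field_simp; rw [Real.sq_sqrt (by positivity)]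
      _ ≤ 4 * B * Real.sqrt D₂ * Real.sqrt (Real.log n) /
          (c * (Real.log n * Real.sqrt (Real.log n))) := by gcongr
      _ = 4 * B * Real.sqrt D₂ / (c * Real.log n) := by field_simp
      _ ≤ _ := by rw [div_le_iff₀ (by positivity)]; linarith
  have hexp' : Real.exp (2 * (l / v) * (2 * B / η) / n) ≤ 1 + τ := by
    calc _ ≤ Real.exp (Real.log (1 + τ)) := Real.exp_le_exp.2 hexp
      _ = _ := Real.exp_log (by linarith)
  gcongr
  rw [Real.rpow_def_of_pos hη0]
  apply Real.exp_le_exp.2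
  have h1 : l / v * (v * l) = l ^ 2 := by field_simp
  have h2 : (l / v) ^ 2 * (n * v ^ 2) / (2 * n) = l ^ 2 / 2 := by field_simp
  rw [h1, h2]
  have h3 : l ^ 2 / 2 * Real.exp (2 * (l / v) * (2 * B / η) / n) ≤ l ^ 2 / 2 * (1 + τ) := by gcongr
  have h4 : D₂ * Real.log (1 / η) ≤ l ^ 2 := le_lam_sq
  rw [one_div, Real.log_inv] at h4
  have h5 : (1 - τ) / 2 * D₂ = 2 * p + ε := by rw [hτ, hDε]; field_simp; ring
  have h6 : 0 ≤ (1 - τ) / 2 := by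
    have : τ ≤ 1 := by rw [hτ, div_le_one (by positivity)]; linarith
    linarith
  have h7 : (1 - τ) / 2 * (D₂ * -Real.log η) ≤ (1 - τ) / 2 * l ^ 2 := by gcongr
  have h8 : (1 - τ) / 2 * (D₂ * -Real.log η) = -((2 * p + ε) * Real.log η) := by rw [← h5]; ring
  linarith

theorem measurableSet_badEvent (hK : IsKernelOfOrder K r) (a M D₂ : ℝ) (n : ℕ) (f : ℝ → ℝ)
    (x h : ℝ) : MeasurableSet (badEvent K a M D₂ n f x h) := by
  have h1 : badEvent K a M D₂ n f x h = ⋃ η ∈ {η | η ∈ bandwidths a n ∧ η ≤ h},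
      {X | vTwo K M n (a * h) η * lam D₂ η <
        |empDev (obsLaw f) (fun y => kfun K (a * h) x y - kfun K η x y) X|} := by
    ext X; simp [badEvent, and_assoc]
  rw [h1]
  refine ((bandwidths_finite a n).subset fun η hη => hη.1).measurableSet_biUnion fun η _ => ?_
  have := measurable_empDev (μ := obsLaw f) (n := n)
    ((measurable_kfun hK (a * h) x).sub (measurable_kfun hK η x))
  exact measurableSet_lt measurable_const (measurable_norm.comp this)

/-- Union bound over `η ≤ h`: the factor `η ^ (2 * p)` is bounded by `h ^ (2 * p)`, and the excess
`η ^ ε` makes the sum converge. -/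
theorem exists_badEvent_bound (hK : IsKernelOfOrder K r) (hp : 1 ≤ p) (ha : 1 < a)
    (hD₂ : 4 * p < D₂) (hM : 0 < M) :
    ∃ C : ℝ, 0 < C ∧ ∃ n₀ : ℕ, 3 ≤ n₀ ∧ ∀ n : ℕ, n₀ ≤ n → ∀ f : ℝ → ℝ, IsDensity f →
      ∀ x h : ℝ, 0 < h → (∀ y, |y - x| ≤ a * h → f y ≤ M) →
      sampleLaw f n (badEvent K a M D₂ n f x h) ≤ ENNReal.ofReal (C * h ^ (2 * p)) := by
  obtain ⟨ε, hε, n₀, hn₀3, htail⟩ := exists_tail_bound hK hp ha hD₂ hM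
  have hlt1 : a ^ (-ε) < 1 := Real.rpow_lt_one_of_one_lt_of_neg ha (by linarith)
  have hCpos : 0 < (1 - a ^ (-ε))⁻¹ := inv_pos.2 (by linarith)
  refine ⟨2 * (1 - a ^ (-ε))⁻¹, by positivity, n₀, hn₀3, fun n hn f hf x h hh hfM => ?_⟩
  have hfin : {η | η ∈ bandwidths a n ∧ η ≤ h}.Finite :=
    (bandwidths_finite a n).subset fun η hη => hη.1
  set F := hfin.toFinset with hF
  have hsub : badEvent K a M D₂ n f x h ⊆ ⋃ η ∈ F,
      {X | vTwo K M n (a * h) η * lam D₂ η <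
        |empDev (obsLaw f) (fun y => kfun K (a * h) x y - kfun K η x y) X|} := by
    rintro X ⟨η, hη, hηh, hX⟩
    simp only [mem_iUnion]
    exact ⟨η, by simp [hF, hη, hηh], hX⟩
  have hmemF : ∀ η ∈ F, η ∈ bandwidths a n ∧ η ≤ h := fun η hη => by simpa [hF] using hη
  calc sampleLaw f n (badEvent K a M D₂ n f x h)
      ≤ ∑ η ∈ F, sampleLaw f n {X | vTwo K M n (a * h) η * lam D₂ η <
        |empDev (obsLaw f) (fun y => kfun K (a * h) x y - kfun K η x y) X|} :=
        (measure_mono hsub).trans (measure_biUnion_finset_le _ _)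
    _ ≤ ∑ η ∈ F, ENNReal.ofReal (2 * h ^ (2 * p) * η ^ ε) := by
        refine Finset.sum_le_sum fun η hη => ?_
        obtain ⟨hη1, hη2⟩ := hmemF η hη
        have hη0 := bandwidths_pos ha hη1
        refine (htail n hn f hf x (a * h) η hη1 (by gcongr) hfM).trans
          (ENNReal.ofReal_le_ofReal ?_)
        rw [Real.rpow_add hη0, mul_assoc]
        gcongr
    _ = ENNReal.ofReal (2 * h ^ (2 * p) * ∑ η ∈ F, η ^ ε) := by
        rw [Finset.mul_sum, ENNReal.ofReal_sum_of_nonneg]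
        intro η hη
        have := bandwidths_pos ha (hmemF η hη).1
        positivity
    _ ≤ _ := by
        apply ENNReal.ofReal_le_ofReal
        have := sum_rpow_le_of_subset_bandwidths ha hε F fun η hη => (hmemF η hη).1
        calc 2 * h ^ (2 * p) * ∑ η ∈ F, η ^ ε ≤ 2 * h ^ (2 * p) * (1 - a ^ (-ε))⁻¹ := by gcongr
          _ = _ := by ring

theorem exists_moment_bound (hK : IsKernelOfOrder K r) (hM : 0 < M) {q : ℝ} (hq : 0 < q) :
    ∃ C : ℝ, 0 < C ∧ ∀ (n : ℕ) (f : ℝ → ℝ), 0 < n → IsDensity f → ∀ x h : ℝ, 0 < h → 1 ≤ n * h →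
      (∀ y, |y - x| ≤ h → f y ≤ M) →
      ∫⁻ X, ENNReal.ofReal (|kde K X h x - kmean K f h x| ^ q) ∂(sampleLaw f n) ≤
        ENNReal.ofReal (C * (n * h) ^ (-(q / 2))) := by
  obtain ⟨B, hB⟩ := hK.bounded
  have hκ := integral_kernel_sq_pos hK
  have hB0 : 0 ≤ B := (abs_nonneg _).trans (hB 0)
  set S := Real.sqrt (M * ∫ u, K u ^ 2) + 2 * B with hS
  have hS0 : 0 < S := by positivity
  refine ⟨q ^ q * (2 * Real.exp (Real.exp 1)) * S ^ q, by positivity,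
    fun n f hn hf x h hh hnh hfM => ?_⟩
  have hn' : (0 : ℝ) < n := by exact_mod_cast hn
  have := isProbabilityMeasure_obsLaw hf
  have hsq : 1 ≤ Real.sqrt (n * h) := Real.one_le_sqrt.2 hnh
  have hsq2 : Real.sqrt (n * h) ^ 2 = n * h := Real.sq_sqrt (by positivity)
  have key := lintegral_abs_empDev_rpow_le (measurable_kfun hK h x) (abs_kfun_le hB hh x)
    (integral_kfun_sq_obsLaw_le hK hf hh hfM) hn (s := S / Real.sqrt (n * h)) (q := q)
    (by positivity) hq ?_ ?_
  · simp_rw [kde_sub_kmean hf]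
    refine key.trans (ENNReal.ofReal_le_ofReal (le_of_eq ?_))
    rw [Real.div_rpow hS0.le (by positivity), Real.sqrt_eq_rpow, ← Real.rpow_mul (by positivity),
      Real.rpow_neg (by positivity)]
    rw [show 1 / 2 * q = q / 2 by ring]
    ring
  · rw [div_pow, hsq2]
    have h1 : M * ∫ u, K u ^ 2 ≤ S ^ 2 := by
      calc M * ∫ u, K u ^ 2 = Real.sqrt (M * ∫ u, K u ^ 2) ^ 2 :=
            (Real.sq_sqrt (by positivity)).symm
        _ ≤ S ^ 2 := by gcongr; rw [hS]; linarith
    calc M * (∫ u, K u ^ 2) / h ≤ S ^ 2 / h := by gcongr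
      _ = _ := by field_simp
  · have h1 : 2 * B ≤ S * Real.sqrt (n * h) := by
      have : 2 * B ≤ S := by rw [hS]; linarith [Real.sqrt_nonneg (M * ∫ u, K u ^ 2)]
      nlinarith
    have h2 : n * (S / Real.sqrt (n * h)) = S * Real.sqrt (n * h) / h := by
      field_simp
      rw [hsq2]
    rw [h2, ← mul_div_assoc]
    gcongr

end Oracle

theorem add_rpow_le_two_rpow_mul {w z p : ℝ} (hw : 0 ≤ w) (hz : 0 ≤ z) (hp : 0 ≤ p) :
    (w + z) ^ p ≤ 2 ^ p * (w ^ p + z ^ p) := by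
  have h1 : w + z ≤ 2 * max w z := by
    have := le_max_left w z; have := le_max_right w z; linarith
  calc (w + z) ^ p ≤ (2 * max w z) ^ p := by gcongr
    _ = 2 ^ p * (max w z) ^ p := Real.mul_rpow (by norm_num) (le_max_of_le_left hw)
    _ ≤ 2 ^ p * (w ^ p + z ^ p) := by
        gcongr
        have h2 : 0 ≤ w ^ p := by positivity
        have h3 : 0 ≤ z ^ p := by positivity
        rcases max_cases w z with h | h <;> rw [h.1] <;> linarith

/-- Plays the part of the Cauchy–Schwarz inequality when a `p`-th moment is taken over an event of
small probability. -/
theorem rpow_le_mul_rpow_two_add {z p ε : ℝ} (hz : 0 ≤ z) (hε : 0 < ε) :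
    z ^ p ≤ ε * z ^ (2 * p) + 1 / ε := by
  have h1 : z ^ (2 * p) = (z ^ p) ^ 2 := by
    rw [← Real.rpow_natCast, ← Real.rpow_mul hz]; congr 1; push_cast; ring
  rw [h1]
  have h2 : 0 ≤ z ^ p := by positivity
  rcases le_total (ε * z ^ p) 1 with h | h
  · have : z ^ p ≤ 1 / ε := by rw [le_div_iff₀ hε]; linarith
    have : 0 ≤ ε * (z ^ p) ^ 2 := by positivity
    linarith
  · have : z ^ p ≤ ε * (z ^ p) ^ 2 := by nlinarith
    have : 0 < 1 / ε := by positivity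
    linarith

section Oracle

variable {K : ℝ → ℝ} {r : ℕ} {p a M D₁ D₂ : ℝ}

theorem measurable_kde (hK : IsKernelOfOrder K r) (n : ℕ) :
    Measurable fun z : (Fin n → ℝ) × ℝ × ℝ => kde K z.1 z.2.1 z.2.2 := by
  have := hK.measurable
  unfold kde
  refine measurable_const.mul (Finset.measurable_sum _ fun i _ => ?_)
  have h1 : Measurable fun z : (Fin n → ℝ) × ℝ × ℝ => z.1 i :=
    (measurable_pi_apply i).comp measurable_fst
  fun_prop

/-- The contribution of the event that the selected bandwidth is a given one which is too small. -/
theorem exists_lintegral_badEvent_bound (hK : IsKernelOfOrder K r) (hp : 1 ≤ p) (ha : 1 < a)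
    (hD₂ : 4 * p < D₂) (hM : 0 < M) :
    ∃ C : ℝ, 0 < C ∧ ∃ n₀ : ℕ, 3 ≤ n₀ ∧ ∀ n : ℕ, n₀ ≤ n → ∀ f : ℝ → ℝ, IsDensity f →
      ∀ x h : ℝ, h ∈ bandwidths a n → (∀ y, |y - x| ≤ a * h → f y ≤ M) →
      ∫⁻ X in badEvent K a M D₂ n f x h,
        ENNReal.ofReal (|kde K X h x - kmean K f h x| ^ p) ∂(sampleLaw f n) ≤
      ENNReal.ofReal (C * (n : ℝ) ^ (-(p / 2)) * h ^ (p / 2)) := by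
  obtain ⟨C₁, hC₁, n₁, hn₁, hbad⟩ := exists_badEvent_bound hK hp ha hD₂ hM
  obtain ⟨C₂, hC₂, hmom⟩ := exists_moment_bound hK hM (q := 2 * p) (by linarith)
  refine ⟨C₂ + C₁, by positivity, n₁, hn₁, fun n hn f hf x h hh hfM => ?_⟩
  have hn3 : 3 ≤ n := hn₁.trans hn
  have hn' : (0 : ℝ) < n := by positivity
  have hh0 := bandwidths_pos ha hh
  have hnh : 1 ≤ n * h :=
    (one_le_pow₀ (one_lt_log_of_three_le hn3).le).trans (log_pow_le_of_mem_bandwidths ha hn3 hh)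
  have hfM' : ∀ y, |y - x| ≤ h → f y ≤ M := fun y hy => hfM y (hy.trans (by nlinarith))
  -- This balances the two contributions: `ε * (n * h) ^ (-p)` and `h ^ (2 * p) / ε` both equal `n ^
  -- (-p / 2) * h ^ (p / 2)`.
  set ε := (n * h) ^ (p / 2) * h ^ p with hε
  have hε0 : 0 < ε := by positivity
  have hm := hmom n f (by omega) hf x h hh0 hnh hfM'
  have hb := hbad n hn f hf x h hh0 hfM
  have hmeas : Measurable fun X : Fin n → ℝ => kde K X h x :=
    (measurable_kde hK n).comp (measurable_id.prodMk (measurable_const (a := ((h, x) : ℝ × ℝ))))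
  calc _ ≤ ∫⁻ X in badEvent K a M D₂ n f x h, (ENNReal.ofReal ε *
          ENNReal.ofReal (|kde K X h x - kmean K f h x| ^ (2 * p)) + ENNReal.ofReal (1 / ε))
          ∂(sampleLaw f n) := by
        apply lintegral_mono
        intro X
        simp only
        rw [← ENNReal.ofReal_mul hε0.le, ← ENNReal.ofReal_add (by positivity) (by positivity)]
        exact ENNReal.ofReal_le_ofReal
          (rpow_le_mul_rpow_two_add (abs_nonneg _) hε0)
    _ ≤ ENNReal.ofReal ε * ENNReal.ofReal (C₂ * (n * h) ^ (-(2 * p / 2))) +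
          ENNReal.ofReal (1 / ε) * ENNReal.ofReal (C₁ * h ^ (2 * p)) := by
        rw [lintegral_add_right _ measurable_const, setLIntegral_const,
          lintegral_const_mul _ (by fun_prop)]
        gcongr
        exact (setLIntegral_le_lintegral _ _).trans hm
    _ = ENNReal.ofReal ((C₂ + C₁) * (n : ℝ) ^ (-(p / 2)) * h ^ (p / 2)) := by
        rw [← ENNReal.ofReal_mul hε0.le, ← ENNReal.ofReal_mul (by positivity),
          ← ENNReal.ofReal_add (by positivity) (by positivity)]
        congr 1
        have e1 : ε * (C₂ * (n * h) ^ (-(2 * p / 2))) =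
            C₂ * (n : ℝ) ^ (-(p / 2)) * h ^ (p / 2) := by
          rw [hε, Real.mul_rpow hn'.le hh0.le, Real.mul_rpow hn'.le hh0.le]
          have h1 : (n : ℝ) ^ (-(p / 2)) = (n : ℝ) ^ (p / 2) * (n : ℝ) ^ (-(2 * p / 2)) := by
            rw [← Real.rpow_add hn']; congr 1; ring
          have h2 : h ^ (p / 2) = h ^ (p / 2) * h ^ p * h ^ (-(2 * p / 2)) := by
            rw [← Real.rpow_add hh0, ← Real.rpow_add hh0]; congr 1; ring
          rw [h1]; conv_rhs => rw [h2]
          ring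
        have e2 : 1 / ε * (C₁ * h ^ (2 * p)) = C₁ * (n : ℝ) ^ (-(p / 2)) * h ^ (p / 2) := by
          rw [hε, Real.mul_rpow hn'.le hh0.le, Real.rpow_neg hn'.le]
          have h2 : h ^ (2 * p) = h ^ (p / 2) * h ^ p * h ^ (p / 2) := by
            rw [← Real.rpow_add hh0, ← Real.rpow_add hh0]; congr 1; ring
          rw [h2]; field_simp
        rw [e1, e2]; ring

/-- The error of the adaptive estimator when every grid bandwidth up to `h` has a small bias. -/
theorem abs_adaptive_sub_le (hK : IsKernelOfOrder K r) (ha : 1 < a) (hD₁ : 1 ≤ D₁)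
    (hD₂ : 1 ≤ D₂) (hM : 0 < M) {n : ℕ} (hn : 3 ≤ n) {f : ℝ → ℝ} (hf : IsDensity f)
    {x h b : ℝ} (hh : h ∈ bandwidths a n) (hb : |kmean K f h x - f x| ≤ b)
    (hmean : ∀ h' ∈ bandwidths a n, h' ≤ h → ∀ η ∈ bandwidths a n, η < h' →
      |kmean K f h' x - kmean K f η x| ≤ 2 * D₁ * vOne K M n h' * lam D₂ h')
    (X : Fin n → ℝ) :
    (|adaptiveEstimator K a M D₁ D₂ X x - f x| ≤
      (b + (2 * D₁ + 2) * Real.sqrt (M * (∫ u, K u ^ 2) * D₂) * Real.sqrt (Real.log n / (n * h)))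
        + |kde K X h x - kmean K f h x|) ∨
    (∃ h' ∈ bandwidths a n, h' < h ∧ X ∈ badEvent K a M D₂ n f x h' ∧
      |adaptiveEstimator K a M D₁ D₂ X x - f x| ≤
      (b + (2 * D₁ + 2) * Real.sqrt (M * (∫ u, K u ^ 2) * D₂) * Real.sqrt (Real.log n / (n * h)))
        + |kde K X h' x - kmean K f h' x|) := by
  have hlog := one_lt_log_of_three_le hn
  have hh0 := bandwidths_pos ha hh
  have hκ := integral_kernel_sq_pos hK
  have hnh : 1 ≤ n * h :=
    (one_le_pow₀ hlog.le).trans (log_pow_le_of_mem_bandwidths ha hn hh)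
  set R := Real.sqrt (M * (∫ u, K u ^ 2) * D₂) * Real.sqrt (Real.log n / (n * h)) with hR
  have hR0 : 0 ≤ R := by positivity
  have hRe : (2 * D₁ + 2) * Real.sqrt (M * (∫ u, K u ^ 2) * D₂) *
    Real.sqrt (Real.log n / (n * h)) = (2 * D₁ + 2) * R := by rw [hR]; ring
  rw [hRe]
  obtain ⟨hmem, hadm⟩ := hHat_mem (K := K) (M := M) (D₁ := D₁) (D₂ := D₂) ⟨h, hh⟩ X x
  unfold adaptiveEstimator
  set h' := hHat K a M D₁ D₂ X x with hh'
  rcases lt_trichotomy h' h with hlt | heq | hgt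
  -- Selected bandwidth too small: its mean is compared with that at `h`, and only its own
  -- stochastic error remains, on the bad event.
  · right
    refine ⟨h', hmem, hlt, mem_badEvent hK ha hf hh hmean hlt, ?_⟩
    have h1 := hmean h hh le_rfl h' hmem hlt
    have h2 : vOne K M n h * lam D₂ h ≤ R := by
      have h3 : vOne K M n h * Real.sqrt (D₂ * Real.log n) = R := by
        rw [hR, vOne_eq, ← Real.sqrt_mul (by positivity), ← Real.sqrt_mul (by positivity)]
        congr 1; ring
      rw [← h3]
      exact mul_le_mul_of_nonneg_left (lam_le hD₂ hn hh0 hnh) (vOne_nonneg _ _ _ _)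
    have h4 : |kmean K f h x - kmean K f h' x| ≤ (2 * D₁ + 2) * R := by
      refine h1.trans ?_
      rw [mul_assoc]
      nlinarith
    have e : kde K X h' x - f x = (kmean K f h x - f x) +
      -(kmean K f h x - kmean K f h' x) + (kde K X h' x - kmean K f h' x) := by ring
    rw [e]
    refine (abs_add_three _ _ _).trans ?_
    rw [abs_neg]
    linarith
  · left
    rw [heq]
    have e : kde K X h x - f x = (kmean K f h x - f x) + (kde K X h x - kmean K f h x) := by ring
    rw [e]
    refine (abs_add_le _ _).trans ?_
    nlinarith
  -- Selected bandwidth too large: admissibility against `h` bounds the distance between the two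
  -- estimators by `psi`.
  · left
    have h1 := (hadm h hh hgt).trans (psi_le hK hM hD₁ hD₂ hn hh0 hgt hnh)
    rw [hRe] at h1
    have e : kde K X h' x - f x = (kmean K f h x - f x) +
      (kde K X h' x - kde K X h x) + (kde K X h x - kmean K f h x) := by ring
    rw [e]
    refine (abs_add_three _ _ _).trans ?_
    linarith

/-- The risk of the adaptive estimator at a point. -/
theorem exists_oracle_bound (hK : IsKernelOfOrder K r) (hp : 1 ≤ p) (ha : 1 < a)
    (hD₁ : 1 ≤ D₁) (hD₂ : 4 * p < D₂) (hM : 0 < M) :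
    ∃ C : ℝ, 0 < C ∧ ∃ n₀ : ℕ, 3 ≤ n₀ ∧ ∀ n : ℕ, n₀ ≤ n → ∀ f : ℝ → ℝ, IsDensity f →
      ∀ x h b : ℝ, h ∈ bandwidths a n → (∀ y, |y - x| ≤ h → f y ≤ M) →
      |kmean K f h x - f x| ≤ b →
      (∀ h' ∈ bandwidths a n, h' ≤ h → ∀ η ∈ bandwidths a n, η < h' →
        |kmean K f h' x - kmean K f η x| ≤ 2 * D₁ * vOne K M n h' * lam D₂ h') →
      ∫⁻ X, ENNReal.ofReal (|adaptiveEstimator K a M D₁ D₂ X x - f x| ^ p) ∂(sampleLaw f n) ≤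
        ENNReal.ofReal (C * (b ^ p + (Real.log n / (n * h)) ^ (p / 2))) := by
  obtain ⟨C₁, hC₁, n₁, hn₁, hbad⟩ := exists_lintegral_badEvent_bound hK hp ha hD₂ hM
  obtain ⟨C₂, hC₂, hmom⟩ := exists_moment_bound hK hM (q := p) (by linarith)
  have hκ := integral_kernel_sq_pos hK
  set S := (2 * D₁ + 2) * Real.sqrt (M * (∫ u, K u ^ 2) * D₂) with hS
  have hD0 : 0 < D₂ := by linarith
  have hS0 : 0 ≤ S := by positivity
  have hlt1 : a ^ (-(p / 2)) < 1 := Real.rpow_lt_one_of_one_lt_of_neg ha (by linarith)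
  set G := (1 - a ^ (-(p / 2)))⁻¹ with hG
  have hG0 : 0 < G := inv_pos.2 (by linarith)
  refine ⟨2 ^ p * (2 ^ p + 2 ^ p * S ^ p + C₂ + C₁ * G), by positivity, n₁, hn₁,
    fun n hn f hf x h b hh hfM hb hmean => ?_⟩
  have hn3 : 3 ≤ n := hn₁.trans hn
  have hn' : (0 : ℝ) < n := by positivity
  have hlog := one_lt_log_of_three_le hn3
  have hh0 := bandwidths_pos ha hh
  have hh1 := bandwidths_le_one ha hh
  have hnh : 1 ≤ n * h :=
    (one_le_pow₀ hlog.le).trans (log_pow_le_of_mem_bandwidths ha hn3 hh)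
  have hb0 : 0 ≤ b := (abs_nonneg _).trans hb
  have := isProbabilityMeasure_obsLaw hf
  have : IsProbabilityMeasure (sampleLaw f n) := by
    unfold sampleLaw; change IsProbabilityMeasure (Measure.pi fun _ : Fin n => obsLaw f)
    infer_instance
  set t := Real.log n / (n * h) with ht
  have ht0 : 0 < t := by positivity
  set w := b + S * Real.sqrt t with hw
  have hw0 : 0 ≤ w := by positivity
  have hfin : {h' | h' ∈ bandwidths a n ∧ h' < h}.Finite :=
    (bandwidths_finite a n).subset fun η hη => hη.1
  set F := hfin.toFinset with hF
  have hmemF : ∀ η ∈ F, η ∈ bandwidths a n ∧ η < h := fun η hη => by simpa [hF] using hη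
  have hmeas : ∀ h' : ℝ, Measurable fun X : Fin n → ℝ => kde K X h' x := fun h' =>
    (measurable_kde hK n).comp (measurable_id.prodMk (measurable_const (a := ((h', x) : ℝ × ℝ))))
  have hpt : ∀ X : Fin n → ℝ,
      ENNReal.ofReal (|adaptiveEstimator K a M D₁ D₂ X x - f x| ^ p) ≤
      ENNReal.ofReal (2 ^ p) * (ENNReal.ofReal (w ^ p) +
        (ENNReal.ofReal (|kde K X h x - kmean K f h x| ^ p) +
        ∑ h' ∈ F, (badEvent K a M D₂ n f x h').indicator
          (fun X => ENNReal.ofReal (|kde K X h' x - kmean K f h' x| ^ p)) X)) := by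
    intro X
    have hstep : ∀ z : ℝ, 0 ≤ z → |adaptiveEstimator K a M D₁ D₂ X x - f x| ≤ w + z →
        ENNReal.ofReal (|adaptiveEstimator K a M D₁ D₂ X x - f x| ^ p) ≤
        ENNReal.ofReal (2 ^ p) * (ENNReal.ofReal (w ^ p) + ENNReal.ofReal (z ^ p)) := by
      intro z hz hle
      rw [← ENNReal.ofReal_add (by positivity) (by positivity),
        ← ENNReal.ofReal_mul (by positivity)]
      apply ENNReal.ofReal_le_ofReal
      calc _ ≤ (w + z) ^ p := by gcongr
        _ ≤ _ := add_rpow_le_two_rpow_mul hw0 hz (by linarith)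
    rcases abs_adaptive_sub_le hK ha hD₁ (by linarith) hM hn3 hf hh hb hmean X with
      hcase | ⟨h', hh', hlt, hXbad, hcase⟩
    · refine (hstep _ (abs_nonneg _) hcase).trans ?_
      gcongr
      exact le_self_add
    · refine (hstep _ (abs_nonneg _) hcase).trans ?_
      gcongr
      refine le_trans ?_ le_add_self
      refine le_trans ?_ (Finset.single_le_sum (f := fun h' =>
        (badEvent K a M D₂ n f x h').indicator
          (fun X => ENNReal.ofReal (|kde K X h' x - kmean K f h' x| ^ p)) X)
        (fun _ _ => zero_le) (show h' ∈ F by simp [hF, hh', hlt]))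
      simp only [indicator_of_mem hXbad]
      exact le_rfl
  have hbads : ∑ h' ∈ F, ∫⁻ X, (badEvent K a M D₂ n f x h').indicator
      (fun X => ENNReal.ofReal (|kde K X h' x - kmean K f h' x| ^ p)) X ∂(sampleLaw f n) ≤
      ENNReal.ofReal (C₁ * G * (n : ℝ) ^ (-(p / 2))) := by
    calc _ ≤ ∑ h' ∈ F, ENNReal.ofReal (C₁ * (n : ℝ) ^ (-(p / 2)) * h' ^ (p / 2)) := by
          refine Finset.sum_le_sum fun h' hh' => ?_
          obtain ⟨h1, h2⟩ := hmemF h' hh'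
          rw [lintegral_indicator (measurableSet_badEvent hK a M D₂ n f x h')]
          -- The bad event at `h'` involves the kernel of bandwidth `a * h'`, which is still at most
          -- `h`.
          refine hbad n hn f hf x h' h1 fun y hy => hfM y (hy.trans ?_)
          exact (mul_mem_bandwidths ha hh h1 h2).2
      _ = ENNReal.ofReal (C₁ * (n : ℝ) ^ (-(p / 2)) * ∑ h' ∈ F, h' ^ (p / 2)) := by
          rw [Finset.mul_sum, ENNReal.ofReal_sum_of_nonneg]
          intro h' hh'
          have := bandwidths_pos ha (hmemF h' hh').1
          positivity
      _ ≤ _ := by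
          apply ENNReal.ofReal_le_ofReal
          have := sum_rpow_le_of_subset_bandwidths ha (q := p / 2) (by linarith) F
            fun η hη => (hmemF η hη).1
          calc _ ≤ C₁ * (n : ℝ) ^ (-(p / 2)) * G := by gcongr
            _ = _ := by ring
  have hnt : (n : ℝ) ^ (-(p / 2)) ≤ t ^ (p / 2) := by
    rw [Real.rpow_neg hn'.le, ← Real.inv_rpow hn'.le]
    gcongr
    rw [ht, inv_eq_one_div, div_le_div_iff₀ hn' (by positivity)]
    nlinarith
  have hnht : (n * h) ^ (-(p / 2)) ≤ t ^ (p / 2) := by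
    rw [Real.rpow_neg (by positivity), ← Real.inv_rpow (by positivity)]
    gcongr
    rw [ht, inv_eq_one_div]
    gcongr
  have hwp : w ^ p ≤ 2 ^ p * b ^ p + 2 ^ p * S ^ p * t ^ (p / 2) := by
    refine (add_rpow_le_two_rpow_mul hb0 (by positivity) (by linarith)).trans (le_of_eq ?_)
    rw [Real.mul_rpow hS0 (Real.sqrt_nonneg _), Real.sqrt_eq_rpow, ← Real.rpow_mul ht0.le,
      show 1 / 2 * p = p / 2 by ring]
    ring
  calc _ ≤ ∫⁻ X, ENNReal.ofReal (2 ^ p) * (ENNReal.ofReal (w ^ p) +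
        (ENNReal.ofReal (|kde K X h x - kmean K f h x| ^ p) +
        ∑ h' ∈ F, (badEvent K a M D₂ n f x h').indicator
          (fun X => ENNReal.ofReal (|kde K X h' x - kmean K f h' x| ^ p)) X)) ∂(sampleLaw f n) :=
        lintegral_mono hpt
    _ = ENNReal.ofReal (2 ^ p) * (ENNReal.ofReal (w ^ p) +
        (∫⁻ X, ENNReal.ofReal (|kde K X h x - kmean K f h x| ^ p) ∂(sampleLaw f n) +
        ∑ h' ∈ F, ∫⁻ X, (badEvent K a M D₂ n f x h').indicator
          (fun X => ENNReal.ofReal (|kde K X h' x - kmean K f h' x| ^ p)) X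
          ∂(sampleLaw f n))) := by
        have hmi : ∀ h' ∈ F, Measurable ((badEvent K a M D₂ n f x h').indicator
          (fun X => ENNReal.ofReal (|kde K X h' x - kmean K f h' x| ^ p))) := fun h' _ => by
          refine Measurable.indicator ?_ (measurableSet_badEvent hK a M D₂ n f x h')
          have := hmeas h'
          fun_prop
        have := hmeas h
        rw [lintegral_const_mul' _ _ ENNReal.ofReal_ne_top, lintegral_add_left measurable_const,
          lintegral_add_left (by fun_prop), lintegral_finsetSum _ hmi, lintegral_const]
        simp
    _ ≤ ENNReal.ofReal (2 ^ p) * (ENNReal.ofReal (w ^ p) +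
        (ENNReal.ofReal (C₂ * (n * h) ^ (-(p / 2))) +
          ENNReal.ofReal (C₁ * G * (n : ℝ) ^ (-(p / 2))))) := by
        gcongr
        exact hmom n f (by omega) hf x h hh0 hnh hfM
    _ ≤ _ := by
        rw [← ENNReal.ofReal_add (by positivity) (by positivity),
          ← ENNReal.ofReal_add (by positivity) (by positivity),
          ← ENNReal.ofReal_mul (by positivity)]
        apply ENNReal.ofReal_le_ofReal
        have h2p : (0 : ℝ) < 2 ^ p := by positivity
        have hbp : 0 ≤ b ^ p := by positivity
        have htp : 0 ≤ t ^ (p / 2) := by positivity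
        have hSp : 0 ≤ S ^ p := by positivity
        refine le_trans (mul_le_mul_of_nonneg_left ?_ h2p.le) (le_of_eq (mul_assoc _ _ _).symm)
        calc w ^ p + (C₂ * (n * h) ^ (-(p / 2)) + C₁ * G * (n : ℝ) ^ (-(p / 2)))
            ≤ (2 ^ p * b ^ p + 2 ^ p * S ^ p * t ^ (p / 2)) +
              (C₂ * t ^ (p / 2) + C₁ * G * t ^ (p / 2)) := by gcongr
          _ ≤ (2 ^ p * b ^ p + 2 ^ p * S ^ p * t ^ (p / 2)) +
              (C₂ * t ^ (p / 2) + C₁ * G * t ^ (p / 2)) +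
              (2 ^ p * t ^ (p / 2) + (2 ^ p * S ^ p + C₂ + C₁ * G) * b ^ p) :=
              le_add_of_nonneg_right (by positivity)
          _ = _ := by ring

/-- The selected bandwidth exceeds `c` exactly when some grid bandwidth above `c` is admissible, a
finite combination of measurable conditions. Joint measurability in sample and point is what
Tonelli's theorem needs. -/
theorem measurable_hHat (hK : IsKernelOfOrder K r) (a M D₁ D₂ : ℝ) (n : ℕ) :
    Measurable fun z : (Fin n → ℝ) × ℝ => hHat K a M D₁ D₂ z.1 z.2 := by
  rcases (bandwidths a n).eq_empty_or_nonempty with he | hne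
  · have : (fun z : (Fin n → ℝ) × ℝ => hHat K a M D₁ D₂ z.1 z.2) = fun _ => 0 := by
      ext z; simp [hHat, he]
    rw [this]; exact measurable_const
  · have hkm : ∀ h : ℝ, Measurable fun z : (Fin n → ℝ) × ℝ => kde K z.1 h z.2 := fun h =>
      (measurable_kde hK n).comp (measurable_fst.prodMk (measurable_const.prodMk measurable_snd))
    apply measurable_of_Ioi
    intro c
    have hset : (fun z : (Fin n → ℝ) × ℝ => hHat K a M D₁ D₂ z.1 z.2) ⁻¹' Ioi c =
        ⋃ h ∈ {h | h ∈ bandwidths a n ∧ c < h}, ⋂ η ∈ {η | η ∈ bandwidths a n ∧ η < h},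
          {z | |kde K z.1 h z.2 - kde K z.1 η z.2| ≤ psi K M D₁ D₂ n h η} := by
      ext z
      simp only [mem_preimage, mem_Ioi, mem_iUnion, mem_iInter, mem_ofPred_eq, exists_prop]
      constructor
      · intro hz
        obtain ⟨h1, h2⟩ := hHat_mem (K := K) (M := M) (D₁ := D₁) (D₂ := D₂) hne z.1 z.2
        exact ⟨_, ⟨h1, hz⟩, fun η hη => h2 η hη.1 hη.2⟩
      · rintro ⟨h, ⟨h1, hc⟩, h2⟩
        exact hc.trans_le (le_hHat h1 fun η hη hlt => h2 η ⟨hη, hlt⟩)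
    rw [hset]
    refine ((bandwidths_finite a n).subset fun η hη => hη.1).measurableSet_biUnion fun h _ => ?_
    refine ((bandwidths_finite a n).subset fun η hη => hη.1).measurableSet_biInter fun η _ => ?_
    exact measurableSet_le (measurable_norm.comp ((hkm h).sub (hkm η))) measurable_const

theorem measurable_adaptiveEstimator (hK : IsKernelOfOrder K r) (a M D₁ D₂ : ℝ)
    (n : ℕ) : Measurable fun z : (Fin n → ℝ) × ℝ => adaptiveEstimator K a M D₁ D₂ z.1 z.2 :=
  (measurable_kde hK n).comp
    (measurable_fst.prodMk ((measurable_hHat hK a M D₁ D₂ n).prodMk measurable_snd))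

theorem adaptiveRisk_eq (hK : IsKernelOfOrder K r) {f : ℝ → ℝ} (hf : IsDensity f)
    (n : ℕ) (c d : ℝ) :
    adaptiveRisk K a M D₁ D₂ p n f c d = ∫⁻ x in Icc c d, ∫⁻ X,
      ENNReal.ofReal (|adaptiveEstimator K a M D₁ D₂ X x - f x| ^ p) ∂(sampleLaw f n) := by
  have := isProbabilityMeasure_obsLaw hf
  have : IsProbabilityMeasure (sampleLaw f n) := by
    unfold sampleLaw; change IsProbabilityMeasure (Measure.pi fun _ : Fin n => obsLaw f)
    infer_instance
  unfold adaptiveRisk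
  apply lintegral_lintegral_swap
  have h1 := measurable_adaptiveEstimator hK a M D₁ D₂ n
  have h2 : Measurable fun z : (Fin n → ℝ) × ℝ => f z.2 := hf.measurable.comp measurable_snd
  exact (((measurable_norm.comp (h1.sub h2)).pow_const p).ennreal_ofReal).aemeasurable

end Oracle

/-! ### Integration of a bound depending on the distance to finitely many points -/

theorem lintegral_comp_abs_sub_le {Φ : ℝ → ℝ≥0∞} (hΦ : Measurable Φ) (t : ℝ) :
    ∫⁻ y, (Ioc (0 : ℝ) 1).indicator Φ |y - t| ≤ 2 * ∫⁻ ρ in Ioc (0 : ℝ) 1, Φ ρ := by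
  rw [lintegral_sub_right_eq_self (fun y => (Ioc (0 : ℝ) 1).indicator Φ |y|) t,
    ← lintegral_indicator measurableSet_Ioc]
  calc _ ≤ ∫⁻ y, ((Ioc (0 : ℝ) 1).indicator Φ y + (Ioc (0 : ℝ) 1).indicator Φ (-y)) := by
        apply lintegral_mono
        intro y
        rcases abs_cases y with h | h
        · simp only [h.1]; exact le_self_add
        · simp only [h.1]; exact le_add_self
    _ = _ := by
        rw [lintegral_add_left (hΦ.indicator measurableSet_Ioc), two_mul,
          lintegral_neg_eq_self (fun y => (Ioc (0 : ℝ) 1).indicator Φ y)]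

theorem exists_dist_to_points {m : ℕ} (x : Fin m → ℝ) {y : ℝ} (hy : y ∉ range x) :
    ∃ ρ : ℝ, 0 < ρ ∧ ρ ≤ 1 ∧ (∀ i, ρ ≤ |y - x i|) ∧ (ρ = 1 ∨ ∃ i, ρ = |y - x i|) := by
  -- The element `none` carries the value 1, which truncates the distance and covers the case `m =
  -- 0`.
  obtain ⟨o, -, ho⟩ := Finset.exists_min_image (Finset.univ : Finset (Option (Fin m)))
    (fun o => o.elim 1 fun i => |y - x i|) Finset.univ_nonempty
  have hpos : ∀ o : Option (Fin m), 0 < o.elim 1 fun i => |y - x i| := by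
    intro o
    cases o with
    | none => simp
    | some i => exact abs_pos.2 (sub_ne_zero.2 fun h => hy ⟨i, h.symm⟩)
  refine ⟨o.elim 1 fun i => |y - x i|, hpos o, ho none (Finset.mem_univ _),
    fun i => ho (some i) (Finset.mem_univ _), ?_⟩
  cases o with
  | none => left; rfl
  | some i => right; exact ⟨i, rfl⟩

/-- With `ρ` the truncated distance to the break points, `Φ ρ` is either `Φ 1` or the profile
centred at one of these points, so it is at most the sum of all of them; no monotonicity of `Φ` is
needed. The constant depends on the break points only through `m`. -/
theorem lintegral_le_of_profile {m : ℕ} (x : Fin m → ℝ) {R Φ : ℝ → ℝ≥0∞} (hΦ : Measurable Φ)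
    {c d T : ℝ} (hT : d - c ≤ T)
    (hR : ∀ y ∈ Icc c d, y ∉ range x → ∀ ρ, 0 < ρ → ρ ≤ 1 → (∀ i, ρ ≤ |y - x i|) → R y ≤ Φ ρ) :
    ∫⁻ y in Icc c d, R y ≤ ENNReal.ofReal T * Φ 1 + 2 * m * ∫⁻ ρ in Ioc (0 : ℝ) 1, Φ ρ := by
  have hnull : ∀ᵐ y ∂(volume.restrict (Icc c d)), y ∉ range x :=
    ae_restrict_of_ae ((finite_range x).measure_zero volume |> measure_eq_zero_iff_ae_notMem.1)
  calc ∫⁻ y in Icc c d, R y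
      ≤ ∫⁻ y in Icc c d, (Φ 1 + ∑ i, (Ioc (0 : ℝ) 1).indicator Φ |y - x i|) := by
        apply lintegral_mono_ae
        filter_upwards [hnull, ae_restrict_mem measurableSet_Icc] with y hy hmem
        obtain ⟨ρ, hρ0, hρ1, hρx, hρ⟩ := exists_dist_to_points x hy
        refine (hR y hmem hy ρ hρ0 hρ1 hρx).trans ?_
        rcases hρ with rfl | ⟨i, rfl⟩
        · exact le_self_add
        · refine le_trans ?_ le_add_self
          refine le_trans ?_ (Finset.single_le_sum
            (f := fun i => (Ioc (0 : ℝ) 1).indicator Φ |y - x i|)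
            (fun _ _ => zero_le) (Finset.mem_univ i))
          rw [indicator_of_mem (show |y - x i| ∈ Ioc (0 : ℝ) 1 from ⟨hρ0, hρ1⟩)]
    _ = Φ 1 * volume (Icc c d) +
          ∑ i, ∫⁻ y in Icc c d, (Ioc (0 : ℝ) 1).indicator Φ |y - x i| := by
        rw [lintegral_add_left measurable_const, setLIntegral_const, lintegral_finsetSum]
        intro i _
        exact (hΦ.indicator measurableSet_Ioc).comp (by fun_prop)
    _ ≤ Φ 1 * ENNReal.ofReal T + ∑ _i : Fin m, 2 * ∫⁻ ρ in Ioc (0 : ℝ) 1, Φ ρ := by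
        gcongr with i
        · rw [Real.volume_Icc]; exact ENNReal.ofReal_le_ofReal hT
        · exact (setLIntegral_le_lintegral _ _).trans (lintegral_comp_abs_sub_le hΦ _)
    _ = _ := by
        rw [Finset.sum_const, Finset.card_univ, Fintype.card_fin, nsmul_eq_mul, mul_comm (Φ 1)]
        ring

/-- A bound for the integral of `ρ ^ (-q)` over `]t, 1]`. -/
noncomputable def powInt (q t : ℝ) : ℝ :=
  if q = 1 then Real.log (1 / t) else |1 - q|⁻¹ * (1 + t ^ (1 - q))

theorem powInt_nonneg {q t : ℝ} (ht : 0 < t) (ht1 : t ≤ 1) : 0 ≤ powInt q t := by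
  unfold powInt
  split_ifs
  · exact Real.log_nonneg (one_le_one_div ht ht1)
  · positivity

theorem lintegral_rpow_neg_le {q t : ℝ} (ht : 0 < t) (ht1 : t ≤ 1) :
    ∫⁻ ρ in Ioc t 1, ENNReal.ofReal (ρ ^ (-q)) ≤ ENNReal.ofReal (powInt q t) := by
  have h0 : (0 : ℝ) ∉ uIcc t 1 := by
    rw [uIcc_of_le ht1]; exact fun h => absurd h.1 (not_le.2 ht)
  have hint : IntegrableOn (fun ρ : ℝ => ρ ^ (-q)) (Ioc t 1) :=
    (intervalIntegrable_iff_integrableOn_Ioc_of_le ht1).1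
      (intervalIntegral.intervalIntegrable_rpow (Or.inr h0))
  rw [← ofReal_integral_eq_lintegral_ofReal hint]
  · apply ENNReal.ofReal_le_ofReal
    rw [← intervalIntegral.integral_of_le ht1]
    unfold powInt
    split_ifs with hq
    · rw [hq]
      simp_rw [Real.rpow_neg_one]
      rw [integral_inv_of_pos ht one_pos]
    · rw [integral_rpow (Or.inr ⟨fun h => hq (by linarith), h0⟩), Real.one_rpow]
      refine (le_abs_self _).trans ?_
      rw [abs_div, div_eq_inv_mul, show -q + 1 = 1 - q by ring]
      gcongr
      refine (abs_sub _ _).trans (le_of_eq ?_)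
      rw [abs_one, abs_of_pos (by positivity)]
  · filter_upwards [ae_restrict_mem measurableSet_Ioc] with ρ hρ
    have : 0 < ρ := ht.trans hρ.1
    simp only [Pi.zero_apply]
    positivity

/-- Cuts the profile at `t`: the crude bound `N` within distance `t` of a break point, a sum of
powers of the distance beyond. -/
theorem lintegral_le_of_power_profile {m : ℕ} (x : Fin m → ℝ) {R : ℝ → ℝ≥0∞} {c d T N t : ℝ}
    (hT0 : 0 ≤ T) (hT : d - c ≤ T) (hN : 0 ≤ N) (ht : 0 < t) (ht1 : t < 1) {k : ℕ}
    {A q : Fin k → ℝ} (hA : ∀ j, 0 ≤ A j)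
    (hnear : ∀ y ∈ Icc c d, y ∉ range x → R y ≤ ENNReal.ofReal N)
    (hfar : ∀ y ∈ Icc c d, y ∉ range x → ∀ ρ, t < ρ → ρ ≤ 1 → (∀ i, ρ ≤ |y - x i|) →
      R y ≤ ENNReal.ofReal (∑ j, A j * ρ ^ (-q j))) :
    ∫⁻ y in Icc c d, R y ≤
      ENNReal.ofReal (T * ∑ j, A j + 2 * m * (t * N + ∑ j, A j * powInt (q j) t)) := by
  set Φ : ℝ → ℝ≥0∞ := fun ρ => if ρ ≤ t then ENNReal.ofReal N else
    ENNReal.ofReal (∑ j, A j * ρ ^ (-q j)) with hΦ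
  have hΦm : Measurable Φ := by
    refine Measurable.ite (measurableSet_le measurable_id measurable_const) measurable_const ?_
    apply Measurable.ennreal_ofReal
    refine Finset.measurable_sum _ fun j _ => ?_
    exact measurable_const.mul (measurable_id.pow_const _)
  refine (lintegral_le_of_profile x hΦm hT fun y hy hyx ρ hρ0 hρ1 hρ => ?_).trans ?_
  · simp only [hΦ]
    split_ifs with h
    · exact hnear y hy hyx
    · exact hfar y hy hyx ρ (not_le.1 h) hρ1 hρ
  · have hpow : ∀ j, 0 ≤ powInt (q j) t := fun j => powInt_nonneg ht ht1.le
    have hint : ∫⁻ ρ in Ioc (0 : ℝ) 1, Φ ρ ≤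
        ENNReal.ofReal (t * N + ∑ j, A j * powInt (q j) t) := by
      rw [← Ioc_union_Ioc_eq_Ioc ht.le ht1.le]
      refine (lintegral_union_le _ _ _).trans ?_
      rw [ENNReal.ofReal_add (by positivity)
        (Finset.sum_nonneg fun j _ => mul_nonneg (hA j) (hpow j))]
      gcongr
      · calc ∫⁻ ρ in Ioc 0 t, Φ ρ = ∫⁻ _ in Ioc 0 t, ENNReal.ofReal N := by
              refine setLIntegral_congr_fun measurableSet_Ioc fun ρ hρ => ?_
              simp only [hΦ]; rw [if_pos hρ.2]
          _ = ENNReal.ofReal (t * N) := by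
              rw [setLIntegral_const, Real.volume_Ioc, sub_zero, ← ENNReal.ofReal_mul hN, mul_comm]
          _ ≤ _ := le_rfl
      · calc ∫⁻ ρ in Ioc t 1, Φ ρ
            = ∫⁻ ρ in Ioc t 1, ∑ j, ENNReal.ofReal (A j) * ENNReal.ofReal (ρ ^ (-q j)) := by
              refine setLIntegral_congr_fun measurableSet_Ioc fun ρ hρ => ?_
              have hρ0 : 0 < ρ := ht.trans hρ.1
              simp only [hΦ]
              rw [if_neg (not_le.2 hρ.1), ENNReal.ofReal_sum_of_nonneg]
              · exact Finset.sum_congr rfl fun j _ => ENNReal.ofReal_mul (hA j)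
              · intro j _; have := hA j; positivity
          _ = ∑ j, ENNReal.ofReal (A j) * ∫⁻ ρ in Ioc t 1, ENNReal.ofReal (ρ ^ (-q j)) := by
              rw [lintegral_finsetSum _ fun j _ => ?_]
              · exact Finset.sum_congr rfl fun j _ =>
                  lintegral_const_mul' _ _ ENNReal.ofReal_ne_top
              · exact measurable_const.mul ((measurable_id.pow_const _).ennreal_ofReal)
          _ ≤ ∑ j, ENNReal.ofReal (A j) * ENNReal.ofReal (powInt (q j) t) := by
              gcongr with j
              exact lintegral_rpow_neg_le ht ht1.le
          _ = _ := by
              rw [ENNReal.ofReal_sum_of_nonneg fun j _ => mul_nonneg (hA j) (hpow j)]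
              exact Finset.sum_congr rfl fun j _ => (ENNReal.ofReal_mul (hA j)).symm
    have h1 : Φ 1 = ENNReal.ofReal (∑ j, A j) := by
      simp only [hΦ]; rw [if_neg (not_le.2 ht1)]; simp
    have hs0 : 0 ≤ ∑ j, A j := Finset.sum_nonneg fun j _ => hA j
    have hs1 : 0 ≤ t * N + ∑ j, A j * powInt (q j) t :=
      add_nonneg (by positivity) (Finset.sum_nonneg fun j _ => mul_nonneg (hA j) (hpow j))
    rw [h1, ENNReal.ofReal_add (by positivity) (by positivity), ENNReal.ofReal_mul hT0,
      ENNReal.ofReal_mul (by positivity), ENNReal.ofReal_mul zero_le_two, ENNReal.ofReal_natCast,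
      ENNReal.ofReal_ofNat]
    gcongr

/-! ### Oracle bounds in terms of the bias -/

theorem exists_nat_log_rpow_le (A : ℝ) {e R : ℝ} (he : 0 < e) (hR : 0 < R) :
    ∃ n₀ : ℕ, 3 ≤ n₀ ∧ ∀ n : ℕ, n₀ ≤ n → Real.log n ^ A ≤ R * (n : ℝ) ^ e := by
  have h1 := ((isLittleO_log_rpow_rpow_atTop A he).bound hR)
  have h2 := tendsto_natCast_atTop_atTop.eventually h1
  obtain ⟨N, hN⟩ := Filter.eventually_atTop.1 h2
  refine ⟨max N 3, le_max_right _ _, fun n hn => ?_⟩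
  have hn3 : 3 ≤ n := (le_max_right _ _).trans hn
  have := hN n ((le_max_left _ _).trans hn)
  rw [Real.norm_eq_abs, Real.norm_eq_abs, abs_of_nonneg, abs_of_nonneg] at this
  · exact this
  · positivity
  · have := one_lt_log_of_three_le hn3
    positivity

section OracleBias

variable {K : ℝ → ℝ} {r : ℕ} {p a M D₁ D₂ : ℝ}

/-- The risk at a point when the bias of bandwidth `h` is at most `C₁ h ^ s W` up to `t`. -/
theorem exists_oracle_of_bias (hK : IsKernelOfOrder K r) (hp : 1 ≤ p) (ha : 1 < a) (ha2 : a ≤ 2)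
    (hD₁ : 1 ≤ D₁) (hD₂ : 4 * p < D₂) (hM : 0 < M) {s C₁ : ℝ} (hs : 0 ≤ s) (hC₁ : 0 < C₁) :
    ∃ C : ℝ, 0 < C ∧ ∃ c₀ : ℝ, 0 < c₀ ∧ ∃ n₀ : ℕ, 3 ≤ n₀ ∧ ∀ n : ℕ, n₀ ≤ n →
      ∀ f : ℝ → ℝ, IsDensity f → ∀ x t W : ℝ, 1 ≤ W → 2 * (Real.log n ^ 3 / n) ≤ t → t ≤ 1 →
      t ^ (2 * s + 1) * W ^ 2 ≤ c₀ * (Real.log n / n) → (∀ y, |y - x| ≤ t → f y ≤ M) →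
      (∀ h, 0 < h → h ≤ t → |kmean K f h x - f x| ≤ C₁ * h ^ s * W) →
      ∫⁻ X, ENNReal.ofReal (|adaptiveEstimator K a M D₁ D₂ X x - f x| ^ p) ∂(sampleLaw f n) ≤
        ENNReal.ofReal (C * (Real.log n / (n * t)) ^ (p / 2)) := by
  obtain ⟨C, hC, n₀, hn₀, hor⟩ := exists_oracle_bound hK hp ha hD₁ hD₂ hM
  have hκ := integral_kernel_sq_pos hK
  set κ := M * ∫ u, K u ^ 2 with hκdef
  have hκ0 : 0 < κ := by positivity
  -- The first entry gives `h' ^ (2 * s + 1) ≤ n ^ (-1 / 2)`, hence a lower bound on `lam`; the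
  -- second lets `vOne * lam` absorb the bias constant.
  set c₀ := min (1 / 2) (2 * κ / ((2 * s + 1) * C₁ ^ 2)) with hc₀
  have hc₀0 : 0 < c₀ := by positivity
  refine ⟨C * ((2 * C₁ ^ 2 * c₀) ^ (p / 2) + 2 ^ (p / 2)), by positivity, c₀, hc₀0, n₀, hn₀,
    fun n hn f hf x t W hW htlow ht1 htW hfM hbias => ?_⟩
  have hn3 : 3 ≤ n := hn₀.trans hn
  have hlog := one_lt_log_of_three_le hn3
  have hn' : (0 : ℝ) < n := by positivity
  have hW0 : 0 < W := by linarith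
  obtain ⟨h, hh, hth, hht⟩ := exists_mem_bandwidths_between ha ha2 hn3 htlow ht1
  have hh0 := bandwidths_pos ha hh
  have ht0 : 0 < t := hh0.trans_le hht
  have hbv : ∀ h' ∈ bandwidths a n, h' ≤ h →
      C₁ * h' ^ s * W ≤ vOne K M n h' * lam D₂ h' := by
    intro h' hh' hle
    have hh'0 := bandwidths_pos ha hh'
    have hh'1 := bandwidths_le_one ha hh'
    have hl1 := one_le_lam D₂ h'
    refine abs_le_of_sq_le_sq' ?_ (mul_nonneg (vOne_nonneg _ _ _ _) (by linarith)) |>.2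
    have hpw : h' ^ (2 * s + 1) * W ^ 2 ≤ c₀ * (Real.log n / n) := by
      refine le_trans ?_ htW
      gcongr
      exact hle.trans hht
    have hc12 : c₀ ≤ 1 / 2 := min_le_left _ _
    have hc2 : c₀ * ((2 * s + 1) * C₁ ^ 2) ≤ 2 * κ := by
      rw [← le_div_iff₀ (by positivity)]; exact min_le_right _ _
    have hlogsq : Real.log n / n ≤ 2 * (n : ℝ) ^ (-(1 / 2) : ℝ) := by
      have h1 := Real.log_le_rpow_div hn'.le (show (0 : ℝ) < 1 / 2 by norm_num)
      rw [div_le_iff₀ hn', mul_assoc]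
      have h2 : (n : ℝ) ^ (-(1 / 2) : ℝ) * n = (n : ℝ) ^ (1 / 2 : ℝ) := by
        rw [← Real.rpow_add_one hn'.ne']; norm_num
      rw [h2]; linarith
    have hsmall : h' ^ (2 * s + 1) ≤ (n : ℝ) ^ (-(1 / 2) : ℝ) := by
      have h1 : h' ^ (2 * s + 1) * 1 ≤ h' ^ (2 * s + 1) * W ^ 2 := by
        gcongr; nlinarith
      have h2 : 0 ≤ Real.log n / n := by positivity
      nlinarith
    -- Since `h'` is below a negative power of `n`, `log (1 / h')` is comparable to `log n`; here
    -- `D₂ ≥ 4` is used.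
    have hlogs : 2 * Real.log n / (2 * s + 1) ≤ lam D₂ h' ^ 2 := by
      have h1 := Real.log_le_log (by positivity) hsmall
      rw [Real.log_rpow hh'0, Real.log_rpow hn'] at h1
      have h2 : D₂ * Real.log (1 / h') ≤ lam D₂ h' ^ 2 := le_lam_sq
      rw [one_div, Real.log_inv] at h2
      have h3 : Real.log h' ≤ 0 := Real.log_nonpos hh'0.le hh'1
      have h4 : 4 * -Real.log h' ≤ D₂ * -Real.log h' := by
        apply mul_le_mul_of_nonneg_right <;> linarith
      rw [div_le_iff₀ (by positivity)]
      nlinarith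
    have hsplit : h' ^ (2 * s + 1) = (h' ^ s) ^ 2 * h' := by
      rw [Real.rpow_add_one hh'0.ne', ← Real.rpow_natCast, ← Real.rpow_mul hh'0.le]
      congr 2; push_cast; ring
    rw [mul_pow, mul_pow, mul_pow, vOne_eq, Real.sq_sqrt (by positivity), ← hκdef]
    rw [div_mul_eq_mul_div, le_div_iff₀ (by positivity)]
    rw [hsplit] at hpw
    rw [← mul_div_assoc, le_div_iff₀ hn'] at hpw
    calc C₁ ^ 2 * (h' ^ s) ^ 2 * W ^ 2 * (n * h')
        = C₁ ^ 2 * ((h' ^ s) ^ 2 * h' * W ^ 2 * n) := by ring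
      _ ≤ C₁ ^ 2 * (c₀ * Real.log n) := by gcongr
      _ = (c₀ * ((2 * s + 1) * C₁ ^ 2)) * (Real.log n / (2 * s + 1)) := by field_simp
      _ ≤ 2 * κ * (Real.log n / (2 * s + 1)) := by gcongr
      _ = κ * (2 * Real.log n / (2 * s + 1)) := by ring
      _ ≤ _ := by gcongr
  refine (hor n hn f hf x h (C₁ * h ^ s * W) hh (fun y hy => hfM y (hy.trans hht))
    (hbias h hh0 hht) ?_).trans (ENNReal.ofReal_le_ofReal ?_)
  -- Each of the two biases is at most `vOne * lam` at `h'`, which accounts for the factor 2 in the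
  -- threshold.
  · intro h' hh' hle η hη hlt
    have h1 := hbias h' (bandwidths_pos ha hh') (hle.trans hht)
    have hη0 := bandwidths_pos ha hη
    have h2 := hbias η hη0 (hlt.le.trans (hle.trans hht))
    have h3 : C₁ * η ^ s * W ≤ C₁ * h' ^ s * W := by gcongr
    have h4 := hbv h' hh' hle
    have h5 : 0 ≤ vOne K M n h' * lam D₂ h' :=
      mul_nonneg (vOne_nonneg _ _ _ _) (zero_le_one.trans (one_le_lam _ _))
    have e : kmean K f h' x - kmean K f η x =
      (kmean K f h' x - f x) - (kmean K f η x - f x) := by ring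
    rw [e]
    refine (abs_sub _ _).trans ?_
    rw [mul_assoc]
    nlinarith
  · set u := Real.log n / (n * t) with hu
    have hu0 : 0 < u := by positivity
    have hle : Real.log n / (n * h) ≤ 2 * u := by
      rw [hu, ← mul_div_assoc, div_le_div_iff₀ (by positivity) (by positivity)]
      have : n * t ≤ n * (2 * h) := by gcongr; linarith
      nlinarith
    have hb2 : (C₁ * h ^ s * W) ^ p ≤ (2 * C₁ ^ 2 * c₀ * u) ^ (p / 2) := by
      have h1 : (C₁ * h ^ s * W) ^ p = ((C₁ * h ^ s * W) ^ 2) ^ (p / 2) := by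
        rw [← Real.rpow_natCast, ← Real.rpow_mul (by positivity)]; congr 1; push_cast; ring
      rw [h1]
      gcongr
      have hsplit : h ^ (2 * s + 1) = (h ^ s) ^ 2 * h := by
        rw [Real.rpow_add_one hh0.ne', ← Real.rpow_natCast, ← Real.rpow_mul hh0.le]
        congr 2; push_cast; ring
      have hpw : h ^ (2 * s + 1) * W ^ 2 ≤ c₀ * (Real.log n / n) := by
        refine le_trans ?_ htW
        gcongr
      rw [hsplit] at hpw
      calc (C₁ * h ^ s * W) ^ 2 = C₁ ^ 2 * ((h ^ s) ^ 2 * h * W ^ 2) / h := by field_simp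
        _ ≤ C₁ ^ 2 * (c₀ * (Real.log n / n)) / h := by gcongr
        _ = C₁ ^ 2 * c₀ * (Real.log n / (n * h)) := by field_simp
        _ ≤ C₁ ^ 2 * c₀ * (2 * u) := by gcongr
        _ = _ := by ring
    rw [mul_assoc C]
    refine mul_le_mul_of_nonneg_left ?_ hC.le
    calc (C₁ * h ^ s * W) ^ p + (Real.log n / (n * h)) ^ (p / 2)
        ≤ (2 * C₁ ^ 2 * c₀ * u) ^ (p / 2) + (2 * u) ^ (p / 2) := by gcongr
      _ = _ := by
          rw [Real.mul_rpow (by positivity) hu0.le, Real.mul_rpow (by norm_num) hu0.le]; ring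

/-- The risk at a point in terms of the bias at the smallest bandwidth. -/
theorem exists_oracle_of_min (hK : IsKernelOfOrder K r) (hp : 1 ≤ p) (ha : 1 < a) (ha2 : a ≤ 2)
    (hD₁ : 1 ≤ D₁) (hD₂ : 4 * p < D₂) (hM : 0 < M) :
    ∃ C : ℝ, 0 < C ∧ ∃ n₀ : ℕ, 3 ≤ n₀ ∧ ∀ n : ℕ, n₀ ≤ n →
      ∀ f : ℝ → ℝ, IsDensity f → ∀ x b : ℝ,
      (∀ y, |y - x| ≤ 2 * (Real.log n ^ 3 / n) → f y ≤ M) →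
      (∀ h, 0 < h → h ≤ 2 * (Real.log n ^ 3 / n) → |kmean K f h x - f x| ≤ b) →
      ∫⁻ X, ENNReal.ofReal (|adaptiveEstimator K a M D₁ D₂ X x - f x| ^ p) ∂(sampleLaw f n) ≤
        ENNReal.ofReal (C * (b ^ p + Real.log n ^ (-p))) := by
  obtain ⟨C, hC, n₁, hn₁, hor⟩ := exists_oracle_bound hK hp ha hD₁ hD₂ hM
  obtain ⟨n₂, -, hlogn⟩ := exists_nat_log_rpow_le 3 one_pos (show (0 : ℝ) < 1 / 2 by norm_num)
  refine ⟨C, hC, max n₁ n₂, hn₁.trans (le_max_left _ _), fun n hn f hf x b hfM hbias => ?_⟩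
  have hn1 : n₁ ≤ n := (le_max_left _ _).trans hn
  have hn3 : 3 ≤ n := hn₁.trans hn1
  have hlog := one_lt_log_of_three_le hn3
  have hn' : (0 : ℝ) < n := by positivity
  have h2 : 2 * (Real.log n ^ 3 / n) ≤ 1 := by
    have := hlogn n ((le_max_right _ _).trans hn)
    rw [Real.rpow_one, show (3 : ℝ) = ((3 : ℕ) : ℝ) by norm_num, Real.rpow_natCast] at this
    rw [← mul_div_assoc, div_le_one hn']; linarith
  obtain ⟨h₁, hh₁, -, hle₁⟩ := exists_mem_bandwidths_between ha ha2 hn3 le_rfl h2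
  obtain ⟨h, hh, hmin⟩ := (bandwidths a n).exists_min_image id (bandwidths_finite a n) ⟨h₁, hh₁⟩
  have hle : h ≤ 2 * (Real.log n ^ 3 / n) := (hmin h₁ hh₁).trans hle₁
  have hh0 := bandwidths_pos ha hh
  refine (hor n hn1 f hf x h b hh (fun y hy => hfM y (hy.trans hle)) (hbias h hh0 hle) ?_).trans
    (ENNReal.ofReal_le_ofReal ?_)
  -- At the smallest grid bandwidth the comparison of means is vacuous.
  · intro h' _ hle' η hη hlt
    exact absurd (hmin η hη) (not_le.2 (hlt.trans_le hle'))
  · have h3 : Real.log n / (n * h) ≤ Real.log n ^ (-2 : ℝ) := by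
      have h4 := log_pow_le_of_mem_bandwidths ha hn3 hh
      rw [div_le_iff₀ (by positivity), Real.rpow_neg (by linarith), Real.rpow_two,
        inv_mul_eq_div, le_div_iff₀ (by positivity)]
      linarith [pow_succ (Real.log n) 2]
    gcongr
    calc (Real.log n / (n * h)) ^ (p / 2) ≤ (Real.log n ^ (-2 : ℝ)) ^ (p / 2) := by gcongr
      _ = _ := by rw [← Real.rpow_mul (by linarith)]; congr 1; ring

end OracleBias

/-! ### Rates from bounds on the bias -/

/-- The bias of bandwidth `h` at a point of `[c, d]` is at most `C₁ h ^ β`, and at most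
`C₁ h ^ s ρ ^ (-γ)` if the distance to the points `x i` is at least `ρ`. -/
structure BiasBounds (K f : ℝ → ℝ) (M δ C₁ β s γ c d : ℝ) {m : ℕ} (x : Fin m → ℝ) : Prop where
  le_bound : ∀ y ∈ Icc c d, ∀ z, |z - y| ≤ δ → f z ≤ M
  bias_le : ∀ y ∈ Icc c d, ∀ h, 0 < h → h ≤ δ → |kmean K f h y - f y| ≤ C₁ * h ^ β
  bias_le_of_dist : ∀ y ∈ Icc c d, ∀ ρ, 0 < ρ → ρ ≤ 1 → (∀ i, ρ ≤ |y - x i|) →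
    ∀ h, 0 < h → h ≤ ρ / 2 → h ≤ δ → |kmean K f h y - f y| ≤ C₁ * h ^ s * ρ ^ (-γ)

theorem mul_powInt_le {A q t X : ℝ} (hX : 0 ≤ X)
    (h1 : q = 1 → A * Real.log (1 / t) ≤ X) (h2 : q ≠ 1 → A + A * t ^ (1 - q) ≤ X) :
    A * powInt q t ≤ (1 + |1 - q|⁻¹) * X := by
  unfold powInt
  split_ifs with hq
  · refine (h1 hq).trans (le_mul_of_one_le_left hX ?_)
    have : 0 ≤ |1 - q|⁻¹ := by positivity
    linarith
  · have : 0 ≤ |1 - q|⁻¹ := by positivity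
    calc A * (|1 - q|⁻¹ * (1 + t ^ (1 - q))) = |1 - q|⁻¹ * (A + A * t ^ (1 - q)) := by ring
      _ ≤ |1 - q|⁻¹ * X := by gcongr; exact h2 hq
      _ ≤ _ := by linarith

theorem mul_min_rpow_neg_le {κ A B q : ℝ} (hκ : 0 < κ) (hA : 0 < A) (hB : 0 < B) :
    (κ * min A B) ^ (-q) ≤ κ ^ (-q) * (A ^ (-q) + B ^ (-q)) := by
  rw [Real.mul_rpow hκ.le (le_min hA.le hB.le)]
  have h1 : 0 ≤ A ^ (-q) := by positivity
  have h2 : 0 ≤ B ^ (-q) := by positivity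
  gcongr
  rcases min_cases A B with h | h <;> rw [h.1] <;> linarith

theorem exists_nat_log_div_rpow_le {e R : ℝ} (he : 0 < e) (hR : 0 < R) (k : ℕ) :
    ∃ n₀ : ℕ, 3 ≤ n₀ ∧ ∀ n : ℕ, n₀ ≤ n → (Real.log n ^ k / n) ^ e ≤ R := by
  obtain ⟨n₀, hn₀, h⟩ := exists_nat_log_rpow_le k one_pos (show 0 < R ^ e⁻¹ by positivity)
  refine ⟨n₀, hn₀, fun n hn => ?_⟩
  have hn3 := hn₀.trans hn
  have hlog := one_lt_log_of_three_le hn3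
  have hn' : (0 : ℝ) < n := by positivity
  have h1 := h n hn
  rw [Real.rpow_natCast, Real.rpow_one, ← div_le_iff₀ hn'] at h1
  calc (Real.log n ^ k / n) ^ e ≤ (R ^ e⁻¹) ^ e := by gcongr
    _ = R := Real.rpow_inv_rpow hR.le he.ne'

section Rates

variable {K : ℝ → ℝ} {r : ℕ} {p a M D₁ D₂ : ℝ}

/-- The risk at a point of distance at least `ρ` from the points `x i`. -/
theorem exists_risk_far (hK : IsKernelOfOrder K r) (hp : 1 ≤ p) (ha : 1 < a) (ha2 : a ≤ 2)
    (hD₁ : 1 ≤ D₁) (hD₂ : 4 * p < D₂) (hM : 0 < M) {β s γ δ C₁ : ℝ} (hs : 0 ≤ s) (hγ : 0 ≤ γ)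
    (hδ : 0 < δ) (hδ1 : δ ≤ 1) (hC₁ : 0 < C₁) :
    ∃ C : ℝ, 0 < C ∧ ∃ κ : ℝ, 0 < κ ∧ κ ≤ 1 / 2 ∧ ∃ n₀ : ℕ, 3 ≤ n₀ ∧ ∀ n : ℕ, n₀ ≤ n →
      ∀ f : ℝ → ℝ, IsDensity f → ∀ (m : ℕ) (x : Fin m → ℝ) (c d : ℝ),
      BiasBounds K f M δ C₁ β s γ c d x →
      ∀ y ∈ Icc c d, ∀ ρ, 0 < ρ → ρ ≤ 1 → (∀ i, ρ ≤ |y - x i|) →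
      2 * (Real.log n ^ 3 / n) ≤
        κ * min ρ ((Real.log n / n) ^ (1 / (2 * s + 1)) * ρ ^ (2 * γ / (2 * s + 1))) →
      ∫⁻ X, ENNReal.ofReal (|adaptiveEstimator K a M D₁ D₂ X y - f y| ^ p) ∂(sampleLaw f n) ≤
        ENNReal.ofReal (C * (Real.log n / n) ^ (p / 2) * ρ ^ (-(p / 2)) +
          C * (Real.log n / n) ^ (p * s / (2 * s + 1)) * ρ ^ (-(p * γ / (2 * s + 1)))) := by
  obtain ⟨C, hC, c₀, hc₀, n₁, hn₁, hor⟩ :=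
    exists_oracle_of_bias hK hp ha ha2 hD₁ hD₂ hM hs hC₁
  have hs1 : 0 < 2 * s + 1 := by linarith
  obtain ⟨n₂, -, hsmall⟩ := exists_nat_log_div_rpow_le (e := 1 / (2 * s + 1)) (by positivity) hδ 1
  -- The entry `1 / 2` keeps the bandwidth below `ρ / 2`; the entry `c₀` gives `κ ^ (2 * s + 1) ≤ κ
  -- ≤ c₀`.
  set κ := min (1 / 2) c₀ with hκ
  have hκ0 : 0 < κ := by positivity
  have hκ2 : κ ≤ 1 / 2 := min_le_left _ _
  refine ⟨C * κ ^ (-(p / 2)), by positivity, κ, hκ0, hκ2, max n₁ n₂,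
    hn₁.trans (le_max_left _ _), fun n hn f hf m x c d hB y hy ρ hρ0 hρ1 hρ hlow => ?_⟩
  have hn1 : n₁ ≤ n := (le_max_left _ _).trans hn
  have hn3 : 3 ≤ n := hn₁.trans hn1
  have hlog := one_lt_log_of_three_le hn3
  have hn' : (0 : ℝ) < n := by positivity
  have hsm := hsmall n ((le_max_right _ _).trans hn)
  rw [pow_one] at hsm
  set g := Real.log n / n with hg
  have hg0 : 0 < g := by positivity
  -- The balancing bandwidth: `Q ^ (2 * s + 1) * ρ ^ (-2 * γ) = log n / n`.
  set Q := g ^ (1 / (2 * s + 1)) * ρ ^ (2 * γ / (2 * s + 1)) with hQ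
  have hQ0 : 0 < Q := by positivity
  set t := κ * min ρ Q with ht
  have ht0 : 0 < t := by positivity
  have hρpow : ρ ^ (2 * γ / (2 * s + 1)) ≤ 1 := Real.rpow_le_one hρ0.le hρ1 (by positivity)
  have htρ : t ≤ ρ / 2 := by
    calc t ≤ 1 / 2 * ρ := by rw [ht]; gcongr; exact min_le_left _ _
      _ = _ := by ring
  have htQ : t ≤ κ * Q := by rw [ht]; gcongr; exact min_le_right _ _
  have htδ : t ≤ δ := by
    have h1 : Q ≤ δ * 1 := by rw [hQ]; gcongr
    calc t ≤ κ * Q := htQ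
      _ ≤ 1 * (δ * 1) := by gcongr; linarith
      _ = δ := by ring
  have hW : 1 ≤ ρ ^ (-γ) := Real.one_le_rpow_of_pos_of_le_one_of_nonpos hρ0 hρ1 (by linarith)
  have hQpow : Q ^ (2 * s + 1) = g * ρ ^ (2 * γ) := by
    rw [hQ, Real.mul_rpow (by positivity) (by positivity), ← Real.rpow_mul hg0.le,
      ← Real.rpow_mul hρ0.le]
    rw [one_div_mul_cancel hs1.ne', div_mul_cancel₀ _ hs1.ne', Real.rpow_one]
  have htpow : t ^ (2 * s + 1) * (ρ ^ (-γ)) ^ 2 ≤ c₀ * g := by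
    have h1 : (ρ ^ (-γ)) ^ 2 = ρ ^ (-(2 * γ)) := by
      rw [← Real.rpow_natCast, ← Real.rpow_mul hρ0.le]; congr 1; push_cast; ring
    have h2 : κ ^ (2 * s + 1) ≤ c₀ := by
      calc κ ^ (2 * s + 1) ≤ κ ^ (1 : ℝ) :=
            Real.rpow_le_rpow_of_exponent_ge hκ0 (by linarith) (by linarith)
        _ ≤ c₀ := by rw [Real.rpow_one]; exact min_le_right _ _
    calc t ^ (2 * s + 1) * (ρ ^ (-γ)) ^ 2 ≤ (κ * Q) ^ (2 * s + 1) * (ρ ^ (-γ)) ^ 2 := by gcongr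
      _ = κ ^ (2 * s + 1) * g * (ρ ^ (2 * γ) * ρ ^ (-(2 * γ))) := by
          rw [Real.mul_rpow hκ0.le hQ0.le, hQpow, h1]; ring
      _ = κ ^ (2 * s + 1) * g := by
          rw [← Real.rpow_add hρ0, add_neg_cancel, Real.rpow_zero, mul_one]
      _ ≤ _ := by gcongr
  refine (hor n hn1 f hf y t (ρ ^ (-γ)) hW hlow (htδ.trans hδ1) htpow
    (fun z hz => hB.le_bound y hy z (hz.trans htδ))
    (fun h hh hht => hB.bias_le_of_dist y hy ρ hρ0 hρ1 hρ h hh (hht.trans htρ)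
      (hht.trans htδ))).trans (ENNReal.ofReal_le_ofReal ?_)
  have hmin := mul_min_rpow_neg_le hκ0 hρ0 hQ0 (q := p / 2)
  have e1 : (Real.log n / (n * t)) ^ (p / 2) = g ^ (p / 2) * t ^ (-(p / 2)) := by
    rw [Real.rpow_neg ht0.le, ← Real.inv_rpow ht0.le, ← Real.mul_rpow hg0.le (by positivity)]
    congr 1; rw [hg]; field_simp
  have e2 : g ^ (p / 2) * Q ^ (-(p / 2)) =
      g ^ (p * s / (2 * s + 1)) * ρ ^ (-(p * γ / (2 * s + 1))) := by
    rw [hQ, Real.mul_rpow (by positivity) (by positivity), ← Real.rpow_mul hg0.le,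
      ← Real.rpow_mul hρ0.le, ← mul_assoc, ← Real.rpow_add hg0]
    congr 2
    · field_simp; ring
    · field_simp
  rw [e1]
  calc C * (g ^ (p / 2) * t ^ (-(p / 2)))
      ≤ C * (g ^ (p / 2) * (κ ^ (-(p / 2)) * (ρ ^ (-(p / 2)) + Q ^ (-(p / 2))))) := by gcongr
    _ = C * κ ^ (-(p / 2)) * g ^ (p / 2) * ρ ^ (-(p / 2)) +
        C * κ ^ (-(p / 2)) * (g ^ (p / 2) * Q ^ (-(p / 2))) := by ring
    _ = _ := by rw [e2]; ring

/-- The logarithmic factor of the critical case. -/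
noncomputable def critLog (p s γ : ℝ) (n : ℕ) : ℝ :=
  if p * γ / (2 * s + 1) = 1 then Real.log n else 1

theorem one_le_critLog (p s γ : ℝ) {n : ℕ} (hn : 3 ≤ n) : 1 ≤ critLog p s γ n := by
  unfold critLog
  split_ifs
  · exact (one_lt_log_of_three_le hn).le
  · exact le_rfl

theorem mul_div_le_half {p s : ℝ} (hp : 0 ≤ p) (hs : 0 ≤ s) : p * s / (2 * s + 1) ≤ p / 2 := by
  rw [div_le_div_iff₀ (by positivity) (by norm_num)]; nlinarith

theorem log_div_rpow_le {n : ℕ} (hn : 3 ≤ n) {s : ℝ} (hp : 0 ≤ p) (hs : 0 ≤ s) :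
    (Real.log n / n) ^ (p * s / (2 * s + 1)) ≤
      Real.log n ^ (p / 2) * (n : ℝ) ^ (-(p * s / (2 * s + 1))) := by
  have hlog := one_lt_log_of_three_le hn
  have hn' : (0 : ℝ) < n := by positivity
  rw [Real.div_rpow (by linarith) hn'.le, Real.rpow_neg hn'.le, ← div_eq_mul_inv]
  have := Real.rpow_le_rpow_of_exponent_le hlog.le (mul_div_le_half hp hs)
  gcongr

theorem log_div_rpow_half_le {n : ℕ} (hn : 3 ≤ n) {s : ℝ} (hp : 0 ≤ p) (hs : 0 ≤ s) :
    (Real.log n / n) ^ (p / 2) ≤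
      Real.log n ^ (p / 2) * (n : ℝ) ^ (-(p * s / (2 * s + 1))) := by
  have hlog := one_lt_log_of_three_le hn
  have hn' : (0 : ℝ) < n := by positivity
  have hn1 : (1 : ℝ) ≤ n := by exact_mod_cast (by omega : 1 ≤ n)
  rw [Real.div_rpow (by linarith) hn'.le, Real.rpow_neg hn'.le, ← div_eq_mul_inv]
  have := Real.rpow_le_rpow_of_exponent_le hn1 (mul_div_le_half hp hs)
  gcongr

/-- The risk at an arbitrary point, in terms of the global smoothness `β`. -/
theorem exists_risk_near (hK : IsKernelOfOrder K r) (hp : 1 ≤ p) (ha : 1 < a) (ha2 : a ≤ 2)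
    (hD₁ : 1 ≤ D₁) (hD₂ : 4 * p < D₂) (hM : 0 < M) {β s γ δ C₁ : ℝ} (hβ : 0 < β)
    (hδ : 0 < δ) (hδ1 : δ ≤ 1) (hC₁ : 0 < C₁) :
    ∃ C : ℝ, 0 < C ∧ ∃ n₀ : ℕ, 3 ≤ n₀ ∧ ∀ n : ℕ, n₀ ≤ n →
      ∀ f : ℝ → ℝ, IsDensity f → ∀ (m : ℕ) (x : Fin m → ℝ) (c d : ℝ),
      BiasBounds K f M δ C₁ β s γ c d x → ∀ y ∈ Icc c d,
      ∫⁻ X, ENNReal.ofReal (|adaptiveEstimator K a M D₁ D₂ X y - f y| ^ p) ∂(sampleLaw f n) ≤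
        ENNReal.ofReal (C * (Real.log n ^ (p / 2) * (n : ℝ) ^ (-(p * β / (2 * β + 1))))) := by
  have hβ1 : 0 < 2 * β + 1 := by linarith
  obtain ⟨Ca, hCa, ca, hca, n₁, hn₁, hora⟩ :=
    exists_oracle_of_bias hK hp ha ha2 hD₁ hD₂ hM hβ.le hC₁
  set κ := min 1 ca with hκdef
  have hκ : 0 < κ := by positivity
  have hκ1 : κ ≤ 1 := min_le_left _ _
  obtain ⟨n₃, -, hn₃⟩ := exists_nat_log_rpow_le 3 (e := 1 - 1 / (2 * β + 1))
    (by rw [sub_pos, div_lt_one hβ1]; linarith) (show 0 < κ / 2 by positivity)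
  -- With exponent 0 on the logarithm this reads `n ^ (-1 / (2β + 1)) ≤ δ`.
  obtain ⟨n₄, -, hn₄⟩ := exists_nat_log_div_rpow_le (e := 1 / (2 * β + 1)) (by positivity) hδ 0
  refine ⟨Ca * κ ^ (-(p / 2)), by positivity, max n₁ (max n₃ n₄), hn₁.trans (le_max_left _ _),
    fun n hn f hf m x c d hB y hy => ?_⟩
  simp only [max_le_iff] at hn
  obtain ⟨h1n, h3n, h4n⟩ := hn
  have hn3 : 3 ≤ n := hn₁.trans h1n
  have hlog := one_lt_log_of_three_le hn3
  have hn' : (0 : ℝ) < n := by positivity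
  set h₀ := (n : ℝ) ^ (-(1 / (2 * β + 1))) with hh₀
  have hh₀0 : 0 < h₀ := by positivity
  have hlow : 2 * (Real.log n ^ 3 / n) ≤ κ * h₀ := by
    have h1 := hn₃ n h3n
    rw [show (3 : ℝ) = ((3 : ℕ) : ℝ) by norm_num, Real.rpow_natCast, Real.rpow_sub hn',
      Real.rpow_one] at h1
    rw [hh₀, Real.rpow_neg hn'.le, ← mul_div_assoc, div_le_iff₀ hn']
    calc 2 * Real.log n ^ 3 ≤ 2 * (κ / 2 * (n / (n : ℝ) ^ (1 / (2 * β + 1)))) := by gcongr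
      _ = _ := by field_simp
  have hh₀δ : h₀ ≤ δ := by
    have h1 := hn₄ n h4n
    rwa [pow_zero, one_div, Real.inv_rpow hn'.le, ← Real.rpow_neg hn'.le] at h1
  have ht0 : 0 < κ * h₀ := by positivity
  have htδ : κ * h₀ ≤ δ := by
    calc κ * h₀ ≤ 1 * δ := by gcongr
      _ = δ := one_mul _
  have hpow : (κ * h₀) ^ (2 * β + 1) * (1 : ℝ) ^ 2 ≤ ca * (Real.log n / n) := by
    rw [one_pow, mul_one, Real.mul_rpow hκ.le hh₀0.le]
    have h1 : κ ^ (2 * β + 1) ≤ ca := by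
      calc κ ^ (2 * β + 1) ≤ κ ^ (1 : ℝ) :=
            Real.rpow_le_rpow_of_exponent_ge hκ hκ1 (by linarith)
        _ ≤ ca := by rw [Real.rpow_one]; exact min_le_right _ _
    have h2 : h₀ ^ (2 * β + 1) = 1 / n := by
      rw [hh₀, ← Real.rpow_mul hn'.le, neg_mul, one_div_mul_cancel hβ1.ne', Real.rpow_neg_one,
        one_div]
    rw [h2]
    gcongr
  refine (hora n h1n f hf y (κ * h₀) 1 le_rfl hlow (htδ.trans hδ1) hpow
    (fun z hz => hB.le_bound y hy z (hz.trans htδ)) (fun h hh hht => ?_)).trans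
    (ENNReal.ofReal_le_ofReal (le_of_eq ?_))
  · rw [mul_one]; exact hB.bias_le y hy h hh (hht.trans htδ)
  · have e : Real.log n / (n * (κ * h₀)) =
        Real.log n * κ⁻¹ * (n : ℝ) ^ (-(2 * β / (2 * β + 1))) := by
      have : (n : ℝ) * h₀ = (n : ℝ) ^ (2 * β / (2 * β + 1)) := by
        rw [hh₀, mul_comm, ← Real.rpow_add_one hn'.ne']; congr 1; field_simp; ring
      rw [show (n : ℝ) * (κ * h₀) = κ * (n * h₀) by ring, this, Real.rpow_neg hn'.le]
      field_simp
    rw [e, Real.mul_rpow (by positivity) (by positivity),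
      Real.mul_rpow (by linarith) (by positivity), ← Real.rpow_mul hn'.le, Real.inv_rpow hκ.le,
      ← Real.rpow_neg hκ.le]
    rw [show -(2 * β / (2 * β + 1)) * (p / 2) = -(p * β / (2 * β + 1)) by field_simp]
    ring

/-- Outside the near zone both `ρ` and the balancing bandwidth are at least `n ^ (-1 / (2β + 1))`,
by `τ ≤ 1` and `γ * τ ≤ s - β` respectively. For `β > 0` this lies well above the bottom of the
grid. -/
theorem exists_far_bandwidth_low {β s γ τ κ : ℝ} (hβ : 0 < β) (hs : 0 < s) (hγ : 0 ≤ γ)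
    (hτ1 : τ ≤ 1) (hγτ : γ * τ ≤ s - β) (hκ : 0 < κ) :
    ∃ n₀ : ℕ, 3 ≤ n₀ ∧ ∀ n : ℕ, n₀ ≤ n → ∀ ρ : ℝ, (n : ℝ) ^ (-(τ / (2 * β + 1))) ≤ ρ →
      2 * (Real.log n ^ 3 / n) ≤
        κ * min ρ ((Real.log n / n) ^ (1 / (2 * s + 1)) * ρ ^ (2 * γ / (2 * s + 1))) := by
  have hβ1 : 0 < 2 * β + 1 := by linarith
  have hs1 : 0 < 2 * s + 1 := by linarith
  obtain ⟨n₃, hn₃3, hn₃⟩ := exists_nat_log_rpow_le 3 (e := 1 - 1 / (2 * β + 1))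
    (by rw [sub_pos, div_lt_one hβ1]; linarith) (show 0 < κ / 2 by positivity)
  refine ⟨n₃, hn₃3, fun n hn ρ hρ => ?_⟩
  have hn3 : 3 ≤ n := hn₃3.trans hn
  have hlog := one_lt_log_of_three_le hn3
  have hn' : (0 : ℝ) < n := by positivity
  have hn1 : (1 : ℝ) ≤ n := by exact_mod_cast (by omega : 1 ≤ n)
  set h₀ := (n : ℝ) ^ (-(1 / (2 * β + 1))) with hh₀
  set ρ₀ := (n : ℝ) ^ (-(τ / (2 * β + 1))) with hρ₀
  have hρ₀0 : 0 < ρ₀ := by positivity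
  have hlow : 2 * (Real.log n ^ 3 / n) ≤ κ * h₀ := by
    have h1 := hn₃ n hn
    rw [show (3 : ℝ) = ((3 : ℕ) : ℝ) by norm_num, Real.rpow_natCast, Real.rpow_sub hn',
      Real.rpow_one] at h1
    rw [hh₀, Real.rpow_neg hn'.le, ← mul_div_assoc, div_le_iff₀ hn']
    calc 2 * Real.log n ^ 3 ≤ 2 * (κ / 2 * (n / (n : ℝ) ^ (1 / (2 * β + 1)))) := by gcongr
      _ = _ := by field_simp
  refine hlow.trans ?_
  gcongr
  refine le_min ?_ ?_
  · refine le_trans ?_ hρ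
    apply Real.rpow_le_rpow_of_exponent_le hn1
    rw [neg_le_neg_iff]
    gcongr
  · have hexp : -(1 / (2 * β + 1)) ≤
        -(1 / (2 * s + 1)) + (-(τ / (2 * β + 1))) * (2 * γ / (2 * s + 1)) := by
      have e : -(1 / (2 * s + 1)) + (-(τ / (2 * β + 1))) * (2 * γ / (2 * s + 1)) =
          -(1 / (2 * β + 1)) + 2 * (s - β - γ * τ) / ((2 * s + 1) * (2 * β + 1)) := by
        field_simp; ring
      rw [e]
      have : 0 ≤ 2 * (s - β - γ * τ) / ((2 * s + 1) * (2 * β + 1)) :=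
        div_nonneg (by linarith) (by positivity)
      linarith
    calc h₀ ≤ (n : ℝ) ^ (-(1 / (2 * s + 1)) + (-(τ / (2 * β + 1))) * (2 * γ / (2 * s + 1))) :=
          Real.rpow_le_rpow_of_exponent_le hn1 hexp
      _ = (1 / n : ℝ) ^ (1 / (2 * s + 1)) * ρ₀ ^ (2 * γ / (2 * s + 1)) := by
          rw [Real.rpow_add hn', Real.rpow_mul hn'.le, Real.rpow_neg hn'.le,
            Real.div_rpow zero_le_one hn'.le, Real.one_rpow, one_div ((n : ℝ) ^ _)]
      _ ≤ _ := by gcongr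

theorem log_one_div_rpow_le {n : ℕ} (hn : 3 ≤ n) {e : ℝ} (he1 : e ≤ 1) :
    Real.log (1 / (n : ℝ) ^ (-e)) ≤ Real.log n := by
  have hlog := one_lt_log_of_three_le hn
  have hn' : (0 : ℝ) < n := by positivity
  rw [one_div, Real.log_inv, Real.log_rpow hn', neg_mul, neg_neg]
  nlinarith

/-- Integral of the term in which `ρ` limits the bandwidth. For `p = 2` it has a logarithm, but `n ^
(-1)` is smaller than the target rate by a power of `n` that absorbs it. Otherwise `τ ≤ 1` makes the
contribution of the lower endpoint no larger than that of the near zone. -/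
theorem variance_powInt_le {β s τ : ℝ} {n : ℕ} (hn : 3 ≤ n) (hp : 0 ≤ p) (hβ : 0 ≤ β)
    (hs : 0 ≤ s) (hτ1 : τ ≤ 1)
    (hlogn : Real.log n ≤ (n : ℝ) ^ (1 / (2 * s + 1))) :
    (Real.log n / n) ^ (p / 2) * powInt (p / 2) ((n : ℝ) ^ (-(τ / (2 * β + 1)))) ≤
      (1 + |1 - p / 2|⁻¹) * (Real.log n ^ (p / 2) * ((n : ℝ) ^ (-((p * β + τ) / (2 * β + 1))) +
        (n : ℝ) ^ (-(p * s / (2 * s + 1))))) := by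
  have hlog := one_lt_log_of_three_le hn
  have hn' : (0 : ℝ) < n := by positivity
  have hn1 : (1 : ℝ) ≤ n := by exact_mod_cast (by omega : 1 ≤ n)
  have hβ1 : 0 < 2 * β + 1 := by linarith
  have hs1 : 0 < 2 * s + 1 := by linarith
  have hA₀ := log_div_rpow_half_le hn hp hs
  have hA₀L : (Real.log n / n) ^ (p / 2) = Real.log n ^ (p / 2) * (n : ℝ) ^ (-(p / 2)) := by
    rw [Real.div_rpow (by linarith) hn'.le, Real.rpow_neg hn'.le, div_eq_mul_inv]
  refine mul_powInt_le (by positivity) (fun hp2 => ?_) (fun hp2 => ?_)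
  · have h1 := log_one_div_rpow_le hn (e := τ / (2 * β + 1))
      (by rw [div_le_one hβ1]; linarith)
    rw [hA₀L]
    calc _ ≤ Real.log n ^ (p / 2) * (n : ℝ) ^ (-(p / 2)) * (n : ℝ) ^ (1 / (2 * s + 1)) := by
          gcongr; exact h1.trans hlogn
      _ = Real.log n ^ (p / 2) * (n : ℝ) ^ (-(p * s / (2 * s + 1))) := by
          rw [mul_assoc, ← Real.rpow_add hn']
          congr 2
          have : p = 2 := by linarith
          rw [this]; field_simp; ring
      _ ≤ _ := by gcongr; exact le_add_of_nonneg_left (by positivity)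
  · have h1 : (Real.log n / n) ^ (p / 2) * ((n : ℝ) ^ (-(τ / (2 * β + 1)))) ^ (1 - p / 2) ≤
        Real.log n ^ (p / 2) * (n : ℝ) ^ (-((p * β + τ) / (2 * β + 1))) := by
      rw [hA₀L, ← Real.rpow_mul hn'.le, mul_assoc, ← Real.rpow_add hn']
      have hexp : -(p / 2) + -(τ / (2 * β + 1)) * (1 - p / 2) ≤
          -((p * β + τ) / (2 * β + 1)) := by
        have e : -(p / 2) + -(τ / (2 * β + 1)) * (1 - p / 2) =
            -((p * β + τ) / (2 * β + 1)) - p * (1 - τ) / (2 * (2 * β + 1)) := by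
          field_simp; ring
        rw [e]
        have : 0 ≤ p * (1 - τ) / (2 * (2 * β + 1)) :=
          div_nonneg (mul_nonneg hp (by linarith)) (by positivity)
        linarith
      have := Real.rpow_le_rpow_of_exponent_le hn1 hexp
      gcongr
    linarith

/-- Integral of the term in which the singular bias limits the bandwidth. If `p * γ = 2 * s + 1` the
logarithm cannot be absorbed and becomes `critLog`; otherwise `γ * τ ≤ s - β` compares the lower
endpoint with the near zone. -/
theorem bias_powInt_le {β s γ τ : ℝ} {n : ℕ} (hn : 3 ≤ n) (hp : 0 ≤ p) (hβ : 0 ≤ β)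
    (hs : 0 ≤ s) (hτ1 : τ ≤ 1) (hγτ : γ * τ ≤ s - β) :
    (Real.log n / n) ^ (p * s / (2 * s + 1)) *
        powInt (p * γ / (2 * s + 1)) ((n : ℝ) ^ (-(τ / (2 * β + 1)))) ≤
      (1 + |1 - p * γ / (2 * s + 1)|⁻¹) *
        (Real.log n ^ (p / 2) * ((n : ℝ) ^ (-((p * β + τ) / (2 * β + 1))) +
          critLog p s γ n * (n : ℝ) ^ (-(p * s / (2 * s + 1))))) := by
  have hlog := one_lt_log_of_three_le hn
  have hn' : (0 : ℝ) < n := by positivity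
  have hn1 : (1 : ℝ) ≤ n := by exact_mod_cast (by omega : 1 ≤ n)
  have hβ1 : 0 < 2 * β + 1 := by linarith
  have hs1 : 0 < 2 * s + 1 := by linarith
  have hA₁ := log_div_rpow_le hn hp hs
  have hcrit := one_le_critLog p s γ hn
  refine mul_powInt_le (by positivity) (fun hq => ?_) (fun hq => ?_)
  · have hΛl : critLog p s γ n = Real.log n := by rw [critLog, if_pos hq]
    have h1 := log_one_div_rpow_le hn (e := τ / (2 * β + 1))
      (by rw [div_le_one hβ1]; linarith)
    calc _ ≤ Real.log n ^ (p / 2) * (n : ℝ) ^ (-(p * s / (2 * s + 1))) * Real.log n :=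
          (mul_le_mul_of_nonneg_left h1 (by positivity)).trans
            (mul_le_mul_of_nonneg_right hA₁ (by linarith))
      _ = Real.log n ^ (p / 2) * (critLog p s γ n * (n : ℝ) ^ (-(p * s / (2 * s + 1)))) := by
          rw [hΛl]; ring
      _ ≤ _ := by gcongr; exact le_add_of_nonneg_left (by positivity)
  · have hΛl : critLog p s γ n = 1 := by rw [critLog, if_neg hq]
    have h1 : (n : ℝ) ^ (-(p * s / (2 * s + 1))) *
        ((n : ℝ) ^ (-(τ / (2 * β + 1)))) ^ (1 - p * γ / (2 * s + 1)) ≤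
        (n : ℝ) ^ (-((p * β + τ) / (2 * β + 1))) := by
      rw [← Real.rpow_mul hn'.le, ← Real.rpow_add hn']
      have hexp : -(p * s / (2 * s + 1)) + -(τ / (2 * β + 1)) * (1 - p * γ / (2 * s + 1)) ≤
          -((p * β + τ) / (2 * β + 1)) := by
        have e : -(p * s / (2 * s + 1)) + -(τ / (2 * β + 1)) * (1 - p * γ / (2 * s + 1)) =
            -((p * β + τ) / (2 * β + 1)) -
              p * (s - β - γ * τ) / ((2 * s + 1) * (2 * β + 1)) := by
          field_simp; ring
        rw [e]
        have : 0 ≤ p * (s - β - γ * τ) / ((2 * s + 1) * (2 * β + 1)) :=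
          div_nonneg (mul_nonneg hp (by linarith)) (by positivity)
        linarith
      exact Real.rpow_le_rpow_of_exponent_le hn1 hexp
    rw [hΛl, one_mul]
    set P := ((n : ℝ) ^ (-(τ / (2 * β + 1)))) ^ (1 - p * γ / (2 * s + 1)) with hP
    have hP0 : 0 ≤ P := by positivity
    calc _ ≤ Real.log n ^ (p / 2) * (n : ℝ) ^ (-(p * s / (2 * s + 1))) +
          Real.log n ^ (p / 2) * (n : ℝ) ^ (-(p * s / (2 * s + 1))) * P := by gcongr
      _ = Real.log n ^ (p / 2) * ((n : ℝ) ^ (-(p * s / (2 * s + 1))) * P +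
          (n : ℝ) ^ (-(p * s / (2 * s + 1)))) := by ring
      _ ≤ _ := by gcongr

theorem sum_le_const_mul {T A₀ A₁ P₀ P₁ B C N k c₂ c₃ Y : ℝ} (hT : 0 ≤ T) (hB : 0 ≤ B)
    (hk : 0 ≤ k) (hY : 0 ≤ Y) (h₀ : A₀ ≤ Y) (h₁ : A₁ ≤ Y) (hN : N ≤ C * Y)
    (h₂ : A₀ * P₀ ≤ c₂ * Y) (h₃ : A₁ * P₁ ≤ c₃ * Y) :
    T * (B * A₀ + B * A₁) + 2 * k * (N + (B * A₀ * P₀ + B * A₁ * P₁)) ≤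
      (max T 0 * (B + B) + 2 * k * (C + (B * c₂ + B * c₃)) + 1) * Y := by
  rw [max_eq_left hT]
  have e₁ : T * (B * A₀ + B * A₁) ≤ T * (B * Y + B * Y) := by gcongr
  have e₂ : B * A₀ * P₀ ≤ B * (c₂ * Y) := by rw [mul_assoc]; gcongr
  have e₃ : B * A₁ * P₁ ≤ B * (c₃ * Y) := by rw [mul_assoc]; gcongr
  have e₄ : 2 * k * (N + (B * A₀ * P₀ + B * A₁ * P₁)) ≤
    2 * k * (C * Y + (B * (c₂ * Y) + B * (c₃ * Y))) := by gcongr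
  calc _ ≤ T * (B * Y + B * Y) + 2 * k * (C * Y + (B * (c₂ * Y) + B * (c₃ * Y))) :=
        add_le_add e₁ e₄
    _ ≤ T * (B * Y + B * Y) + 2 * k * (C * Y + (B * (c₂ * Y) + B * (c₃ * Y))) + Y :=
        le_add_of_nonneg_right hY
    _ = _ := by ring

/-- The risk bound when the smoothness `β` at the break points is positive. -/
theorem exists_rate_of_pos (hK : IsKernelOfOrder K r) (hp : 1 ≤ p) (ha : 1 < a) (ha2 : a ≤ 2)
    (hD₁ : 1 ≤ D₁) (hD₂ : 4 * p < D₂) (hM : 0 < M) {β s γ τ δ C₁ : ℝ} (hβ : 0 < β) (hβs : β < s)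
    (hγ : 0 ≤ γ) (hτ : 0 < τ) (hτ1 : τ ≤ 1) (hγτ : γ * τ ≤ s - β)
    (hδ : 0 < δ) (hδ1 : δ ≤ 1) (hC₁ : 0 < C₁) (T : ℝ) (m : ℕ) :
    ∃ C : ℝ, 0 < C ∧ ∃ n₀ : ℕ, 3 ≤ n₀ ∧ ∀ n : ℕ, n₀ ≤ n → ∀ f : ℝ → ℝ, IsDensity f →
      ∀ (x : Fin m → ℝ) (c d : ℝ), c ≤ d → d - c ≤ T →
      BiasBounds K f M δ C₁ β s γ c d x →
      adaptiveRisk K a M D₁ D₂ p n f c d ≤ ENNReal.ofReal (C * (Real.log n ^ (p / 2) *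
        ((n : ℝ) ^ (-((p * β + τ) / (2 * β + 1))) +
          critLog p s γ n * (n : ℝ) ^ (-(p * s / (2 * s + 1)))))) := by
  have hs : 0 < s := hβ.trans hβs
  have hβ1 : 0 < 2 * β + 1 := by linarith
  have hs1 : 0 < 2 * s + 1 := by linarith
  obtain ⟨Ca, hCa, n₁, hn₁, hnear⟩ :=
    exists_risk_near (s := s) (γ := γ) hK hp ha ha2 hD₁ hD₂ hM hβ hδ hδ1 hC₁
  obtain ⟨Cb, hCb, κ, hκ, -, n₂, hn₂, hfar⟩ :=
    exists_risk_far (β := β) hK hp ha ha2 hD₁ hD₂ hM hs.le hγ hδ hδ1 hC₁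
  obtain ⟨n₃, -, hlow⟩ := exists_far_bandwidth_low hβ hs hγ hτ1 hγτ hκ
  obtain ⟨n₅, -, hn₅⟩ := exists_nat_log_rpow_le 1 (e := 1 / (2 * s + 1)) (by positivity) one_pos
  refine ⟨max T 0 * (Cb + Cb) + 2 * m * (Ca +
      (Cb * (1 + |1 - p / 2|⁻¹) + Cb * (1 + |1 - p * γ / (2 * s + 1)|⁻¹))) + 1,
    by positivity, max n₁ (max n₂ (max n₃ n₅)), hn₁.trans (le_max_left _ _),
    fun n hn f hf x c d hcd hT hB => ?_⟩
  simp only [max_le_iff] at hn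
  obtain ⟨h1n, h2n, h3n, h5n⟩ := hn
  have hn3 : 3 ≤ n := hn₁.trans h1n
  have hlog := one_lt_log_of_three_le hn3
  have hn' : (0 : ℝ) < n := by positivity
  have hn1 : (1 : ℝ) < n := by exact_mod_cast (by omega : 1 < n)
  have hT0 : 0 ≤ T := by linarith
  have hp0 : 0 ≤ p := by linarith
  have hρ₀1 : (n : ℝ) ^ (-(τ / (2 * β + 1))) < 1 := Real.rpow_lt_one_of_one_lt_of_neg hn1 (by
    rw [neg_lt_zero]; positivity)
  -- The near zone contributes its radius times the pointwise risk, which is the exponent `(p * β +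
  -- τ) / (2 * β + 1)`.
  have key := lintegral_le_of_power_profile (k := 2) (t := (n : ℝ) ^ (-(τ / (2 * β + 1))))
    (A := ![Cb * (Real.log n / n) ^ (p / 2), Cb * (Real.log n / n) ^ (p * s / (2 * s + 1))])
    (q := ![p / 2, p * γ / (2 * s + 1)])
    x hT0 hT (by positivity) (by positivity) hρ₀1
    (fun j => by fin_cases j <;> simp <;> positivity)
    (fun y hy _ => hnear n h1n f hf m x c d hB y hy)
    (fun y hy _ ρ hρ hρ1 hρx => by
      simpa [Fin.sum_univ_two] using hfar n h2n f hf m x c d hB y hy ρ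
        ((by positivity : (0 : ℝ) < (n : ℝ) ^ (-(τ / (2 * β + 1)))).trans hρ) hρ1 hρx
        (hlow n h3n ρ hρ.le))
  rw [adaptiveRisk_eq hK hf]
  refine key.trans (ENNReal.ofReal_le_ofReal ?_)
  simp only [Fin.sum_univ_two, Matrix.cons_val_zero, Matrix.cons_val_one]
  have hA₀ := log_div_rpow_half_le hn3 hp0 hs.le
  have hA₁ := log_div_rpow_le hn3 hp0 hs.le
  have b₂ := variance_powInt_le hn3 hp0 hβ.le hs.le hτ1
    (by have := hn₅ n h5n; rwa [Real.rpow_one, one_mul] at this)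
  have b₃ := bias_powInt_le hn3 hp0 hβ.le hs.le hτ1 hγτ
  have e : (n : ℝ) ^ (-(τ / (2 * β + 1))) * (n : ℝ) ^ (-(p * β / (2 * β + 1))) =
      (n : ℝ) ^ (-((p * β + τ) / (2 * β + 1))) := by
    rw [← Real.rpow_add hn']; congr 1; field_simp; ring
  have hcrit := one_le_critLog p s γ hn3
  set E₁ := (n : ℝ) ^ (-((p * β + τ) / (2 * β + 1))) with hE₁
  set E₂ := (n : ℝ) ^ (-(p * s / (2 * s + 1))) with hE₂
  have hE₁0 : 0 < E₁ := by positivity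
  have hE₂0 : 0 < E₂ := by positivity
  have hEΛ : E₂ ≤ critLog p s γ n * E₂ := le_mul_of_one_le_left hE₂0.le hcrit
  have hY : Real.log n ^ (p / 2) * E₂ ≤
      Real.log n ^ (p / 2) * (E₁ + critLog p s γ n * E₂) := by gcongr; linarith
  refine sum_le_const_mul hT0 hCb.le (by positivity) (by positivity) (hA₀.trans hY)
    (hA₁.trans hY) ?_ (b₂.trans ?_) b₃
  · calc _ = Ca * (Real.log n ^ (p / 2) *
          ((n : ℝ) ^ (-(τ / (2 * β + 1))) * (n : ℝ) ^ (-(p * β / (2 * β + 1))))) := by ring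
      _ ≤ _ := by
          rw [e]; gcongr; exact le_add_of_nonneg_right (by positivity)
  · gcongr

end Rates

/-! ### Rates without smoothness at the break points -/

/-- The condition `A ≤ t ^ q` means that the profile `A * ρ ^ (-q)` is at most 1 at the cut-off; its
integral beyond then costs no more than the near zone, up to the terms in `X`. -/
theorem mul_powInt_le_add {A q t X : ℝ} (ht : 0 < t) (hA : 0 ≤ A) (hAX : A ≤ X)
    (h1 : q = 1 → A * Real.log (1 / t) ≤ X) (h2 : A ≤ t ^ q) :
    A * powInt q t ≤ (1 + |1 - q|⁻¹) * (X + t) := by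
  refine mul_powInt_le (by linarith) (fun hq => (h1 hq).trans (by linarith)) fun _ => ?_
  have h3 : A * t ^ (1 - q) ≤ t ^ q * t ^ (1 - q) := by gcongr
  rw [← Real.rpow_add ht, add_sub_cancel, Real.rpow_one] at h3
  linarith

theorem sum_le_const_mul_three {T A₀ A₁ A₂ P₀ P₁ P₂ B B' N C k c₀ c₁ c₂ Y : ℝ} (hT : 0 ≤ T)
    (hB : 0 ≤ B) (hB' : 0 ≤ B') (hk : 0 ≤ k) (hY : 0 ≤ Y) (h₀ : A₀ ≤ Y) (h₁ : A₁ ≤ Y)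
    (h₂ : A₂ ≤ Y) (hN : N ≤ C * Y) (hP₀ : A₀ * P₀ ≤ c₀ * Y) (hP₁ : A₁ * P₁ ≤ c₁ * Y)
    (hP₂ : A₂ * P₂ ≤ c₂ * Y) :
    T * (B * A₀ + B * A₁ + B' * A₂) +
        2 * k * (N + (B * A₀ * P₀ + B * A₁ * P₁ + B' * A₂ * P₂)) ≤
      (max T 0 * (B + B + B') + 2 * k * (C + (B * c₀ + B * c₁ + B' * c₂)) + 1) * Y := by
  rw [max_eq_left hT]
  have e₁ : T * (B * A₀ + B * A₁ + B' * A₂) ≤ T * (B * Y + B * Y + B' * Y) := by gcongr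
  have e₂ : B * A₀ * P₀ ≤ B * (c₀ * Y) := by rw [mul_assoc]; gcongr
  have e₃ : B * A₁ * P₁ ≤ B * (c₁ * Y) := by rw [mul_assoc]; gcongr
  have e₅ : B' * A₂ * P₂ ≤ B' * (c₂ * Y) := by rw [mul_assoc]; gcongr
  have e₄ : 2 * k * (N + (B * A₀ * P₀ + B * A₁ * P₁ + B' * A₂ * P₂)) ≤
    2 * k * (C * Y + (B * (c₀ * Y) + B * (c₁ * Y) + B' * (c₂ * Y))) := by gcongr
  calc _ ≤ T * (B * Y + B * Y + B' * Y) +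
        2 * k * (C * Y + (B * (c₀ * Y) + B * (c₁ * Y) + B' * (c₂ * Y))) := add_le_add e₁ e₄
    _ ≤ T * (B * Y + B * Y + B' * Y) +
        2 * k * (C * Y + (B * (c₀ * Y) + B * (c₁ * Y) + B' * (c₂ * Y))) + Y :=
        le_add_of_nonneg_right hY
    _ = _ := by ring

section Rates

variable {K : ℝ → ℝ} {r : ℕ} {p a M D₁ D₂ : ℝ}

/-- Where the balancing bandwidth falls below the grid, the bias at the smallest bandwidth
dominates the stochastic error. -/
theorem inv_log_le_of_bandwidth_lt {n : ℕ} (hn : 3 ≤ n) {s γ κ ρ : ℝ} (hs : 0 ≤ s)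
    (hκ : 0 < κ) (hρ : 0 < ρ)
    (hlt : κ * ((Real.log n / n) ^ (1 / (2 * s + 1)) * ρ ^ (2 * γ / (2 * s + 1))) <
      2 * (Real.log n ^ 3 / n)) :
    (Real.log n)⁻¹ ≤ Real.sqrt (2 * (κ ^ (2 * s + 1))⁻¹) *
      ((2 * (Real.log n ^ 3 / n)) ^ s * ρ ^ (-γ)) := by
  have hlog := one_lt_log_of_three_le hn
  have hn' : (0 : ℝ) < n := by positivity
  have hs1 : 0 < 2 * s + 1 := by linarith
  set g := Real.log n / n with hg
  have hg0 : 0 < g := by positivity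
  set u := Real.log n ^ 3 / n with hu
  have hu0 : 0 < u := by positivity
  have hug : u = Real.log n ^ 2 * g := by rw [hu, hg]; field_simp
  have h1 : (κ * (g ^ (1 / (2 * s + 1)) * ρ ^ (2 * γ / (2 * s + 1)))) ^ (2 * s + 1) ≤
      (2 * u) ^ (2 * s + 1) := by gcongr
  rw [Real.mul_rpow hκ.le (by positivity), Real.mul_rpow (by positivity) (by positivity),
    ← Real.rpow_mul hg0.le, ← Real.rpow_mul hρ.le, one_div_mul_cancel hs1.ne',
    div_mul_cancel₀ _ hs1.ne', Real.rpow_one,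
    Real.rpow_add_one (show 2 * u ≠ 0 by positivity)] at h1
  have e1 : (2 * u) ^ (2 * s) = ((2 * u) ^ s) ^ 2 := by
    rw [← Real.rpow_natCast, ← Real.rpow_mul (by positivity)]; congr 1; push_cast; ring
  have e2 : ρ ^ (2 * γ) = (ρ ^ γ) ^ 2 := by
    rw [← Real.rpow_natCast, ← Real.rpow_mul hρ.le]; congr 1; push_cast; ring
  rw [e1, e2] at h1
  have h2 : κ ^ (2 * s + 1) * (ρ ^ γ) ^ 2 ≤ ((2 * u) ^ s) ^ 2 * 2 * Real.log n ^ 2 := by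
    refine le_of_mul_le_mul_right ?_ hg0
    calc _ = κ ^ (2 * s + 1) * (g * (ρ ^ γ) ^ 2) := by ring
      _ ≤ ((2 * u) ^ s) ^ 2 * (2 * u) := h1
      _ = _ := by nth_rewrite 2 [hug]; ring
  refine abs_le_of_sq_le_sq' ?_ (by positivity) |>.2
  have hκp : 0 < κ ^ (2 * s + 1) := by positivity
  have hρp : 0 < ρ ^ γ := by positivity
  rw [mul_pow, Real.sq_sqrt (by positivity), mul_pow, Real.rpow_neg hρ.le]
  rw [show 2 * (κ ^ (2 * s + 1))⁻¹ * (((2 * u) ^ s) ^ 2 * (ρ ^ γ)⁻¹ ^ 2) =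
    ((2 * u) ^ s) ^ 2 * 2 / (κ ^ (2 * s + 1) * (ρ ^ γ) ^ 2) by field_simp, inv_pow, inv_eq_one_div,
    div_le_div_iff₀ (by positivity) (by positivity)]
  linarith

/-- With `β = 0` the global bias bound is a constant, so near a break point the risk is merely
bounded. Farther out there are two regimes: either the bandwidth limited by `ρ` and by the balance
is in reach of the grid, or the smallest grid bandwidth is used and its bias `(log³ n / n) ^ s * ρ ^
(-γ)` governs. The third term is the price of the second regime. -/
theorem exists_risk_far_zero (hK : IsKernelOfOrder K r) (hp : 1 ≤ p) (ha : 1 < a) (ha2 : a ≤ 2)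
    (hD₁ : 1 ≤ D₁) (hD₂ : 4 * p < D₂) (hM : 0 < M) {s γ δ C₁ : ℝ} (hs : 0 ≤ s) (hγ : 0 ≤ γ)
    (hδ : 0 < δ) (hδ1 : δ ≤ 1) (hC₁ : 0 < C₁) :
    ∃ C : ℝ, 0 < C ∧ ∃ C' : ℝ, 0 < C' ∧ ∃ κ : ℝ, 0 < κ ∧ κ ≤ 1 / 2 ∧ ∃ n₀ : ℕ, 3 ≤ n₀ ∧
      ∀ n : ℕ, n₀ ≤ n →
      ∀ f : ℝ → ℝ, IsDensity f → ∀ (m : ℕ) (x : Fin m → ℝ) (c d : ℝ),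
      BiasBounds K f M δ C₁ 0 s γ c d x →
      (∀ y ∈ Icc c d, ∫⁻ X, ENNReal.ofReal (|adaptiveEstimator K a M D₁ D₂ X y - f y| ^ p)
        ∂(sampleLaw f n) ≤ ENNReal.ofReal C') ∧
      ∀ y ∈ Icc c d, ∀ ρ, 0 < ρ → ρ ≤ 1 → (∀ i, ρ ≤ |y - x i|) →
      2 * (Real.log n ^ 3 / n) ≤ κ * ρ →
      ∫⁻ X, ENNReal.ofReal (|adaptiveEstimator K a M D₁ D₂ X y - f y| ^ p) ∂(sampleLaw f n) ≤
        ENNReal.ofReal (C * (Real.log n / n) ^ (p / 2) * ρ ^ (-(p / 2)) +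
          C * (Real.log n / n) ^ (p * s / (2 * s + 1)) * ρ ^ (-(p * γ / (2 * s + 1))) +
          C' * (Real.log n ^ 3 / n) ^ (p * s) * ρ ^ (-(p * γ))) := by
  obtain ⟨C, hC, κ, hκ, hκ2, n₁, hn₁, hfar⟩ :=
    exists_risk_far (β := 0) hK hp ha ha2 hD₁ hD₂ hM hs hγ hδ hδ1 hC₁
  obtain ⟨Cm, hCm, n₂, hn₂, hmin⟩ := exists_oracle_of_min hK hp ha ha2 hD₁ hD₂ hM
  obtain ⟨n₃, -, hn₃⟩ := exists_nat_log_div_rpow_le one_pos (half_pos hδ) 3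
  set D := Real.sqrt (2 * (κ ^ (2 * s + 1))⁻¹) with hD
  have hD0 : 0 < D := by positivity
  refine ⟨C, hC, Cm * (C₁ ^ p + 1) + Cm * (C₁ ^ p + D ^ p) * 2 ^ (p * s), by positivity, κ, hκ, hκ2,
    max n₁ (max n₂ n₃), hn₁.trans (le_max_left _ _), fun n hn f hf m x c d hB => ?_⟩
  simp only [max_le_iff] at hn
  obtain ⟨h1n, h2n, h3n⟩ := hn
  have hn3 : 3 ≤ n := hn₁.trans h1n
  have hlog := one_lt_log_of_three_le hn3
  have hn' : (0 : ℝ) < n := by positivity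
  have hp0 : 0 < p := by linarith
  have hsm := hn₃ n h3n
  rw [Real.rpow_one] at hsm
  have hlogp : Real.log n ^ (-p) ≤ 1 := Real.rpow_le_one_of_one_le_of_nonpos hlog.le (by linarith)
  constructor
  · intro y hy
    refine (hmin n h2n f hf y C₁ (fun z hz => hB.le_bound y hy z (by linarith))
      (fun h hh hhu => by simpa using hB.bias_le y hy h hh (by linarith))).trans
      (ENNReal.ofReal_le_ofReal ?_)
    calc Cm * (C₁ ^ p + Real.log n ^ (-p)) ≤ Cm * (C₁ ^ p + 1) := by gcongr
      _ ≤ _ := le_add_of_nonneg_right (by positivity)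
  · intro y hy ρ hρ0 hρ1 hρ hκρ
    rcases le_or_gt (2 * (Real.log n ^ 3 / n))
      (κ * min ρ ((Real.log n / n) ^ (1 / (2 * s + 1)) * ρ ^ (2 * γ / (2 * s + 1)))) with hle | hlt
    · refine (hfar n h1n f hf m x c d hB y hy ρ hρ0 hρ1 hρ hle).trans
        (ENNReal.ofReal_le_ofReal ?_)
      exact le_add_of_nonneg_right (by positivity)
    · have hlt' : κ * ((Real.log n / n) ^ (1 / (2 * s + 1)) * ρ ^ (2 * γ / (2 * s + 1))) <
          2 * (Real.log n ^ 3 / n) := by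
        rcases min_cases ρ ((Real.log n / n) ^ (1 / (2 * s + 1)) * ρ ^ (2 * γ / (2 * s + 1)))
          with h | h
        · rw [h.1] at hlt; linarith
        · rwa [h.1] at hlt
      have hV := inv_log_le_of_bandwidth_lt hn3 hs hκ hρ0 hlt'
      set u := Real.log n ^ 3 / n with hu
      have hu0 : 0 < u := by positivity
      set V := (2 * u) ^ s * ρ ^ (-γ) with hVdef
      have hV0 : 0 < V := by positivity
      refine (hmin n h2n f hf y (C₁ * V) (fun z hz => hB.le_bound y hy z (by linarith))
        (fun h hh hhu => ?_)).trans (ENNReal.ofReal_le_ofReal ?_)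
      · refine (hB.bias_le_of_dist y hy ρ hρ0 hρ1 hρ h hh ?_ (by linarith)).trans ?_
        · nlinarith
        · rw [hVdef, ← mul_assoc]; gcongr
      · have hlp : Real.log n ^ (-p) ≤ D ^ p * V ^ p := by
          rw [Real.rpow_neg (by linarith), ← Real.inv_rpow (by linarith),
            ← Real.mul_rpow hD0.le hV0.le]
          gcongr
        have hVp : V ^ p = 2 ^ (p * s) * u ^ (p * s) * ρ ^ (-(p * γ)) := by
          rw [hVdef, Real.mul_rpow (by positivity) (by positivity), ← Real.rpow_mul (by positivity),
            ← Real.rpow_mul hρ0.le, Real.mul_rpow zero_le_two hu0.le,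
            mul_comm s p, neg_mul, mul_comm γ p]
        calc Cm * ((C₁ * V) ^ p + Real.log n ^ (-p))
            ≤ Cm * (C₁ ^ p * V ^ p + D ^ p * V ^ p) := by
              rw [Real.mul_rpow hC₁.le hV0.le]; gcongr
          _ = (Cm * (C₁ ^ p + D ^ p) * 2 ^ (p * s)) * u ^ (p * s) * ρ ^ (-(p * γ)) := by
              rw [hVp]; ring
          _ ≤ _ := by
              refine le_trans ?_ (le_add_of_nonneg_left (by positivity))
              gcongr
              exact le_add_of_nonneg_left (by positivity)

/-- The risk bound when no smoothness is assumed at the break points. -/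
theorem exists_rate_of_zero (hK : IsKernelOfOrder K r) (hp : 1 ≤ p) (ha : 1 < a) (ha2 : a ≤ 2)
    (hD₁ : 1 ≤ D₁) (hD₂ : 4 * p < D₂) (hM : 0 < M) {s γ τ δ C₁ : ℝ} (hs : 0 < s)
    (hγ : 0 ≤ γ) (hτ : 0 < τ) (hτ1 : τ ≤ 1) (hγτ : γ * τ ≤ s)
    (hδ : 0 < δ) (hδ1 : δ ≤ 1) (hC₁ : 0 < C₁) (T : ℝ) (m : ℕ) :
    ∃ C : ℝ, 0 < C ∧ ∃ n₀ : ℕ, 3 ≤ n₀ ∧ ∀ n : ℕ, n₀ ≤ n → ∀ f : ℝ → ℝ, IsDensity f →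
      ∀ (x : Fin m → ℝ) (c d : ℝ), c ≤ d → d - c ≤ T →
      BiasBounds K f M δ C₁ 0 s γ c d x →
      adaptiveRisk K a M D₁ D₂ p n f c d ≤ ENNReal.ofReal (C * (Real.log n ^ (p / 2) *
          (critLog p s γ n * (n : ℝ) ^ (-(p * s / (2 * s + 1)))) + (Real.log n ^ 3 / n) ^ τ)) := by
  have hs1 : 0 < 2 * s + 1 := by linarith
  have hp0 : 0 < p := by linarith
  obtain ⟨Cb, hCb, Cc, hCc, κ, hκ, hκ2, n₁, hn₁, hrisk⟩ :=
    exists_risk_far_zero hK hp ha ha2 hD₁ hD₂ hM hs.le hγ hδ hδ1 hC₁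
  obtain ⟨n₂, -, hn₂⟩ := exists_nat_log_div_rpow_le hτ (show 0 < κ / 4 by positivity) 3
  obtain ⟨n₃, -, hn₃⟩ := exists_nat_log_rpow_le 1 (e := 1 / (2 * s + 1)) (by positivity) one_pos
  obtain ⟨n₄, -, hn₄⟩ := exists_nat_log_rpow_le (3 * (p * s) + 1)
    -- The bias at the bottom of the grid beats the target rate by a positive power of `n`, even
    -- after multiplication by `log n`, so its integral never needs a critical logarithm.
    (e := p * s - p * s / (2 * s + 1))
    (by rw [sub_pos, div_lt_iff₀ hs1]; nlinarith [mul_pos hp0 hs]) one_pos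
  obtain ⟨n₅, -, hn₅⟩ := exists_nat_log_div_rpow_le one_pos one_pos 3
  -- Makes `2 * u ≤ κ * ρ` for all `ρ > R * u ^ τ`, because `u ≤ u ^ τ`.
  set R := 2 / κ with hR
  have hR1 : 1 ≤ R := by rw [hR, le_div_iff₀ hκ]; linarith
  have hR0 : 0 < R := by linarith
  refine ⟨(max T 0 * (Cb + Cb + Cc) + 2 * m * (Cc + (Cb * (1 + |1 - p / 2|⁻¹) +
      Cb * (1 + |1 - p * γ / (2 * s + 1)|⁻¹) + Cc * (1 + |1 - p * γ|⁻¹))) + 1) * R,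
    by positivity, max n₁ (max n₂ (max n₃ (max n₄ n₅))), hn₁.trans (le_max_left _ _),
    fun n hn f hf x c d hcd hT hB => ?_⟩
  simp only [max_le_iff] at hn
  obtain ⟨h1n, h2n, h3n, h4n, h5n⟩ := hn
  have hn3 : 3 ≤ n := hn₁.trans h1n
  have hlog := one_lt_log_of_three_le hn3
  have hn' : (0 : ℝ) < n := by positivity
  have hn1 : (1 : ℝ) < n := by exact_mod_cast (by omega : 1 < n)
  have hT0 : 0 ≤ T := by linarith
  obtain ⟨hnear, hfar⟩ := hrisk n h1n f hf m x c d hB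
  have hucτ := hn₂ n h2n
  have hlogn := hn₃ n h3n
  have hupow := hn₄ n h4n
  have hu1 := hn₅ n h5n
  rw [Real.rpow_one] at hu1
  rw [Real.rpow_one, one_mul] at hlogn
  have hug : Real.log n / n ≤ Real.log n ^ 3 / n := by
    gcongr; exact le_self_pow₀ hlog.le (by norm_num)
  have hinv : 1 / (n : ℝ) ≤ Real.log n ^ 3 / n := by
    gcongr; exact one_le_pow₀ hlog.le
  have hu0 : 0 < Real.log n ^ 3 / n := by positivity
  have hupw : (Real.log n ^ 3 / n) ^ (p * s) * Real.log n ≤ (n : ℝ) ^ (-(p * s / (2 * s + 1))) := by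
    rw [Real.div_rpow (by positivity) hn'.le, ← Real.rpow_natCast, ← Real.rpow_mul (by linarith),
      div_mul_eq_mul_div, ← Real.rpow_add_one (by linarith), div_le_iff₀ (by positivity),
      ← Real.rpow_add hn']
    rw [one_mul] at hupow
    refine (le_of_eq ?_).trans (hupow.trans (le_of_eq ?_))
    · push_cast; rfl
    · congr 1; ring
  have hupw1 : (Real.log n ^ 3 / n) ^ (p * s) ≤ (n : ℝ) ^ (-(p * s / (2 * s + 1))) :=
    (le_mul_of_one_le_right (by positivity) hlog.le).trans hupw
  have hA₀ := log_div_rpow_half_le hn3 hp0.le hs.le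
  have hA₁ := log_div_rpow_le hn3 hp0.le hs.le
  have hcrit := one_le_critLog p s γ hn3
  have hL1 : 1 ≤ Real.log n ^ (p / 2) := Real.one_le_rpow hlog.le (by positivity)
  set u := Real.log n ^ 3 / n with hu
  have huτ : u ≤ u ^ τ := by
    conv_lhs => rw [← Real.rpow_one u]
    exact Real.rpow_le_rpow_of_exponent_ge hu0 hu1 hτ1
  set t := R * u ^ τ with ht
  have ht0 : 0 < t := by positivity
  have hut : u ^ τ ≤ t := le_mul_of_one_le_left (by positivity) hR1
  have ht1 : t < 1 := by
    calc t ≤ R * (κ / 4) := by rw [ht]; gcongr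
      _ = 1 / 2 := by rw [hR]; field_simp; norm_num
      _ < 1 := by norm_num
  have hlogt : Real.log (1 / t) ≤ Real.log n := by
    apply Real.log_le_log (by positivity)
    rw [one_div_le ht0 hn']
    exact hinv.trans (huτ.trans hut)
  have key := lintegral_le_of_power_profile (k := 3) (t := t)
    (A := ![Cb * (Real.log n / n) ^ (p / 2), Cb * (Real.log n / n) ^ (p * s / (2 * s + 1)),
      Cc * u ^ (p * s)])
    (q := ![p / 2, p * γ / (2 * s + 1), p * γ])
    x hT0 hT hCc.le ht0 ht1
    (fun j => by fin_cases j <;> simp <;> positivity)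
    (fun y hy _ => hnear y hy)
    (fun y hy _ ρ hρ hρ1 hρx => by
      have hκρ : 2 * u ≤ κ * ρ := by
        have : 2 * u ^ τ = κ * t := by rw [ht, hR]; field_simp
        nlinarith
      simpa [Fin.sum_univ_three] using hfar y hy ρ (ht0.trans hρ) hρ1 hρx hκρ)
  rw [adaptiveRisk_eq hK hf]
  refine key.trans (ENNReal.ofReal_le_ofReal ?_)
  simp only [Fin.sum_univ_three, Matrix.cons_val_zero, Matrix.cons_val_one, Matrix.cons_val]
  set L := Real.log n ^ (p / 2) with hL
  set E₂ := (n : ℝ) ^ (-(p * s / (2 * s + 1))) with hE₂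
  have hE₂0 : 0 < E₂ := by positivity
  set Λ := critLog p s γ n with hΛ
  have hE₂L : E₂ ≤ L * E₂ := le_mul_of_one_le_left hE₂0.le hL1
  have hEΛ : L * E₂ ≤ L * (Λ * E₂) := by gcongr; exact le_mul_of_one_le_left hE₂0.le hcrit
  -- From `γ * τ ≤ s` and `u ≤ 1`: at the cut-off, the bias terms of the profile are at most 1.
  have hγτ' : u ^ s ≤ t ^ γ := by
    calc u ^ s ≤ u ^ (τ * γ) := Real.rpow_le_rpow_of_exponent_ge hu0 hu1 (by linarith)
      _ = (u ^ τ) ^ γ := Real.rpow_mul hu0.le _ _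
      _ ≤ t ^ γ := by gcongr
  have hgu : Real.log n / n ≤ u := hug
  have b₀ : (Real.log n / n) ^ (p / 2) * powInt (p / 2) t ≤
      (1 + |1 - p / 2|⁻¹) * (L * (Λ * E₂) + t) := by
    refine mul_powInt_le_add ht0 (by positivity) (hA₀.trans hEΛ) (fun hp2 => ?_) ?_
    · have hA₀L : (Real.log n / n) ^ (p / 2) = L * (n : ℝ) ^ (-(p / 2)) := by
        rw [Real.div_rpow (by linarith) hn'.le, Real.rpow_neg hn'.le, div_eq_mul_inv]
      refine le_trans ?_ hEΛ
      rw [hA₀L]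
      calc _ ≤ L * (n : ℝ) ^ (-(p / 2)) * (n : ℝ) ^ (1 / (2 * s + 1)) := by
            gcongr; exact hlogt.trans hlogn
        _ = L * E₂ := by
            rw [mul_assoc, ← Real.rpow_add hn', hE₂]
            congr 2
            have : p = 2 := by linarith
            rw [this]; field_simp; ring
    · gcongr
      exact hgu.trans (huτ.trans hut)
  have b₁ : (Real.log n / n) ^ (p * s / (2 * s + 1)) * powInt (p * γ / (2 * s + 1)) t ≤
      (1 + |1 - p * γ / (2 * s + 1)|⁻¹) * (L * (Λ * E₂) + t) := by
    refine mul_powInt_le_add ht0 (by positivity) (hA₁.trans hEΛ) (fun hq => ?_) ?_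
    · have hΛl : Λ = Real.log n := by rw [hΛ, critLog, if_pos hq]
      calc _ ≤ L * E₂ * Real.log n :=
            (mul_le_mul_of_nonneg_left hlogt (by positivity)).trans
              (mul_le_mul_of_nonneg_right hA₁ (by linarith))
        _ = L * (Λ * E₂) := by rw [hΛl]; ring
    · calc (Real.log n / n) ^ (p * s / (2 * s + 1)) ≤ u ^ (p * s / (2 * s + 1)) := by gcongr
        _ = (u ^ s) ^ (p / (2 * s + 1)) := by rw [← Real.rpow_mul hu0.le]; congr 1; ring
        _ ≤ (t ^ γ) ^ (p / (2 * s + 1)) := by gcongr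
        _ = t ^ (p * γ / (2 * s + 1)) := by rw [← Real.rpow_mul ht0.le]; congr 1; ring
  have b₂ : u ^ (p * s) * powInt (p * γ) t ≤ (1 + |1 - p * γ|⁻¹) * (L * (Λ * E₂) + t) := by
    refine mul_powInt_le_add ht0 (by positivity) (hupw1.trans (hE₂L.trans hEΛ)) (fun hq => ?_) ?_
    · exact ((mul_le_mul_of_nonneg_left hlogt (by positivity)).trans hupw).trans (hE₂L.trans hEΛ)
    · calc u ^ (p * s) = (u ^ s) ^ p := by rw [← Real.rpow_mul hu0.le]; congr 1; ring
        _ ≤ (t ^ γ) ^ p := by gcongr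
        _ = t ^ (p * γ) := by rw [← Real.rpow_mul ht0.le]; congr 1; ring
  have hX0 : 0 ≤ L * (Λ * E₂) := by positivity
  have hXY : L * (Λ * E₂) + t ≤ R * (L * (Λ * E₂) + u ^ τ) := by
    have := le_mul_of_one_le_left hX0 hR1
    rw [mul_add, ← ht]; linarith
  have hXt : L * (Λ * E₂) ≤ L * (Λ * E₂) + t := le_add_of_nonneg_right ht0.le
  have htX : t ≤ L * (Λ * E₂) + t := le_add_of_nonneg_left hX0
  refine (sum_le_const_mul_three (C := Cc) hT0 hCb.le hCc.le (by positivity) (by positivity)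
    ((hA₀.trans hEΛ).trans hXt) ((hA₁.trans hEΛ).trans hXt)
    ((hupw1.trans (hE₂L.trans hEΛ)).trans hXt) ?_ b₀ b₁ b₂).trans ?_
  · rw [mul_comm]; gcongr
  · rw [mul_assoc _ R]; gcongr

end Rates

/-! ### Bias bounds for the piecewise classes -/

theorem isOpen_openIv (A B : EReal) : IsOpen (openIv A B) :=
  (isOpen_lt continuous_const continuous_coe_real_ereal).inter
    (isOpen_lt continuous_coe_real_ereal continuous_const)

theorem openIv_subset_closedIv (A B : EReal) : openIv A B ⊆ closedIv A B :=
  fun _ h => ⟨h.1.le, h.2.le⟩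

theorem strictFloor_lt {α : ℝ} {r : ℕ} (hr : 1 ≤ r) (hα : α ≤ r) : strictFloor α < r := by
  have := Nat.ceil_le.2 hα
  unfold strictFloor
  omega

theorem nodes_zero (A B : EReal) {m : ℕ} (x : Fin m → ℝ) : nodes A B x 0 = A := rfl

theorem nodes_last (A B : EReal) {m : ℕ} (x : Fin m → ℝ) :
    nodes A B x (Fin.last (m + 1)) = B := by
  rw [nodes, ← Fin.succ_last, Fin.cons_succ, Fin.snoc_last]

theorem nodes_eq (A B : EReal) {m : ℕ} (x : Fin m → ℝ) (j : Fin (m + 2)) :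
    nodes A B x j = A ∨ nodes A B x j = B ∨ ∃ k, nodes A B x j = (x k : EReal) := by
  refine Fin.cases (Or.inl rfl) (fun i => Or.inr ?_) j
  rw [nodes, Fin.cons_succ]
  refine Fin.lastCases (Or.inl ?_) (fun k => Or.inr ⟨k, ?_⟩) i
  · rw [Fin.snoc_last]
  · rw [Fin.snoc_castSucc]

/-- A point strictly between the first and the last node, and distinct from every node, lies
strictly between two consecutive ones. -/
theorem exists_nodes_lt_lt {α : Type*} [LinearOrder α] {k : ℕ} (u : Fin (k + 1) → α) {y : α}
    (h0 : u 0 < y) (h1 : y < u (Fin.last k)) (hne : ∀ j, u j ≠ y) :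
    ∃ i : Fin k, u i.castSucc < y ∧ y < u i.succ := by
  by_contra! hcon
  have key : ∀ j : Fin (k + 1), u j < y := by
    intro j
    induction j using Fin.induction with
    | zero => exact h0
    | succ i ih => exact lt_of_le_of_ne (hcon i ih) (hne _)
  exact lt_asymm h1 (key _)

/-- The nodes enclosing `y` are either end points of `I`, excluded by the window lying in `I`, or
break points, at distance at least `ρ > h`. -/
theorem Icc_subset_piece {A B : EReal} {m : ℕ} {x : Fin m → ℝ} {y ρ h : ℝ} (hh : 0 < h)
    (hhρ : h < ρ) (hw : Icc (y - h) (y + h) ⊆ openIv A B) (hρ : ∀ i, ρ ≤ |y - x i|) :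
    ∃ i : Fin (m + 1), Icc (y - h) (y + h) ⊆
      openIv (nodes A B x i.castSucc) (nodes A B x i.succ) := by
  have hy : y ∈ openIv A B := hw ⟨by linarith, by linarith⟩
  have hne : ∀ j, nodes A B x j ≠ (y : EReal) := by
    intro j
    rcases nodes_eq A B x j with h | h | ⟨k, h⟩ <;> rw [h]
    · exact hy.1.ne
    · exact hy.2.ne'
    · intro hxy
      have := hρ k
      rw [EReal.coe_eq_coe_iff.1 hxy, sub_self, abs_zero] at this
      linarith
  obtain ⟨i, hi1, hi2⟩ := exists_nodes_lt_lt (nodes A B x) (y := (y : EReal))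
    (by rw [nodes_zero]; exact hy.1) (by rw [nodes_last]; exact hy.2) hne
  have hl : (y - h : ℝ) ∈ openIv A B := hw ⟨le_rfl, by linarith⟩
  have hr : (y + h : ℝ) ∈ openIv A B := hw ⟨by linarith, le_rfl⟩
  have h1 : nodes A B x i.castSucc < ((y - h : ℝ) : EReal) := by
    rcases nodes_eq A B x i.castSucc with e | e | ⟨k, e⟩ <;> rw [e] at hi1 ⊢
    · exact hl.1
    · exact absurd hy.2 hi1.not_gt
    · have h3 := EReal.coe_lt_coe_iff.1 hi1
      have h4 := hρ k
      rw [abs_of_pos (by linarith)] at h4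
      exact EReal.coe_lt_coe_iff.2 (by linarith)
  have h2 : ((y + h : ℝ) : EReal) < nodes A B x i.succ := by
    rcases nodes_eq A B x i.succ with e | e | ⟨k, e⟩ <;> rw [e] at hi2 ⊢
    · exact absurd hy.1 hi2.not_gt
    · exact hr.2
    · have h3 := EReal.coe_lt_coe_iff.1 hi2
      have h4 := hρ k
      rw [abs_of_neg (by linarith)] at h4
      exact EReal.coe_lt_coe_iff.2 (by linarith)
  exact ⟨i, fun z hz => ⟨h1.trans_le (EReal.coe_le_coe_iff.2 hz.1),
    (EReal.coe_le_coe_iff.2 hz.2).trans_lt h2⟩⟩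

theorem window_subset {δ c d y h : ℝ} {S : Set ℝ} (hδ : 0 < δ) (hS : Ioo (c - δ) (d + δ) ⊆ S)
    (hy : y ∈ Icc c d) (hh : h ≤ min (δ / 2) 1) : Icc (y - h) (y + h) ⊆ S := by
  have h1 : h ≤ δ / 2 := hh.trans (min_le_left _ _)
  exact fun z hz => hS ⟨by linarith [hz.1, hy.1], by linarith [hz.2, hy.2]⟩

section Classes

variable {K : ℝ → ℝ} {r : ℕ} {b L M δ β c d : ℝ} {A B : EReal} {m : ℕ} {x : Fin m → ℝ}
  {f : ℝ → ℝ}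

theorem biasBounds_of_holder (hK : IsKernelOfOrder K r) (hb : ∀ u, |K u| ≤ b) (hf : IsDensity f)
    (hL : 0 ≤ L) (hβ : 0 ≤ β) (hβr : β ≤ r) (hδ : 0 < δ)
    (hI : Ioo (c - δ) (d + δ) ⊆ openIv A B) (hfh : f ∈ Holder β L M (openIv A B))
    {s γ C₁ : ℝ} (hC₁ : 2 * b * L ≤ C₁)
    (hloc : ∀ y ∈ Icc c d, ∀ ρ, 0 < ρ → ρ ≤ 1 → (∀ i, ρ ≤ |y - x i|) →
      ∀ h, 0 < h → h ≤ ρ / 2 → h ≤ min (δ / 2) 1 → Icc (y - h) (y + h) ⊆ openIv A B →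
      |kmean K f h y - f y| ≤ C₁ * h ^ s * ρ ^ (-γ)) :
    BiasBounds K f M (min (δ / 2) 1) C₁ β s γ c d x where
  le_bound y hy z hz := by
    have h1 := abs_le.1 hz
    exact (le_abs_self _).trans (hfh.2.1 z
      (window_subset hδ hI hy le_rfl ⟨by linarith, by linarith⟩))
  bias_le y hy h hh hhδ := by
    refine (abs_bias_le_of_holder hK hb hf.measurable hβ hL (strictFloor_lt hK.order_pos hβr)
      (isOpen_openIv A B) subset_rfl hfh (eqOn_refl _ _) hh (hhδ.trans (min_le_right _ _))
      (window_subset hδ hI hy hhδ)).trans ?_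
    gcongr
  bias_le_of_dist y hy ρ hρ0 hρ1 hρ h hh hhρ hhδ :=
    hloc y hy ρ hρ0 hρ1 hρ h hh hhρ hhδ (window_subset hδ hI hy hhδ)

theorem biasBounds_of_pwHolder (hK : IsKernelOfOrder K r) (hb : ∀ u, |K u| ≤ b)
    (hf : IsDensity f) (hL : 0 ≤ L) (hβ : 0 ≤ β) {α : ℝ} (hβα : β < α) (hαr : α ≤ r)
    (hδ : 0 < δ) (hI : Ioo (c - δ) (d + δ) ⊆ openIv A B)
    (hfh : f ∈ PwHolder A B x α L M ∩ Holder β L M (openIv A B)) :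
    BiasBounds K f M (min (δ / 2) 1) (2 * b * L + 1) β α 0 c d x := by
  have hb0 : 0 ≤ b := (abs_nonneg _).trans (hb 0)
  refine biasBounds_of_holder hK hb hf hL hβ (hβα.le.trans hαr) hδ hI hfh.2 (by linarith)
    fun y hy ρ hρ0 hρ1 hρ h hh hhρ hhδ hw => ?_
  obtain ⟨i, hi⟩ := Icc_subset_piece hh (by linarith : h < ρ) hw hρ
  obtain ⟨g, hg, hfg⟩ := hfh.1.2 i
  refine (abs_bias_le_of_holder hK hb hf.measurable (hβ.trans hβα.le) hL
    (strictFloor_lt hK.order_pos hαr) (isOpen_openIv _ _) (openIv_subset_closedIv _ _) hg hfg hh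
    (hhδ.trans (min_le_right _ _)) hi).trans ?_
  rw [neg_zero, Real.rpow_zero, mul_one]
  gcongr
  linarith

/-- A window of radius at most `ρ / 2` stays at distance `ρ / 2` from the break points, so the
derivative there is at most `L * (ρ / 2) ^ (-γ)`; this is the source of the factor `2 ^ γ`. -/
theorem biasBounds_of_pwDiff (hK : IsKernelOfOrder K r) (hb : ∀ u, |K u| ≤ b)
    (hf : IsDensity f) (hL : 0 ≤ L) (hβ : 0 ≤ β) {ℓ : ℕ} {γ : ℝ} (hβℓ : β < ℓ) (hℓr : ℓ ≤ r)
    (hγ : 0 < γ) (hδ : 0 < δ) (hI : Ioo (c - δ) (d + δ) ⊆ openIv A B)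
    (hfh : f ∈ PwDiff A B x ℓ γ L M ∩ Holder β L M (openIv A B)) :
    BiasBounds K f M (min (δ / 2) 1) (2 * b * L * 2 ^ γ + 1) β ℓ γ c d x := by
  have hb0 : 0 ≤ b := (abs_nonneg _).trans (hb 0)
  have h2γ : (1 : ℝ) ≤ 2 ^ γ := Real.one_le_rpow one_le_two hγ.le
  have hℓ : 1 ≤ ℓ := by
    have : (0 : ℝ) < ℓ := hβ.trans_lt hβℓ
    exact_mod_cast this
  refine biasBounds_of_holder hK hb hf hL hβ (hβℓ.le.trans (by exact_mod_cast hℓr)) hδ hI hfh.2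
    ?_ fun y hy ρ hρ0 hρ1 hρ h hh hhρ hhδ hw => ?_
  · have := le_mul_of_one_le_right (show 0 ≤ 2 * b * L by positivity) h2γ
    linarith
  have hρ2 : (1 : ℝ) ≤ (ρ / 2) ^ (-γ) :=
    Real.one_le_rpow_of_pos_of_le_one_of_nonpos (by positivity) (by linarith) (by linarith)
  refine (abs_bias_le_of_deriv hK hb hf.measurable (Q := L * (ρ / 2) ^ (-γ)) hℓ hℓr hh
    fun z hz => ?_).trans ?_
  · have hdist : ∀ i, ρ / 2 ≤ |z - x i| := fun i => by
      have h1 : |y - z| ≤ h := abs_le.2 ⟨by linarith [hz.2], by linarith [hz.1]⟩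
      have h2 := abs_sub_le y z (x i)
      linarith [hρ i]
    have hzx : z ∉ range x := by
      rintro ⟨i, rfl⟩
      have := hdist i
      rw [sub_self, abs_zero] at this
      linarith
    obtain ⟨h1, h2⟩ := hfh.1.2.2 z (hw hz) hzx
    refine ⟨h1, h2.trans (mul_le_mul_of_nonneg_left (max_le ?_ hρ2) hL)⟩
    -- For `m = 0` the supremum is 0, which is why nonnegativity of the bound is also required.
    exact Real.iSup_le (fun i => Real.rpow_le_rpow_of_nonpos (by positivity) (hdist i)
      (by linarith)) (by positivity)
  · have e : (ρ / 2) ^ (-γ) = 2 ^ γ * ρ ^ (-γ) := by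
      rw [Real.div_rpow hρ0.le zero_le_two, Real.rpow_neg zero_le_two, div_inv_eq_mul, mul_comm]
    rw [e, Real.rpow_natCast]
    calc 2 * b * (L * (2 ^ γ * ρ ^ (-γ))) * h ^ ℓ = (2 * b * L * 2 ^ γ) * h ^ ℓ * ρ ^ (-γ) := by
          ring
      _ ≤ _ := by gcongr; linarith

end Classes

/-! ### Uniform risk bounds over a class -/

section RiskBounds

variable {K : ℝ → ℝ} {r : ℕ} {p a M D₁ D₂ : ℝ}

theorem exists_kernel_bound (hK : IsKernelOfOrder K r) :
    ∃ b, 0 ≤ b ∧ ∀ u, |K u| ≤ b := by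
  obtain ⟨b, hb⟩ := hK.bounded
  exact ⟨b, (abs_nonneg _).trans (hb 0), hb⟩

theorem RiskBound.mono_rate {T δ : ℝ} {m : ℕ} {F : EReal → EReal → (Fin m → ℝ) → Set (ℝ → ℝ)}
    {rate rate' : ℕ → ℝ} (h : RiskBound K a M D₁ D₂ p T δ m F rate) {C' : ℝ} (hC' : 0 < C')
    {n₁ : ℕ} (hle : ∀ n, n₁ ≤ n → rate n ≤ C' * rate' n) :
    RiskBound K a M D₁ D₂ p T δ m F rate' := by
  obtain ⟨C, hC, n₀, h⟩ := h
  refine ⟨C * C', by positivity, max n₀ n₁, fun A B c d hcd hT hI x f hf hfF n hn =>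
    (h A B c d hcd hT hI x f hf hfF n ((le_max_left _ _).trans hn)).trans
      (ENNReal.ofReal_le_ofReal ?_)⟩
  rw [mul_assoc]
  gcongr
  exact hle n ((le_max_right _ _).trans hn)

/-- Classes whose members have uniformly controlled bias. -/
def HasBiasBounds (K : ℝ → ℝ) (M δ β s γ : ℝ) {m : ℕ}
    (F : EReal → EReal → (Fin m → ℝ) → Set (ℝ → ℝ)) : Prop :=
  ∃ C₁ : ℝ, 0 < C₁ ∧ ∀ (A B : EReal) (c d : ℝ), Ioo (c - δ) (d + δ) ⊆ openIv A B →
    ∀ (x : Fin m → ℝ) (f : ℝ → ℝ), IsDensity f → f ∈ F A B x →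
    BiasBounds K f M (min (δ / 2) 1) C₁ β s γ c d x

theorem hasBiasBounds_pwHolder (hK : IsKernelOfOrder K r) {L δ β α : ℝ} (hL : 0 < L) (hδ : 0 < δ)
    (hβ : 0 ≤ β) (hβα : β < α) (hαr : α ≤ r) (m : ℕ) :
    HasBiasBounds K M δ β α 0 (m := m)
      (fun A B x => PwHolder A B x α L M ∩ Holder β L M (openIv A B)) := by
  obtain ⟨b, hb0, hb⟩ := exists_kernel_bound hK
  exact ⟨2 * b * L + 1, by positivity, fun A B c d hI x f hf hfF =>
    biasBounds_of_pwHolder hK hb hf hL.le hβ hβα hαr hδ hI hfF⟩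

theorem hasBiasBounds_pwDiff (hK : IsKernelOfOrder K r) {L δ β γ : ℝ} {ℓ : ℕ} (hL : 0 < L)
    (hδ : 0 < δ) (hβ : 0 ≤ β) (hβℓ : β < ℓ) (hℓr : ℓ ≤ r) (hγ : 0 < γ) (m : ℕ) :
    HasBiasBounds K M δ β ℓ γ (m := m)
      (fun A B x => PwDiff A B x ℓ γ L M ∩ Holder β L M (openIv A B)) := by
  obtain ⟨b, hb0, hb⟩ := exists_kernel_bound hK
  exact ⟨2 * b * L * 2 ^ γ + 1, by positivity, fun A B c d hI x f hf hfF =>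
    biasBounds_of_pwDiff hK hb hf hL.le hβ hβℓ hℓr hγ hδ hI hfF⟩

theorem HasBiasBounds.riskBound_of_pos (hK : IsKernelOfOrder K r) (hp : 1 ≤ p) (ha : 1 < a)
    (ha2 : a ≤ 2) (hD₁ : 1 ≤ D₁) (hD₂ : 4 * p < D₂) (hM : 0 < M) {β s γ δ : ℝ} (τ T : ℝ) {m : ℕ}
    {F : EReal → EReal → (Fin m → ℝ) → Set (ℝ → ℝ)} (hF : HasBiasBounds K M δ β s γ F)
    (hβ : 0 < β) (hβs : β < s) (hγ : 0 ≤ γ) (hτ : 0 < τ) (hτ1 : τ ≤ 1) (hγτ : γ * τ ≤ s - β)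
    (hδ : 0 < δ) :
    RiskBound K a M D₁ D₂ p T δ m F (fun n => Real.log n ^ (p / 2) *
        ((n : ℝ) ^ (-((p * β + τ) / (2 * β + 1))) +
          critLog p s γ n * (n : ℝ) ^ (-(p * s / (2 * s + 1))))) := by
  obtain ⟨C₁, hC₁, hF⟩ := hF
  obtain ⟨C, hC, n₀, -, h⟩ := exists_rate_of_pos hK hp ha ha2 hD₁ hD₂ hM hβ hβs hγ hτ hτ1 hγτ
    (show 0 < min (δ / 2) 1 by positivity) (min_le_right _ _) hC₁ T m
  exact ⟨C, hC, n₀, fun A B c d hcd hT hI x f hf hfF n hn =>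
    h n hn f hf x c d hcd hT (hF A B c d hI x f hf hfF)⟩

theorem HasBiasBounds.riskBound_of_zero (hK : IsKernelOfOrder K r) (hp : 1 ≤ p) (ha : 1 < a)
    (ha2 : a ≤ 2) (hD₁ : 1 ≤ D₁) (hD₂ : 4 * p < D₂) (hM : 0 < M) {s γ δ : ℝ} (τ T : ℝ) {m : ℕ}
    {F : EReal → EReal → (Fin m → ℝ) → Set (ℝ → ℝ)} (hF : HasBiasBounds K M δ 0 s γ F)
    (hs : 0 < s) (hγ : 0 ≤ γ) (hτ : 0 < τ) (hτ1 : τ ≤ 1) (hγτ : γ * τ ≤ s) (hδ : 0 < δ) :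
    RiskBound K a M D₁ D₂ p T δ m F (fun n => Real.log n ^ (p / 2) *
          (critLog p s γ n * (n : ℝ) ^ (-(p * s / (2 * s + 1)))) + (Real.log n ^ 3 / n) ^ τ) := by
  obtain ⟨C₁, hC₁, hF⟩ := hF
  obtain ⟨C, hC, n₀, -, h⟩ := exists_rate_of_zero hK hp ha ha2 hD₁ hD₂ hM hs hγ hτ hτ1 hγτ
    (show 0 < min (δ / 2) 1 by positivity) (min_le_right _ _) hC₁ T m
  exact ⟨C, hC, n₀, fun A B c d hcd hT hI x f hf hfF n hn =>
    h n hn f hf x c d hcd hT (hF A B c d hI x f hf hfF)⟩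

end RiskBounds

/-! ### Absorption of the remainder and conclusion -/

theorem critLog_le_log (p s γ : ℝ) {n : ℕ} (hn : 3 ≤ n) : critLog p s γ n ≤ Real.log n := by
  unfold critLog
  split_ifs
  · exact le_rfl
  · exact (one_lt_log_of_three_le hn).le

theorem critLog_zero (p s : ℝ) (n : ℕ) : critLog p s 0 n = 1 := by
  simp [critLog]

/-- The remainder `(log³ n / n) ^ τ` is negligible when `τ` exceeds the exponent of the rate. -/
theorem exists_log_cube_div_rpow_le {τ e : ℝ} (h : e < τ) :
    ∃ n₀ : ℕ, 3 ≤ n₀ ∧ ∀ n : ℕ, n₀ ≤ n → (Real.log n ^ 3 / n) ^ τ ≤ (n : ℝ) ^ (-e) := by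
  obtain ⟨n₀, hn₀, h⟩ := exists_nat_log_rpow_le (3 * τ) (sub_pos.2 h) one_pos
  refine ⟨n₀, hn₀, fun n hn => ?_⟩
  have hlog := one_lt_log_of_three_le (hn₀.trans hn)
  have hn' : (0 : ℝ) < n := by have := hn₀.trans hn; positivity
  rw [Real.div_rpow (by positivity) hn'.le, ← Real.rpow_natCast, ← Real.rpow_mul (by linarith),
    div_le_iff₀ (by positivity), ← Real.rpow_add hn']
  refine (h n hn).trans (le_of_eq ?_)
  rw [one_mul]
  congr 1
  ring

theorem log_cube_div_rpow_le_of_le {n : ℕ} (hn : 3 ≤ n) {τ q : ℝ} (h : 3 * τ ≤ q) :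
    (Real.log n ^ 3 / n) ^ τ ≤ Real.log n ^ q * (n : ℝ) ^ (-τ) := by
  have hlog := one_lt_log_of_three_le hn
  have hn' : (0 : ℝ) < n := by positivity
  rw [Real.div_rpow (by positivity) hn'.le, Real.rpow_neg hn'.le, ← Real.rpow_natCast,
    ← Real.rpow_mul (by linarith), ← div_eq_mul_inv]
  have := Real.rpow_le_rpow_of_exponent_le hlog.le h
  push_cast
  gcongr

/-- Either the main rate has an exponent below 1 and dominates by a power of `n`, or `p / 2 ≥ 3` and
the prefactor already contains `log³ n`. -/
theorem exists_log_cube_div_le {p s : ℝ} (hs : 0 ≤ s) (h : p * s < 2 * s + 1 ∨ 6 ≤ p) (hp : 0 ≤ p) :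
    ∃ n₀ : ℕ, 3 ≤ n₀ ∧ ∀ n : ℕ, n₀ ≤ n → (Real.log n ^ 3 / n) ^ (1 : ℝ) ≤
      Real.log n ^ (p / 2) * ((n : ℝ) ^ (-1 : ℝ) + (n : ℝ) ^ (-(p * s / (2 * s + 1)))) := by
  rcases h with h | h
  · obtain ⟨n₀, hn₀, hle⟩ := exists_log_cube_div_rpow_le
      (show p * s / (2 * s + 1) < 1 by rwa [div_lt_one (by linarith)])
    refine ⟨n₀, hn₀, fun n hn => (hle n hn).trans ?_⟩
    have hlog := one_lt_log_of_three_le (hn₀.trans hn)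
    have hL := Real.one_le_rpow hlog.le (show 0 ≤ p / 2 by linarith)
    exact (le_add_of_nonneg_left (by positivity)).trans
      (le_mul_of_one_le_left (by positivity) hL)
  · refine ⟨3, le_rfl, fun n hn => (log_cube_div_rpow_le_of_le hn (q := p / 2)
      (by linarith)).trans ?_⟩
    have hlog := one_lt_log_of_three_le hn
    gcongr
    exact le_add_of_nonneg_right (by positivity)

/-- The same dichotomy with `τ = s / γ`: the first condition is `p * s / (2 * s + 1) < τ`, the
second is `3 * τ ≤ p / 2 + 1`. -/
theorem exists_log_cube_div_rpow_div_le {p s γ : ℝ} (hs : 0 < s) (hγ : 0 < γ)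
    (h : p * γ < 2 * s + 1 ∨ 6 * s ≤ (p + 2) * γ) (hp : 0 ≤ p) :
    ∃ n₀ : ℕ, 3 ≤ n₀ ∧ ∀ n : ℕ, n₀ ≤ n → (Real.log n ^ 3 / n) ^ (s / γ) ≤
      Real.log n ^ (p / 2 + 1) *
        ((n : ℝ) ^ (-(s / γ)) + (n : ℝ) ^ (-(p * s / (2 * s + 1)))) := by
  rcases h with h | h
  · obtain ⟨n₀, hn₀, hle⟩ := exists_log_cube_div_rpow_le
      (show p * s / (2 * s + 1) < s / γ by
        rw [div_lt_div_iff₀ (by linarith) hγ]; nlinarith)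
    refine ⟨n₀, hn₀, fun n hn => (hle n hn).trans ?_⟩
    have hlog := one_lt_log_of_three_le (hn₀.trans hn)
    have hL := Real.one_le_rpow hlog.le (show 0 ≤ p / 2 + 1 by linarith)
    exact (le_add_of_nonneg_left (by positivity)).trans
      (le_mul_of_one_le_left (by positivity) hL)
  · refine ⟨3, le_rfl, fun n hn => (log_cube_div_rpow_le_of_le hn (q := p / 2 + 1) ?_).trans ?_⟩
    · rw [mul_div_assoc', div_le_iff₀ hγ]; linarith
    · have hlog := one_lt_log_of_three_le hn
      gcongr
      exact le_add_of_nonneg_right (by positivity)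

/-- Absorbing the remainder of a bound into its main term. -/
theorem RiskBound.absorb {K : ℝ → ℝ} {a M D₁ D₂ p T δ : ℝ} {m : ℕ}
    {F : EReal → EReal → (Fin m → ℝ) → Set (ℝ → ℝ)} {rate u : ℕ → ℝ}
    (h : RiskBound K a M D₁ D₂ p T δ m F (fun n => rate n + u n)) {n₁ : ℕ}
    (hu : ∀ n, n₁ ≤ n → u n ≤ rate n) : RiskBound K a M D₁ D₂ p T δ m F rate :=
  RiskBound.mono_rate h two_pos fun n hn => by linarith [hu n hn]

theorem corollary1 (K : ℝ → ℝ) (r : ℕ) (hK : IsKernelOfOrder K r)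
    (p a D₁ D₂ : ℝ) (hp : 1 ≤ p) (ha : 1 < a) (ha2 : a ≤ 2) (hD₁ : 1 ≤ D₁) (hD₂ : 4 * p < D₂)
    (L M : ℝ) (hL : 0 < L) (hM : 0 < M) (T δ : ℝ) (hδ : 0 < δ) (m : ℕ)
    (β : ℝ) (hβ : 0 ≤ β) :
    -- piecewise Hölder densities
    (∀ α : ℝ, β < α → α ≤ r →
      ((0 < β ∨ p * α < 2 * α + 1 ∨ 6 ≤ p) →
        RiskBound K a M D₁ D₂ p T δ m
          (fun A B x => PwHolder A B x α L M ∩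
            Holder β L M (openIv A B))
          (fun n => Real.log n ^ (p / 2) *
            ((n : ℝ) ^ (-((1 + p * β) / (1 + 2 * β))) + (n : ℝ) ^ (-(p * α / (2 * α + 1)))))) ∧
      (β = 0 →
        RiskBound K a M D₁ D₂ p T δ m
          (fun A B x => PwHolder A B x α L M ∩
            Holder β L M (openIv A B))
          (fun n => Real.log n ^ (p / 2) *
            ((n : ℝ) ^ (-((1 + p * β) / (1 + 2 * β))) + (n : ℝ) ^ (-(p * α / (2 * α + 1)))) +
            Real.log n ^ 3 / n))) ∧
    -- piecewise differentiable densities, first regime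
    (∀ (ℓ : ℕ) (γ : ℝ), β < ℓ → ℓ ≤ r → 0 < γ → γ ≤ ℓ - β →
      ((0 < β ∨ p * ℓ < 2 * ℓ + 1 ∨ 6 ≤ p) →
        RiskBound K a M D₁ D₂ p T δ m
          (fun A B x => PwDiff A B x ℓ γ L M ∩
            Holder β L M (openIv A B))
          (fun n => Real.log n ^ (p / 2) *
            ((n : ℝ) ^ (-((1 + p * β) / (1 + 2 * β))) +
              Real.log n * (n : ℝ) ^ (-(p * ℓ / (2 * ℓ + 1)))))) ∧
      (β = 0 →
        RiskBound K a M D₁ D₂ p T δ m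
          (fun A B x => PwDiff A B x ℓ γ L M ∩
            Holder β L M (openIv A B))
          (fun n => Real.log n ^ (p / 2) *
            ((n : ℝ) ^ (-((1 + p * β) / (1 + 2 * β))) +
              Real.log n * (n : ℝ) ^ (-(p * ℓ / (2 * ℓ + 1)))) +
            Real.log n ^ 3 / n))) ∧
    -- piecewise differentiable densities, second regime
    (∀ (ℓ : ℕ) (γ : ℝ), β < ℓ → ℓ ≤ r → 0 < γ → ℓ - β < γ →
      ((0 < β ∨ p * γ < 2 * ℓ + 1 ∨ 6 * ℓ ≤ (p + 2) * γ) →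
        RiskBound K a M D₁ D₂ p T δ m
          (fun A B x => PwDiff A B x ℓ γ L M ∩
            Holder β L M (openIv A B))
          (fun n => Real.log n ^ (p / 2 + 1) *
            ((n : ℝ) ^ (-(p * β / (1 + 2 * β) + (ℓ - β) / γ / (2 * β + 1))) +
              (n : ℝ) ^ (-(p * ℓ / (2 * ℓ + 1)))))) ∧
      (β = 0 →
        RiskBound K a M D₁ D₂ p T δ m
          (fun A B x => PwDiff A B x ℓ γ L M ∩
            Holder β L M (openIv A B))
          (fun n => Real.log n ^ (p / 2 + 1) *
            ((n : ℝ) ^ (-(p * β / (1 + 2 * β) + (ℓ - β) / γ / (2 * β + 1))) +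
              (n : ℝ) ^ (-(p * ℓ / (2 * ℓ + 1)))) +
            (Real.log n ^ 3 / n) ^ ((ℓ : ℝ) / γ)))) := by
  have hp0 : 0 ≤ p := by linarith
  refine ⟨fun α hα hαr => ?_, fun ℓ γ hℓ hℓr hγ hγℓ => ?_, fun ℓ γ hℓ hℓr hγ hγℓ => ?_⟩
  · have hF := hasBiasBounds_pwHolder (M := M) hK hL hδ hβ hα hαr m
    have hα0 : 0 < α := hβ.trans_lt hα
    have hzero : β = 0 → RiskBound K a M D₁ D₂ p T δ m
        (fun A B x => PwHolder A B x α L M ∩ Holder β L M (openIv A B))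
        (fun n => Real.log n ^ (p / 2) *
          ((n : ℝ) ^ (-((1 + p * β) / (1 + 2 * β))) + (n : ℝ) ^ (-(p * α / (2 * α + 1)))) +
          Real.log n ^ 3 / n) := by
      rintro rfl
      refine RiskBound.mono_rate (hF.riskBound_of_zero hK hp ha ha2 hD₁ hD₂ hM 1 T hα0 le_rfl
        one_pos le_rfl (by linarith) hδ) one_pos (n₁ := 3) fun n hn => ?_
      have hlog := one_lt_log_of_three_le hn
      rw [critLog_zero, one_mul, one_mul, Real.rpow_one]
      gcongr
      exact le_add_of_nonneg_left (by positivity)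
    refine ⟨fun h => ?_, hzero⟩
    rcases hβ.eq_or_lt with rfl | hβ0
    · obtain ⟨n₀, -, hle⟩ := exists_log_cube_div_le hα0.le (h.resolve_left (lt_irrefl _)) hp0
      refine RiskBound.absorb (hzero rfl) (n₁ := n₀) fun n hn => ?_
      simpa using hle n hn
    -- Here `γ = 0`, so `τ = 1` is allowed and the critical logarithm is absent.
    · refine RiskBound.mono_rate (hF.riskBound_of_pos hK hp ha ha2 hD₁ hD₂ hM 1 T hβ0 hα le_rfl
        one_pos le_rfl (by linarith) hδ) one_pos (n₁ := 3) fun n _ => ?_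
      rw [critLog_zero, one_mul, one_mul, add_comm (p * β), add_comm (2 * β)]
  · have hF := hasBiasBounds_pwDiff (M := M) hK hL hδ hβ hℓ hℓr hγ m
    have hℓ0 : (0 : ℝ) < ℓ := hβ.trans_lt hℓ
    have hzero : β = 0 → RiskBound K a M D₁ D₂ p T δ m
        (fun A B x => PwDiff A B x ℓ γ L M ∩ Holder β L M (openIv A B))
        (fun n => Real.log n ^ (p / 2) *
          ((n : ℝ) ^ (-((1 + p * β) / (1 + 2 * β))) +
            Real.log n * (n : ℝ) ^ (-(p * ℓ / (2 * ℓ + 1)))) + Real.log n ^ 3 / n) := by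
      rintro rfl
      refine RiskBound.mono_rate (hF.riskBound_of_zero hK hp ha ha2 hD₁ hD₂ hM 1 T hℓ0 hγ.le
        one_pos le_rfl (by linarith) hδ) one_pos (n₁ := 3) fun n hn => ?_
      have hlog := one_lt_log_of_three_le hn
      have hcrit := critLog_le_log p ℓ γ hn
      rw [one_mul, Real.rpow_one]
      gcongr
      refine le_trans ?_ (le_add_of_nonneg_left (by positivity))
      gcongr
    refine ⟨fun h => ?_, hzero⟩
    rcases hβ.eq_or_lt with rfl | hβ0
    · obtain ⟨n₀, hn₀, hle⟩ := exists_log_cube_div_le hℓ0.le (h.resolve_left (lt_irrefl _)) hp0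
      refine RiskBound.absorb (hzero rfl) (n₁ := n₀) fun n hn => ?_
      have hlog := one_lt_log_of_three_le (hn₀.trans hn)
      have h1 := hle n hn
      rw [Real.rpow_one] at h1
      refine h1.trans ?_
      rw [mul_zero, mul_zero, add_zero, div_one]
      gcongr
      exact le_mul_of_one_le_left (by positivity) hlog.le
    -- The regime `γ ≤ ℓ - β` still permits `τ = 1`; `critLog` is bounded by `log n` whether or not
    -- `γ` is critical.
    · refine RiskBound.mono_rate (hF.riskBound_of_pos hK hp ha ha2 hD₁ hD₂ hM 1 T hβ0 hℓ hγ.le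
        one_pos le_rfl (by linarith) hδ) one_pos (n₁ := 3) fun n hn => ?_
      have hlog := one_lt_log_of_three_le hn
      have hcrit := critLog_le_log p ℓ γ hn
      rw [one_mul, add_comm (p * β), add_comm (2 * β)]
      gcongr
  · have hF := hasBiasBounds_pwDiff (M := M) hK hL hδ hβ hℓ hℓr hγ m
    have hℓ0 : (0 : ℝ) < ℓ := hβ.trans_lt hℓ
    have hlogpow : ∀ n : ℕ, 3 ≤ n →
        Real.log n ^ (p / 2 + 1) = Real.log n ^ (p / 2) * Real.log n := fun n hn => by
      rw [Real.rpow_add_one (by linarith [one_lt_log_of_three_le hn])]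
    have hzero : β = 0 → RiskBound K a M D₁ D₂ p T δ m
        (fun A B x => PwDiff A B x ℓ γ L M ∩ Holder β L M (openIv A B))
        (fun n => Real.log n ^ (p / 2 + 1) *
          ((n : ℝ) ^ (-(p * β / (1 + 2 * β) + (ℓ - β) / γ / (2 * β + 1))) +
            (n : ℝ) ^ (-(p * ℓ / (2 * ℓ + 1)))) + (Real.log n ^ 3 / n) ^ ((ℓ : ℝ) / γ)) := by
      rintro rfl
      refine RiskBound.mono_rate (hF.riskBound_of_zero hK hp ha ha2 hD₁ hD₂ hM (ℓ / γ) T hℓ0 hγ.le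
        (by positivity) (by rw [div_le_one hγ]; linarith) (mul_div_cancel₀ _ hγ.ne').le hδ) one_pos
        (n₁ := 3) fun n hn => ?_
      have hlog := one_lt_log_of_three_le hn
      have hcrit := critLog_le_log p ℓ γ hn
      rw [one_mul, hlogpow n hn, mul_assoc (Real.log n ^ (p / 2))]
      gcongr
      exact le_add_of_nonneg_left (by positivity)
    refine ⟨fun h => ?_, hzero⟩
    rcases hβ.eq_or_lt with rfl | hβ0
    · obtain ⟨n₀, -, hle⟩ :=
        exists_log_cube_div_rpow_div_le hℓ0 hγ (h.resolve_left (lt_irrefl _)) hp0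
      refine RiskBound.absorb (hzero rfl) (n₁ := n₀) fun n hn => ?_
      simpa using hle n hn
    · have hτ : 0 < ((ℓ : ℝ) - β) / γ := div_pos (by linarith) hγ
      -- Now `(ℓ - β) / γ < 1` is the largest admissible `τ`.
      refine RiskBound.mono_rate (hF.riskBound_of_pos hK hp ha ha2 hD₁ hD₂ hM ((ℓ - β) / γ) T hβ0
        hℓ hγ.le hτ (by rw [div_le_one hγ]; linarith) (mul_div_cancel₀ _ hγ.ne').le hδ) one_pos
        (n₁ := 3) fun n hn => ?_
      have hlog := one_lt_log_of_three_le hn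
      have hcrit := critLog_le_log p ℓ γ hn
      rw [one_mul, hlogpow n hn, mul_assoc (Real.log n ^ (p / 2)), add_comm 1 (2 * β), ← add_div,
        mul_add (Real.log n)]
      gcongr
      exact le_mul_of_one_le_left (by positivity) hlog.le
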